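/- **Theorem.** Let $\mathbb H^d=\mathbb R^d\times\mathbb R^d\times\mathbb R$ be the Heisenberg group with the group law $(x,y,w)(x',y',w')=(x+x',y+y',w+w'+x\cdot y')$ and Lebesgue measure as Haar measure, and let $L_gf(q)=f(g^{-1}q)$ be left translation on $L^2(\mathbb H^d)$. For $S\subset\mathbb H^d$, a closed subspace $W\subset L^2(\mathbb H^d)$ is called $S$-invariant if $L_sf\in W$ for all $s\in S$ and $f\in W$. For $\lambda\in\mathbb R\setminus\{0\}$ let $\pi_\lambda(x,y,w)u(v)=e^{2\pi i\lambda w}e^{-2\pi i\lambda\, y\cdot v}u(v-x)$ be the Schrödinger representation on $L^2(\mathbb R^d)$. Let $f\mapsto\widehat f$ be the Plancherel transform from $L^2(\mathbb H^d)$ onto $L^2\big(\mathbb R,\mathcal{HS}(L^2(\mathbb R^d)),|\lambda|^d\,d\lambda\big)$, where $\mathcal{HS}$ denotes the Hilbert–Schmidt operators; that is, the unitary extension of $\widehat f(\lambda)=\int_{\mathbb H^d}f(g)\pi_\lambda(g)\,dg$, $f\in L^1\cap L^2(\mathbb H^d)$. For $f\in L^2(\mathbb H^d)$, a.e. $\xi\in[0,1)$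 and $n\in\mathbb Z$ put $\mathcal Tf(\xi)(n)=|\xi+n|^{d/2}\,\widehat f(\xi+n)$, so that $\mathcal Tf(\xi)\in\ell^2(\mathbb Z,\mathcal{HS}(L^2(\mathbb R^d)))$ for a.e. $\xi$. For a closed subspace $W$ invariant under the central translations by $\mathbb Z$, let $J_W$ be its range function: the (a.e. unique) measurable family of closed subspaces $J_W(\xi)\subset\ell^2(\mathbb Z,\mathcal{HS}(L^2(\mathbb R^d)))$, $\xi\in[0,1)$, such that $W=\{f\in L^2(\mathbb H^d):\mathcal Tf(\xi)\in J_W(\xi)\text{ for a.e. }\xi\in[0,1)\}$. Here measurable means that, for every vector $a$, the orthogonal projection of $a$ onto $J_W(\xi)$ is weakly measurable in $\xi$. Put $\dim_W(\xi)=\dim J_W(\xi)\in\{0,1,2,\dots\}\cup\{\infty\}$. Let $A,B\in GL(d,\mathbb R)$ be such that $AB^t$ has integer entries, let $N\ge1$ be an integer, and let $W$ be an $A\mathbb Z^d\times B\mathbb Z^d\times\mathbb Z$-invariant subspace of $L^2(\mathbb H^d)$. For $n\in\{0,1,\dots,N-1\}$ put $$V_n=\{f\in L^2(\mathbb H^d):\widehat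 f=\chi_{H_n}\,\widehat g\ \text{ for some } g\in W\},\qquad H_n=[n,n+1)+N\mathbb Z .$$ Then $W$ is $A\mathbb Z^d\times B\mathbb Z^d\times\frac1N\mathbb Z$-invariant if and only if $V_n\subset W$ for every $n\in\{0,\dots,N-1\}$. In this case the $V_n$ are $A\mathbb Z^d\times B\mathbb Z^d\times\mathbb Z$-invariant (in particular closed) subspaces, $W$ is their orthogonal direct sum, $W=\bigoplus_{n=0}^{N-1}V_n$, and $$\dim_W(\xi)=\sum_{n=0}^{N-1}\dim_{V_n}(\xi)\qquad\text{for a.e. }\xi\in[0,1).$$ -/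

import Mathlib

open MeasureTheory Filter Topology Set

noncomputable section

/-! ## The Heisenberg group and left translations -/

/-- The `d`-dimensional Heisenberg group, identified as a set with `ℝ^d × ℝ^d × ℝ`; an element is
written `(x, y, w)`. -/
def Heisenberg (d : ℕ) : Type :=
  EuclideanSpace ℝ (Fin d) × EuclideanSpace ℝ (Fin d) × ℝ

namespace Heisenberg

variable {d : ℕ}

/-- The group law `(x, y, w) (x', y', w') = (x + x', y + y', w + w' + x · y')`. -/
instance : Group (Heisenberg d) where
  mul g h := (g.1 + h.1, g.2.1 + h.2.1, g.2.2 + h.2.2 + inner ℝ g.1 h.2.1)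
  one := (0, 0, 0)
  inv g := (-g.1, -g.2.1, -g.2.2 + inner ℝ g.1 g.2.1)
  mul_assoc a b c := by
    refine Prod.ext (add_assoc _ _ _) (Prod.ext (add_assoc _ _ _) ?_)
    change a.2.2 + b.2.2 + inner ℝ a.1 b.2.1 + c.2.2 + inner ℝ (a.1 + b.1) c.2.1
      = a.2.2 + (b.2.2 + c.2.2 + inner ℝ b.1 c.2.1) + inner ℝ a.1 (b.2.1 + c.2.1)
    rw [inner_add_left, inner_add_right]; ring
  one_mul a := by
    refine Prod.ext (zero_add _) (Prod.ext (zero_add _) ?_)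
    change (0 : ℝ) + a.2.2 + inner ℝ (0 : EuclideanSpace ℝ (Fin d)) a.2.1 = a.2.2
    simp
  mul_one a := by
    refine Prod.ext (add_zero _) (Prod.ext (add_zero _) ?_)
    change a.2.2 + (0 : ℝ) + inner ℝ a.1 (0 : EuclideanSpace ℝ (Fin d)) = a.2.2
    simp
  inv_mul_cancel a := by
    refine Prod.ext (neg_add_cancel _) (Prod.ext (neg_add_cancel _) ?_)
    change -a.2.2 + inner ℝ a.1 a.2.1 + a.2.2 + inner ℝ (-a.1) a.2.1 = (0 : ℝ)
    rw [inner_neg_left]; ring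

/-- Lebesgue measure on `ℝ^d × ℝ^d × ℝ`, a Haar measure of the Heisenberg group. -/
instance : MeasureSpace (Heisenberg d) :=
  inferInstanceAs (MeasureSpace (EuclideanSpace ℝ (Fin d) × EuclideanSpace ℝ (Fin d) × ℝ))

theorem measurePreserving_mul_left (g : Heisenberg d) :
    MeasurePreserving (fun q : Heisenberg d => g * q) volume volume := by
  have h2 : MeasurePreserving (fun p : EuclideanSpace ℝ (Fin d) × ℝ =>
      (g.2.1 + p.1, g.2.2 + p.2 + inner ℝ g.1 p.1)) volume volume := by
    refine MeasurePreserving.skew_product (μa := volume) (μb := volume) (μc := volume)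
      (μd := volume) (g := fun (y : EuclideanSpace ℝ (Fin d)) (w : ℝ) =>
        g.2.2 + w + inner ℝ g.1 y) (measurePreserving_add_left volume g.2.1) ?_ ?_
    · exact Continuous.measurable (by fun_prop)
    · refine Eventually.of_forall fun y => ?_
      have h := (measurePreserving_add_left (volume : Measure ℝ)
        (g.2.2 + inner ℝ g.1 y)).map_eq
      refine Eq.trans ?_ h
      congr 1
      funext w
      ring
  exact (measurePreserving_add_left volume g.1).prod h2

end Heisenberg

/-- The Hilbert space `L²(ℍ^d)`. -/
abbrev HeisenbergL2 (d : ℕ) : Type :=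
  Lp ℂ 2 (volume : Measure (Heisenberg d))

/-- Left translation `(L_g f)(q) = f (g⁻¹ q)` on `L²(ℍ^d)`. -/
def leftTranslation {d : ℕ} (g : Heisenberg d) (f : HeisenbergL2 d) : HeisenbergL2 d :=
  Lp.compMeasurePreserving (fun q => g⁻¹ * q) (Heisenberg.measurePreserving_mul_left g⁻¹) f

/-- `W` is an `S`-invariant space: a closed subspace of `L²(ℍ^d)` with `L_s f ∈ W` for all
`s ∈ S` and `f ∈ W`. -/
def IsTranslationInvariant {d : ℕ} (S : Set (Heisenberg d)) (W : Submodule ℂ (HeisenbergL2 d)) :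
    Prop :=
  IsClosed (W : Set (HeisenbergL2 d)) ∧ ∀ s ∈ S, ∀ f ∈ W, leftTranslation s f ∈ W

/-- The set `Aℤ^d × Bℤ^d × Θ` in the Heisenberg group. -/
def translationSet {d : ℕ} (A B : Matrix (Fin d) (Fin d) ℝ) (Θ : AddSubgroup ℝ) :
    Set (Heisenberg d) :=
  {g | ∃ k l : Fin d → ℤ, ∃ θ ∈ Θ,
    g = (WithLp.toLp 2 (A.mulVec fun i => (k i : ℝ)),
      WithLp.toLp 2 (B.mulVec fun i => (l i : ℝ)), θ)}

/-! ## Hilbert-Schmidt operators -/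

section HilbertSchmidt

variable (H : Type*) [NormedAddCommGroup H] [InnerProductSpace ℂ H] [CompleteSpace H]

/-- Index set of a fixed Hilbert basis of `H`. -/
def hsIndex : Set H := (exists_hilbertBasis ℂ H).choose

/-- A fixed Hilbert basis of `H`. -/
def hsBasis : HilbertBasis (hsIndex H) ℂ H := (exists_hilbertBasis ℂ H).choose_spec.choose

/-- The subspace of Hilbert-Schmidt operators: those bounded `T` for which `∑ᵢ ‖T eᵢ‖² < ∞`, for
an orthonormal basis `(eᵢ)`. (The value of the sum does not depend on the basis.) -/
def hilbertSchmidtSubmodule : Submodule ℂ (H →L[ℂ] H) where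
  carrier := {T | Memℓp (fun i : hsIndex H => T (hsBasis H i)) 2}
  zero_mem' := zero_memℓp
  add_mem' hS hT := Memℓp.add hS hT
  smul_mem' c _ hT := Memℓp.const_smul hT c

/-- The Hilbert space `HS(H)` of Hilbert-Schmidt operators on `H` (with the Hilbert-Schmidt norm,
not the operator norm). -/
def HilbertSchmidt : Type _ := hilbertSchmidtSubmodule H

namespace HilbertSchmidt

instance : AddCommGroup (HilbertSchmidt H) :=
  inferInstanceAs (AddCommGroup (hilbertSchmidtSubmodule H))

instance : Module ℂ (HilbertSchmidt H) :=
  inferInstanceAs (Module ℂ (hilbertSchmidtSubmodule H))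

variable {H}

/-- The bounded operator underlying a Hilbert-Schmidt operator. -/
def toCLM (T : HilbertSchmidt H) : H →L[ℂ] H := Subtype.val T

variable (H)

/-- The map `T ↦ (T eᵢ)ᵢ` into `ℓ²(H)`, used to transport norm and inner product. -/
def toL2 : HilbertSchmidt H →ₗ[ℂ] lp (fun _ : hsIndex H => H) 2 where
  toFun T := ⟨fun i => T.toCLM (hsBasis H i), T.2⟩
  map_add' _ _ := rfl
  map_smul' _ _ := rfl

theorem toL2_injective : Function.Injective (toL2 H) := by
  intro S T h
  apply Subtype.ext
  change S.toCLM = T.toCLM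
  have hd : Dense ((Submodule.span ℂ (Set.range (hsBasis H)) : Submodule ℂ H) : Set H) := by
    rw [Submodule.dense_iff_topologicalClosure_eq_top]
    exact (hsBasis H).dense_span
  refine ContinuousLinearMap.ext_on hd ?_
  rintro _ ⟨i, rfl⟩
  exact congrFun (congrArg Subtype.val h) i

/-- The Hilbert-Schmidt norm `‖T‖² = ∑ᵢ ‖T eᵢ‖²`. -/
instance : NormedAddCommGroup (HilbertSchmidt H) :=
  NormedAddCommGroup.induced _ _ (toL2 H) (toL2_injective H)

/-- The Hilbert-Schmidt inner product `⟪S, T⟫ = ∑ᵢ ⟪S eᵢ, T eᵢ⟫ = tr (S* T)`. -/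
instance : InnerProductSpace ℂ (HilbertSchmidt H) where
  inner S T := inner ℂ (toL2 H S) (toL2 H T)
  norm_smul_le c T := by
    change ‖toL2 H (c • T)‖ ≤ ‖c‖ * ‖toL2 H T‖
    rw [map_smul]; exact norm_smul_le _ _
  norm_sq_eq_re_inner T := by
    change ‖toL2 H T‖ ^ 2 = _
    exact norm_sq_eq_re_inner (𝕜 := ℂ) (toL2 H T)
  conj_inner_symm S T := inner_conj_symm (toL2 H S) (toL2 H T)
  add_left S T U := by
    change inner ℂ (toL2 H (S + T)) (toL2 H U) = _
    rw [map_add]; exact inner_add_left _ _ _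
  smul_left S T c := by
    change inner ℂ (toL2 H (c • S)) (toL2 H T) = _
    rw [map_smul]; exact inner_smul_left _ _ _

end HilbertSchmidt

end HilbertSchmidt

/-! ## The Schrödinger representations and the Plancherel transform -/

/-- The Hilbert space `L²(ℝ^d)`. -/
abbrev EuclideanL2 (d : ℕ) : Type :=
  Lp ℂ 2 (volume : Measure (EuclideanSpace ℝ (Fin d)))

/-- The function `v ↦ e^{2πiλw} e^{-2πiλ y·v} u(v - x)`. -/
def schrodingerFun {d : ℕ} (lam : ℝ) (g : Heisenberg d) (u : EuclideanSpace ℝ (Fin d) → ℂ) :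
    EuclideanSpace ℝ (Fin d) → ℂ :=
  fun v => Complex.exp (2 * Real.pi * Complex.I * lam * g.2.2) *
    Complex.exp (-(2 * Real.pi * Complex.I * lam * (inner ℝ g.2.1 v : ℝ))) * u (v - g.1)

theorem memLp_schrodingerFun {d : ℕ} (lam : ℝ) (g : Heisenberg d) (u : EuclideanL2 d) :
    MemLp (schrodingerFun lam g u) 2 volume := by
  have hu : MemLp (fun v => u (v - g.1)) 2 volume :=
    (Lp.memLp u).comp_measurePreserving (measurePreserving_sub_right volume g.1)
  refine hu.of_le_mul (c := 1) ?_ (Eventually.of_forall fun v => ?_)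
  · refine AEStronglyMeasurable.mul (Continuous.aestronglyMeasurable ?_) hu.1
    fun_prop
  · have h1 : ‖Complex.exp (2 * Real.pi * Complex.I * lam * g.2.2)‖ = 1 := by
      rw [Complex.norm_exp]; simp
    have h2 : ‖Complex.exp (-(2 * Real.pi * Complex.I * lam * (inner ℝ g.2.1 v : ℝ)))‖ = 1 := by
      rw [Complex.norm_exp]; simp
    simp only [schrodingerFun, norm_mul, h1, h2, one_mul, le_refl]

/-- The Schrödinger representation `π_λ` on `L²(ℝ^d)`:
`(π_λ(x, y, w) u)(v) = e^{2πiλw} e^{-2πiλ y·v} u(v - x)`. -/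
def schrodinger {d : ℕ} (lam : ℝ) (g : Heisenberg d) (u : EuclideanL2 d) : EuclideanL2 d :=
  (memLp_schrodingerFun lam g u).toLp _

/-- The Hilbert space `HS(L²(ℝ^d))`. -/
abbrev HS (d : ℕ) : Type := HilbertSchmidt (EuclideanL2 d)

/-- The Plancherel measure `|λ|^d dλ` (the Pfaffian is `|Pf(λ)| = |λ|^d`). -/
def plancherelMeasure (d : ℕ) : Measure ℝ :=
  volume.withDensity fun lam => ENNReal.ofReal (|lam| ^ d)

/-- `T` is the operator `φ̂(λ) = ∫ φ(g) π_λ(g) dg`, the operator-valued integral being taken in the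
weak sense. Only used for integrable `φ`. -/
def IsOperatorFourier {d : ℕ} (φ : Heisenberg d → ℂ) (lam : ℝ) (T : HS d) : Prop :=
  ∀ u v : EuclideanL2 d,
    inner ℂ v (T.toCLM u) = ∫ g, φ g * inner ℂ v (schrodinger lam g u)

/-- The graph of the Fourier transform on `L¹ ∩ L²`: pairs `(φ, φ̂)` with `φ` in
`L¹(ℍ^d) ∩ L²(ℍ^d)` and `φ̂(λ) = ∫ φ(g) π_λ(g) dg` for almost every `λ`. -/
def fourierGraph (d : ℕ) : Set (HeisenbergL2 d × Lp (HS d) 2 (plancherelMeasure d)) :=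
  {p | Integrable p.1 volume ∧ ∀ᵐ lam ∂(plancherelMeasure d), IsOperatorFourier p.1 lam (p.2 lam)}

open Classical in
/-- The Plancherel transform `𝓕 : L²(ℍ^d) → L²(ℝ, HS(L²(ℝ^d)), |λ|^d dλ)`: the continuous extension
to `L²(ℍ^d)` of the Fourier transform on `L¹ ∩ L²`, so that its graph is the closure of the graph
of the latter. (By the Plancherel theorem the `else` branch never occurs, and the chosen element
is unique.) -/
def plancherel {d : ℕ} (f : HeisenbergL2 d) : Lp (HS d) 2 (plancherelMeasure d) :=
  if h : ∃ F, (f, F) ∈ closure (fourierGraph d) then h.choose else 0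

/-- The set `[n, n + 1) + Nℤ`. -/
def cutoffSet (N n : ℕ) : Set ℝ :=
  {ξ | ∃ t ∈ Ico (n : ℝ) (n + 1), ∃ k : ℤ, ξ = t + N * k}

/-- The set `V_n` of all `f ∈ L²(ℍ^d)` with `f̂ = χ ĝ` for some `g ∈ W`, where `χ` is the indicator
function of `[n, n + 1) + Nℤ`. -/
def cutoffSpace {d : ℕ} (W : Submodule ℂ (HeisenbergL2 d)) (N n : ℕ) : Set (HeisenbergL2 d) :=
  {f | ∃ g ∈ W, plancherel f =ᵐ[plancherelMeasure d] (cutoffSet N n).indicator (plancherel g)}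

/-! ## Periodization, range functions and dimension functions -/

/-- The Hilbert space `ℓ²(ℤ, HS(L²(ℝ^d)))`. -/
abbrev FiberSpace (d : ℕ) : Type := lp (fun _ : ℤ => HS d) 2

open Classical in
/-- The Plancherel transform followed by periodization:
`(𝓣 f)(ξ)(n) = |ξ + n|^{d/2} (𝓕 f)(ξ + n)`. The sequence on the right is square summable for almost
every `ξ ∈ [0, 1)`; on the exceptional null set the value is set to `0`. -/
def fiberization {d : ℕ} (f : HeisenbergL2 d) (ξ : ℝ) : FiberSpace d :=
  if h : Memℓp (fun n : ℤ => ((|ξ + n| ^ ((d : ℝ) / 2) : ℝ) : ℂ) • plancherel f (ξ + n)) 2 then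
    ⟨_, h⟩
  else 0

/-- `J` is a range function associated to `W`: it assigns to `ξ ∈ [0, 1)` a closed subspace of
`ℓ²(ℤ, HS(L²(ℝ^d)))`, it is measurable (for each `a` the orthogonal projection `p ξ` of `a` onto
`J ξ` depends weakly measurably on `ξ`), and
`W = {f | (𝓣 f)(ξ) ∈ J ξ for almost every ξ ∈ [0, 1)}`. -/
def IsRangeFunction {d : ℕ} (W : Submodule ℂ (HeisenbergL2 d))
    (J : ℝ → Submodule ℂ (FiberSpace d)) : Prop :=
  (∀ ξ, IsClosed (J ξ : Set (FiberSpace d))) ∧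
  (∀ a : FiberSpace d, ∃ p : ℝ → FiberSpace d,
    (∀ ξ, p ξ ∈ J ξ ∧ a - p ξ ∈ (J ξ)ᗮ) ∧
    ∀ b : FiberSpace d,
      AEMeasurable (fun ξ => inner ℂ b (p ξ)) (volume.restrict (Ico (0 : ℝ) 1))) ∧
  ∀ f : HeisenbergL2 d,
    f ∈ W ↔ ∀ᵐ ξ ∂(volume.restrict (Ico (0 : ℝ) 1)), fiberization f ξ ∈ J ξ

open Classical in
/-- The range function associated to `W` (it exists and is unique up to null sets
for every closed subspace `W` that is invariant under the central translations by `ℤ`). -/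
def rangeFunction {d : ℕ} (W : Submodule ℂ (HeisenbergL2 d)) : ℝ → Submodule ℂ (FiberSpace d) :=
  if h : ∃ J, IsRangeFunction W J then h.choose else fun _ => ⊥

/-- The dimension function `dim_W(ξ) = dim J_W(ξ)`, with values in `ℕ ∪ {∞}`. -/
def dimFunction {d : ℕ} (W : Submodule ℂ (HeisenbergL2 d)) (ξ : ℝ) : ℕ∞ :=
  Cardinal.toENat (Module.rank ℂ (rangeFunction W ξ))

end

/-! ### Square-integrability expressed through lower Lebesgue integrals. -/

noncomputable section

/-! On the Plancherel side, translation by the central element `(0, 0, w)` is multiplication by the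
character `e^{2πiλw}`. A closed subspace invariant under central translations by `T⁻¹ℤ` is therefore
stable under all trigonometric polynomials of period `T`, and by approximation under every bounded
measurable `T`-periodic multiplier (`multiplier_mem`).

If `W` is invariant with centre `N⁻¹ℤ`, apply this with `T = N` to the `N`-periodic function
`χ_{H_n}`: this gives `V_n ⊆ W`. Conversely, every `λ` in `H_n` has the form `n + Nk + {λ}`, so
there `e^{2πiλj/N}` equals the `1`-periodic function `e^{2πi(n+{λ})j/N}`
(`centralChar_mul_cutoffFun`). A translation by `j/N` is thus a sum over `n` of a `1`-periodic
multiplier applied to the cut-off by `χ_{H_n}`, and both operations preserve `W`. The cut-offs are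
mutually orthogonal projections with sum `1`, and they commute with all left translations
(`leftTranslation_multiplier`), so the `V_n` are invariant and `W` is their orthogonal sum.

For the dimensions, fiberization is a unitary map onto `L²([0,1); ℓ²(ℤ, HS))` which turns
`1`-periodic multipliers into multiplications by scalar functions. Multiplication-invariant closed
subspaces have range functions (`exists_isRangeFamily`), and orthogonal decompositions pass to
almost every fibre (`IsRangeFamily.ae_toENat_rank_eq_sum`).

All this rests on the Plancherel theorem for the Heisenberg group. The inverse transform is written
on operators with explicit kernels as two Euclidean Fourier transforms and a shear, which makes it
isometric. Its adjoint is the operator-valued Fourier transform on `L¹ ∩ L²`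
(`mem_fourierGraph_of_integrable`). Surjectivity follows because this adjoint preserves the norm of
indicator functions of boxes, which are total (`plancherelInv_surjective`). -/

theorem MeasureTheory.Lp.enorm_sq_eq_lintegral {α F : Type*} [MeasurableSpace α] {μ : Measure α}
    [NormedAddCommGroup F] (g : Lp F 2 μ) : ‖g‖ₑ ^ 2 = ∫⁻ x, ‖g x‖ₑ ^ 2 ∂μ := by
  rw [Lp.enorm_def, eLpNorm_eq_lintegral_rpow_enorm_toReal two_ne_zero ENNReal.ofNat_ne_top]
  simp only [ENNReal.toReal_ofNat, one_div, ENNReal.rpow_ofNat]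
  rw [← ENNReal.rpow_natCast, ← ENNReal.rpow_mul]
  simp

theorem MeasureTheory.MemLp.lintegral_enorm_sq_lt_top {α F : Type*} [MeasurableSpace α]
    {μ : Measure α} [NormedAddCommGroup F] {f : α → F} (hf : MemLp f 2 μ) :
    ∫⁻ x, ‖f x‖ₑ ^ 2 ∂μ < ⊤ := by
  have h := lintegral_rpow_enorm_lt_top_of_eLpNorm_lt_top two_ne_zero ENNReal.ofNat_ne_top hf.2
  simpa using h

theorem MeasureTheory.memLp_two_of_lintegral {α F : Type*} [MeasurableSpace α]
    {μ : Measure α} [NormedAddCommGroup F] {f : α → F} (hf : AEStronglyMeasurable f μ)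
    (h : ∫⁻ x, ‖f x‖ₑ ^ 2 ∂μ < ⊤) : MemLp f 2 μ := by
  refine ⟨hf, ?_⟩
  rw [eLpNorm_lt_top_iff_lintegral_rpow_enorm_lt_top two_ne_zero ENNReal.ofNat_ne_top]
  simpa using h

/-! ### The Euclidean Fourier transform on `L¹ ∩ L²`. -/

section FourierL2

open FourierTransform ContDiff

variable {V : Type*} [NormedAddCommGroup V] [InnerProductSpace ℝ V] [FiniteDimensional ℝ V]
  [MeasurableSpace V] [BorelSpace V]

/-- On `L¹ ∩ L²` the `L²` Fourier transform is given by the Fourier integral. -/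
theorem fourier_toLp_ae_eq {f : V → ℂ} (h1 : Integrable f) (h2 : MemLp f 2) :
    ((𝓕 (h2.toLp f) : Lp ℂ 2 (volume : Measure V)) : V → ℂ) =ᵐ[volume] 𝓕 f := by
  have hcont : Continuous (𝓕 f) :=
    VectorFourier.fourierIntegral_continuous Real.continuous_fourierChar
      (by exact continuous_inner) h1
  -- It suffices to test against smooth compactly supported `g`. The `L²` transform moves onto `g`
  -- as a tempered distribution, the Fourier integral by Fubini, and both give `∫ ĝ f`.
  refine ae_eq_of_integral_contDiff_smul_eq
    ((Lp.memLp _).locallyIntegrable one_le_two) hcont.locallyIntegrable ?_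
  intro g g_smooth g_cpt
  have hg₁ : HasCompactSupport (Complex.ofRealCLM ∘ g) := g_cpt.comp_left rfl
  have hg₂ : ContDiff ℝ ∞ (Complex.ofRealCLM ∘ g) := by fun_prop
  set G := hg₁.toSchwartzMap hg₂ with hG
  have e1 := congrArg (fun T => T G) (Lp.fourier_toTemperedDistribution_eq (h2.toLp f))
  simp only [TemperedDistribution.fourier_apply, Lp.toTemperedDistribution_apply] at e1
  have e2 : ∫ x, (𝓕 G) x • (h2.toLp f) x = ∫ x, (𝓕 G) x • f x := by
    refine integral_congr_ae ?_
    filter_upwards [h2.coeFn_toLp] with x hx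
    rw [hx]
  have e3 : ∫ ξ, (𝓕 (G : V → ℂ)) ξ • f ξ = ∫ x, G x • 𝓕 f x :=
    VectorFourier.integral_fourierIntegral_smul_eq_flip (L := innerₗ V) (μ := volume)
      Real.continuous_fourierChar continuous_inner G.integrable h1 |>.trans (by
        simp only [flip_innerₗ]; rfl)
  rw [e2, SchwartzMap.fourier_coe, e3] at e1
  simpa [hG] using e1.symm

/-- Plancherel's theorem for functions in `L¹ ∩ L²`. -/
theorem lintegral_enorm_fourier_sq {f : V → ℂ} (h1 : Integrable f) (h2 : MemLp f 2) :
    ∫⁻ ξ, ‖𝓕 f ξ‖ₑ ^ 2 = ∫⁻ x, ‖f x‖ₑ ^ 2 := by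
  calc ∫⁻ ξ, ‖𝓕 f ξ‖ₑ ^ 2 = ∫⁻ ξ, ‖(𝓕 (h2.toLp f) : Lp ℂ 2 (volume : Measure V)) ξ‖ₑ ^ 2 := by
        refine lintegral_congr_ae ?_
        filter_upwards [fourier_toLp_ae_eq h1 h2] with x hx
        rw [hx]
    _ = ∫⁻ x, ‖(h2.toLp f) x‖ₑ ^ 2 := by
        rw [← Lp.enorm_sq_eq_lintegral, ← Lp.enorm_sq_eq_lintegral, ← ofReal_norm,
          Lp.norm_fourier_eq, ofReal_norm]
    _ = _ := by
        refine lintegral_congr_ae ?_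
        filter_upwards [h2.coeFn_toLp] with x hx
        rw [hx]

end FourierL2

/-! ### Separability of the Hilbert spaces involved. -/

section Separability

variable {H : Type*} [NormedAddCommGroup H] [InnerProductSpace ℂ H]

/-- Distinct orthonormal vectors are at distance `√2`, so the balls of radius `1/2` around them are
disjoint, and a separable space has only countably many disjoint nonempty open sets. -/
theorem Orthonormal.countable_index [TopologicalSpace.SeparableSpace H] {ι : Type*} {v : ι → H}
    (hv : Orthonormal ℂ v) : Countable ι := by
  have h : (Set.univ : Set ι).PairwiseDisjoint fun i => Metric.ball (v i) (1 / 2) := by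
    intro i _ j _ hij
    refine Metric.ball_disjoint_ball ?_
    have h2 : ‖v i - v j‖ ^ 2 = 2 := by
      rw [@norm_sub_sq ℂ, hv.2 hij, hv.1 i, hv.1 j]; norm_num
    rw [dist_eq_norm]
    nlinarith [norm_nonneg (v i - v j)]
  have := h.countable_of_isOpen (fun i _ => Metric.isOpen_ball)
    (fun i _ => ⟨v i, Metric.mem_ball_self (by norm_num)⟩)
  exact Set.countable_univ_iff.mp this

instance lp.separableSpace {ι : Type*} [Countable ι] [TopologicalSpace.SeparableSpace H] :
    TopologicalSpace.SeparableSpace (lp (fun _ : ι => H) 2) := by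
  classical
  rw [← TopologicalSpace.isSeparable_univ_iff]
  have h1 : TopologicalSpace.IsSeparable
      (⋃ i : ι, Set.range fun x : H => (lp.single 2 i x : lp (fun _ : ι => H) 2)) := by
    refine TopologicalSpace.IsSeparable.iUnion fun i => ?_
    exact TopologicalSpace.isSeparable_range
      (lp.isometry_single (E := fun _ : ι => H) (p := 2) i).continuous
  refine (h1.span (R := ℂ)).closure.mono fun f _ => ?_
  have h2 := lp.hasSum_single (p := 2) ENNReal.ofNat_ne_top f
  refine mem_closure_of_tendsto h2 (Eventually.of_forall fun s => ?_)
  refine Submodule.sum_mem _ fun i _ => Submodule.subset_span ?_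
  exact Set.mem_iUnion.mpr ⟨i, f i, rfl⟩

end Separability

/-! ### The Hilbert space of Hilbert-Schmidt operators. -/

namespace HilbertSchmidt

variable {H : Type*} [NormedAddCommGroup H] [InnerProductSpace ℂ H] [CompleteSpace H]

instance [TopologicalSpace.SeparableSpace H] : Countable (hsIndex H) :=
  (hsBasis H).orthonormal.countable_index

/-- `T ↦ (T eᵢ)ᵢ` is isometric. -/
theorem isometry_toL2 : Isometry (toL2 H) :=
  AddMonoidHomClass.isometry_of_norm _ fun _ => rfl

instance [TopologicalSpace.SeparableSpace H] :
    SecondCountableTopology (HilbertSchmidt H) := by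
  have : SecondCountableTopology (lp (fun _ : hsIndex H => H) 2) :=
    UniformSpace.secondCountable_of_separable _
  exact (isometry_toL2 (H := H)).isEmbedding.secondCountableTopology

theorem norm_def (T : HilbertSchmidt H) : ‖T‖ = ‖toL2 H T‖ := rfl

theorem toL2_apply (T : HilbertSchmidt H) (i : hsIndex H) :
    toL2 H T i = T.toCLM (hsBasis H i) := rfl

theorem hasSum_inner (S T : HilbertSchmidt H) :
    HasSum (fun i => inner ℂ (S.toCLM (hsBasis H i)) (T.toCLM (hsBasis H i))) (inner ℂ S T) :=
  lp.hasSum_inner (toL2 H S) (toL2 H T)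

theorem enorm_sq_eq_tsum (T : HilbertSchmidt H) :
    ‖T‖ₑ ^ 2 = ∑' i, ‖T.toCLM (hsBasis H i)‖ₑ ^ 2 := by
  have h := lp.hasSum_norm (p := 2) (by norm_num) (toL2 H T)
  simp only [ENNReal.toReal_ofNat, Real.rpow_ofNat, toL2_apply] at h
  rw [← ofReal_norm, ← ENNReal.ofReal_pow (norm_nonneg _), norm_def, ← h.tsum_eq,
    ENNReal.ofReal_tsum_of_nonneg (fun _ => by positivity) h.summable]
  simp only [ENNReal.ofReal_pow (norm_nonneg _), ofReal_norm]

/-- The rank one operator `x ↦ ⟪v, x⟫ u`. -/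
def rankOne (u v : H) : HilbertSchmidt H :=
  ⟨InnerProductSpace.rankOne ℂ u v, by
    have h := (lp.memℓp ((hsBasis H).repr v)).norm.const_smul (c := (‖u‖ : ℝ))
    refine memℓp_gen ?_
    have h' := (memℓp_gen_iff (by norm_num)).mp h
    refine h'.congr fun i => ?_
    simp [InnerProductSpace.rankOne_apply, norm_smul, HilbertBasis.repr_apply_apply, mul_comm,
      norm_inner_symm]⟩

theorem rankOne_apply (u v x : H) : (rankOne u v).toCLM x = inner ℂ v x • u := rfl

/-- Expand `v` in the fixed basis and apply `T` termwise. Pairing with rank one operators thus reads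
off matrix coefficients, which links the Hilbert-Schmidt product to weakly defined operators. -/
theorem inner_rankOne (u v : H) (T : HilbertSchmidt H) :
    inner ℂ (rankOne u v) T = inner ℂ u (T.toCLM v) := by
  refine (hasSum_inner (rankOne u v) T).unique ?_
  have h := (((hsBasis H).hasSum_repr v).mapL T.toCLM).mapL (innerSL ℂ u)
  refine (h.congr_fun ?_)
  intro i
  simp [rankOne_apply, HilbertBasis.repr_apply_apply, mul_comm]

/-- Cauchy-Schwarz for `T` and the rank one operator `|Tv⟩⟨v|`, whose norm is `‖Tv‖ ‖v‖`, bounds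
`‖Tv‖²`. -/
theorem norm_toCLM_apply_le (T : HilbertSchmidt H) (v : H) :
    ‖T.toCLM v‖ ≤ ‖T‖ * ‖v‖ := by
  have h1 : ‖T.toCLM v‖ ^ 2 = ‖inner ℂ (rankOne (T.toCLM v) v) T‖ := by
    rw [inner_rankOne, inner_self_eq_norm_sq_to_K]; simp
  have h2 : ‖rankOne (T.toCLM v) v‖ = ‖T.toCLM v‖ * ‖v‖ := by
    have h := inner_rankOne (T.toCLM v) v (rankOne (T.toCLM v) v)
    rw [rankOne_apply, inner_smul_right, inner_self_eq_norm_sq_to_K, inner_self_eq_norm_sq_to_K,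
      inner_self_eq_norm_sq_to_K, ← mul_pow] at h
    have h' : ‖rankOne (T.toCLM v) v‖ ^ 2 = (‖v‖ * ‖T.toCLM v‖) ^ 2 := by exact_mod_cast h
    rw [pow_left_inj₀ (norm_nonneg _) (by positivity) two_ne_zero] at h'
    rw [h', mul_comm]
  have h3 := norm_inner_le_norm (𝕜 := ℂ) (rankOne (T.toCLM v) v) T
  rw [← h1, h2] at h3
  rcases eq_or_lt_of_le (norm_nonneg (T.toCLM v)) with h0 | h0
  · rw [← h0]; positivity
  · nlinarith

theorem toCLM_sub (S T : HilbertSchmidt H) : (S - T).toCLM = S.toCLM - T.toCLM := rfl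

/-- A Cauchy sequence converges both in operator norm and, through `toL2`, in `ℓ²(H)`. Comparing
coordinates shows that the operator limit is Hilbert-Schmidt with the `ℓ²` limit as its image. -/
instance : CompleteSpace (HilbertSchmidt H) := by
  refine Metric.complete_of_cauchySeq_tendsto fun T hT => ?_
  have hlip : LipschitzWith 1 (toCLM : HilbertSchmidt H → H →L[ℂ] H) := by
    refine LipschitzWith.of_dist_le_mul fun S T => ?_
    rw [dist_eq_norm, dist_eq_norm, ← toCLM_sub, NNReal.coe_one, one_mul]
    exact ContinuousLinearMap.opNorm_le_bound _ (norm_nonneg _) (norm_toCLM_apply_le _)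
  obtain ⟨T', hT'⟩ := cauchySeq_tendsto_of_complete
    (u := toCLM ∘ T) (hlip.uniformContinuous.comp_cauchySeq hT)
  obtain ⟨x, hx⟩ := cauchySeq_tendsto_of_complete
    (u := toL2 H ∘ T) ((isometry_toL2 (H := H)).uniformContinuous.comp_cauchySeq hT)
  have hxi : ∀ i, x i = T' (hsBasis H i) := by
    intro i
    have h1 : Tendsto (fun n => (T n).toCLM (hsBasis H i)) atTop (𝓝 (T' (hsBasis H i))) :=
      ((ContinuousLinearMap.apply ℂ H (hsBasis H i)).continuous.tendsto T').comp hT'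
    have h2 : Tendsto (fun n => (toL2 H (T n)) i) atTop (𝓝 (x i)) := by
      rw [tendsto_iff_norm_sub_tendsto_zero] at hx ⊢
      refine squeeze_zero (fun _ => norm_nonneg _) (fun n => ?_) hx
      exact lp.norm_apply_le_norm two_ne_zero (toL2 H (T n) - x) i
    exact tendsto_nhds_unique h2 h1
  have hmem : Memℓp (fun i : hsIndex H => T' (hsBasis H i)) 2 := by
    have := lp.memℓp x
    rwa [show (x : hsIndex H → H) = fun i => T' (hsBasis H i) from funext hxi] at this
  let S : HilbertSchmidt H := (⟨T', hmem⟩ : hilbertSchmidtSubmodule H)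
  have hS : toL2 H S = x := lp.ext (funext fun i => (hxi i).symm)
  exact ⟨S, (isometry_toL2 (H := H)).isEmbedding.tendsto_nhds_iff.mpr (hS ▸ hx)⟩

end HilbertSchmidt

end

noncomputable section

theorem HilbertBasis.tsum_enorm_inner_sq {ι H : Type*} [NormedAddCommGroup H]
    [InnerProductSpace ℂ H] (b : HilbertBasis ι ℂ H) (x : H) :
    ∑' i, ‖inner ℂ x (b i)‖ₑ ^ 2 = ‖x‖ₑ ^ 2 := by
  have h := lp.hasSum_norm (p := 2) (by norm_num) (b.repr x)
  simp only [ENNReal.toReal_ofNat, Real.rpow_ofNat, b.repr.norm_map,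
    HilbertBasis.repr_apply_apply, norm_inner_symm _ x] at h
  rw [← ofReal_norm, ← ENNReal.ofReal_pow (norm_nonneg _), ← h.tsum_eq,
    ENNReal.ofReal_tsum_of_nonneg (fun _ => by positivity) h.summable]
  simp only [ENNReal.ofReal_pow (norm_nonneg _), ofReal_norm]

instance (d : ℕ) : TopologicalSpace.SeparableSpace (EuclideanL2 d) := by
  have : Fact ((2 : ENNReal) ≠ ⊤) := ⟨ENNReal.ofNat_ne_top⟩
  infer_instance

/-- The Hilbert-Schmidt norm of an integral operator is the `L²` norm of its kernel. -/
theorem HilbertSchmidt.enorm_sq_eq_lintegral_kernel {d : ℕ} (T : HS d)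
    {K : EuclideanSpace ℝ (Fin d) → EuclideanSpace ℝ (Fin d) → ℂ}
    (hK : ∀ᵐ s, MemLp (K s) 2)
    (hT : ∀ v : EuclideanL2 d, ∀ᵐ s, T.toCLM v s = ∫ t, K s t * v t) :
    ‖T‖ₑ ^ 2 = ∫⁻ s, ∫⁻ t, ‖K s t‖ₑ ^ 2 := by
  calc ‖T‖ₑ ^ 2 = ∑' i, ∫⁻ s, ‖T.toCLM (hsBasis _ i) s‖ₑ ^ 2 := by
        rw [enorm_sq_eq_tsum]
        simp only [Lp.enorm_sq_eq_lintegral]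
    _ = ∫⁻ s, ∑' i, ‖T.toCLM (hsBasis _ i) s‖ₑ ^ 2 := by
        rw [lintegral_tsum]
        intro i
        exact ((Lp.aestronglyMeasurable _).enorm.pow_const 2)
    _ = _ := by
        refine lintegral_congr_ae ?_
        filter_upwards [hK, ae_all_iff.mpr fun i => hT (hsBasis _ i)] with s hs hi
        -- For fixed `s`, the numbers `(T eᵢ)(s)` are the coefficients of the conjugated row `K s`,
        -- so Parseval applies row by row.
        have hs' : MemLp (fun t => (starRingEnd ℂ) (K s t)) 2 := hs.star
        calc ∑' i, ‖T.toCLM (hsBasis _ i) s‖ₑ ^ 2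
            = ∑' i, ‖inner ℂ (hs'.toLp _) (hsBasis (EuclideanL2 d) i)‖ₑ ^ 2 := by
              congr 1
              ext i
              rw [hi, L2.inner_def]
              congr 2
              refine integral_congr_ae ?_
              filter_upwards [hs'.coeFn_toLp] with t ht
              rw [ht]
              simp [mul_comm]
          _ = ‖hs'.toLp _‖ₑ ^ 2 := HilbertBasis.tsum_enorm_inner_sq _ _
          _ = ∫⁻ t, ‖K s t‖ₑ ^ 2 := by
              rw [Lp.enorm_sq_eq_lintegral]
              refine lintegral_congr_ae ?_
              filter_upwards [hs'.coeFn_toLp] with t ht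
              rw [ht]
              simp

/-! ### The inverse transform of operator fields given by kernels. -/

section KernelTransform

open FourierTransform

variable {d : ℕ}

/-- The partial Fourier transform of the sheared kernel, weighted by the Plancherel density. -/
def shearedFourier (K : ℝ → EuclideanSpace ℝ (Fin d) → EuclideanSpace ℝ (Fin d) → ℂ) (x y : EuclideanSpace ℝ (Fin d)) (lam : ℝ) : ℂ :=
  ((|lam| ^ d : ℝ) : ℂ) * 𝓕 (fun t => K lam t (t - x)) (-(lam • y))

/-- The function on the Heisenberg group whose operator-valued Fourier transform at `λ` is the
integral operator with kernel `K λ`. -/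
def kernelTransform (K : ℝ → EuclideanSpace ℝ (Fin d) → EuclideanSpace ℝ (Fin d) → ℂ) (g : Heisenberg d) : ℂ :=
  𝓕 (shearedFourier K g.1 g.2.1) g.2.2

theorem kernelTransform_mk (K : ℝ → EuclideanSpace ℝ (Fin d) → EuclideanSpace ℝ (Fin d) → ℂ)
    (x y : EuclideanSpace ℝ (Fin d)) (w : ℝ) :
    kernelTransform K (x, y, w) = 𝓕 (shearedFourier K x y) w := rfl

theorem stronglyMeasurable_shearedFourier {K : ℝ → EuclideanSpace ℝ (Fin d) → EuclideanSpace ℝ (Fin d) → ℂ}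
    (hK : StronglyMeasurable fun p : ℝ × EuclideanSpace ℝ (Fin d) × EuclideanSpace ℝ (Fin d) => K p.1 p.2.1 p.2.2) :
    StronglyMeasurable fun p : (EuclideanSpace ℝ (Fin d) × EuclideanSpace ℝ (Fin d)) × ℝ => shearedFourier K p.1.1 p.1.2 p.2 := by
  unfold shearedFourier
  refine StronglyMeasurable.mul ?_ ?_
  · exact Continuous.stronglyMeasurable (by fun_prop)
  · simp only [Real.fourier_eq']
    refine StronglyMeasurable.integral_prod_right
      (f := fun (p : (EuclideanSpace ℝ (Fin d) × EuclideanSpace ℝ (Fin d)) × ℝ) (t : EuclideanSpace ℝ (Fin d)) => Complex.exp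
        (((-2 * Real.pi * inner ℝ t (-(p.2 • p.1.2)) : ℝ) : ℂ) * Complex.I) • K p.2 t (t - p.1.1)) ?_
    have h1 : Continuous fun q : ((EuclideanSpace ℝ (Fin d) × EuclideanSpace ℝ (Fin d)) × ℝ) ×
        EuclideanSpace ℝ (Fin d) => Complex.exp
          (((-2 * Real.pi * inner ℝ q.2 (-(q.1.2 • q.1.1.2)) : ℝ) : ℂ) * Complex.I) := by
      fun_prop
    refine h1.stronglyMeasurable.smul ?_
    exact hK.comp_measurable (g := fun q : ((EuclideanSpace ℝ (Fin d) × EuclideanSpace ℝ (Fin d)) × ℝ) × EuclideanSpace ℝ (Fin d) => (q.1.2, q.2, q.2 - q.1.1.1))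
        (Continuous.measurable (by fun_prop))

theorem Heisenberg.lintegral_eq {f : Heisenberg d → ENNReal} (hf : Measurable f) :
    ∫⁻ g, f g = ∫⁻ x : EuclideanSpace ℝ (Fin d), ∫⁻ y : EuclideanSpace ℝ (Fin d),
      ∫⁻ w : ℝ, f (x, y, w) := by
  refine (lintegral_prod (μ := (volume : Measure (EuclideanSpace ℝ (Fin d))))
    (ν := (volume : Measure (EuclideanSpace ℝ (Fin d) × ℝ))) f hf.aemeasurable).trans ?_
  refine lintegral_congr fun x => ?_
  exact lintegral_prod (μ := (volume : Measure (EuclideanSpace ℝ (Fin d))))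
    (ν := (volume : Measure ℝ)) _ (hf.comp measurable_prodMk_left).aemeasurable

theorem lintegral_plancherelMeasure {f : ℝ → ENNReal} (hf : Measurable f) :
    ∫⁻ lam, f lam ∂plancherelMeasure d = ∫⁻ lam, ENNReal.ofReal (|lam| ^ d) * f lam := by
  have h : Measurable fun lam : ℝ => ENNReal.ofReal (|lam| ^ d) :=
    ENNReal.measurable_ofReal.comp (Continuous.measurable (by fun_prop))
  exact lintegral_withDensity_eq_lintegral_mul _ h hf

theorem integral_plancherelMeasure {F : Type*} [NormedAddCommGroup F] [NormedSpace ℝ F]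
    (f : ℝ → F) :
    ∫ lam, f lam ∂plancherelMeasure d = ∫ lam, (|lam| ^ d : ℝ) • f lam := by
  have h : Measurable fun lam : ℝ => ENNReal.ofReal (|lam| ^ d) :=
    ENNReal.measurable_ofReal.comp (Continuous.measurable (by fun_prop))
  rw [plancherelMeasure, integral_withDensity_eq_integral_toReal_smul h
    (Eventually.of_forall fun _ => ENNReal.ofReal_lt_top)]
  refine integral_congr_ae (Eventually.of_forall fun lam => ?_)
  simp only [ENNReal.toReal_ofReal (show 0 ≤ |lam| ^ d by positivity)]

instance : SigmaFinite (plancherelMeasure d) := by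
  unfold plancherelMeasure
  infer_instance

instance : IsLocallyFiniteMeasure (plancherelMeasure d) :=
  IsLocallyFiniteMeasure.withDensity_ofReal (by fun_prop)

/-- The Jacobian of a dilation of `ℝ^d` is the source of the Plancherel density `|λ|^d`. -/
theorem lintegral_comp_smul (f : EuclideanSpace ℝ (Fin d) → ENNReal) {r : ℝ} (hr : r ≠ 0) :
    ENNReal.ofReal (|r| ^ d) * ∫⁻ y, f (r • y) = ∫⁻ y, f y := by
  have h := Measure.map_addHaar_smul (volume : Measure (EuclideanSpace ℝ (Fin d))) hr
  have h2 := lintegral_map_equiv (μ := (volume : Measure (EuclideanSpace ℝ (Fin d)))) f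
    (Homeomorph.smulOfNeZero (α := EuclideanSpace ℝ (Fin d)) r hr).toMeasurableEquiv
  have h3 : ⇑(Homeomorph.smulOfNeZero r hr : EuclideanSpace ℝ (Fin d) ≃ₜ EuclideanSpace ℝ (Fin d)).toMeasurableEquiv = fun x : EuclideanSpace ℝ (Fin d) => r • x := rfl
  rw [h3] at h2
  rw [h, lintegral_smul_measure] at h2
  rw [← h2, finrank_euclideanSpace_fin, smul_eq_mul, ← mul_assoc,
    ← ENNReal.ofReal_mul (by positivity), abs_inv, abs_pow,
    mul_inv_cancel₀ (by positivity), ENNReal.ofReal_one, one_mul]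

variable {K : ℝ → EuclideanSpace ℝ (Fin d) → EuclideanSpace ℝ (Fin d) → ℂ} {R : ℝ} {p q : EuclideanSpace ℝ (Fin d) → ℝ}

theorem integrable_sheared (hK : StronglyMeasurable fun p : ℝ × EuclideanSpace ℝ (Fin d) × EuclideanSpace ℝ (Fin d) => K p.1 p.2.1 p.2.2)
    (hp : MemLp p 2 volume) (hq : MemLp q 2 volume) (hb : ∀ lam t s, ‖K lam t s‖ ≤ p t * q s) (lam : ℝ) (x : EuclideanSpace ℝ (Fin d)) :
    Integrable fun t => K lam t (t - x) := by
  have hq' : MemLp (fun t => q (t - x)) 2 :=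
    hq.comp_measurePreserving (measurePreserving_sub_right volume x)
  refine (hp.integrable_mul hq').mono' ?_ (Eventually.of_forall fun t => hb _ _ _)
  exact (hK.comp_measurable (g := fun t : EuclideanSpace ℝ (Fin d) => (lam, t, t - x))
    (Continuous.measurable (by fun_prop))).aestronglyMeasurable

/-- For fixed `t`, the map `x ↦ t - x` preserves Lebesgue measure, and Tonelli exchanges the two
integrals. -/
theorem lintegral_sheared (hK : StronglyMeasurable fun p : ℝ × EuclideanSpace ℝ (Fin d) × EuclideanSpace ℝ (Fin d) => K p.1 p.2.1 p.2.2)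
    (lam : ℝ) :
    ∫⁻ x, ∫⁻ t, ‖K lam t (t - x)‖ₑ ^ 2 = ∫⁻ t, ∫⁻ s, ‖K lam t s‖ₑ ^ 2 := by
  rw [lintegral_lintegral_swap]
  · refine lintegral_congr fun t => ?_
    exact lintegral_sub_left_eq_self (fun s => ‖K lam t s‖ₑ ^ 2) t
  · exact ((hK.comp_measurable (g := fun z : EuclideanSpace ℝ (Fin d) × EuclideanSpace ℝ (Fin d) => (lam, z.2, z.2 - z.1))
      (Continuous.measurable (by fun_prop))).enorm.pow_const 2).aemeasurable

theorem ae_memLp_sheared (hK : StronglyMeasurable fun p : ℝ × EuclideanSpace ℝ (Fin d) × EuclideanSpace ℝ (Fin d) => K p.1 p.2.1 p.2.2)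
    (hp : MemLp p 2 volume) (hq : MemLp q 2 volume) (hb : ∀ lam t s, ‖K lam t s‖ ≤ p t * q s) (lam : ℝ) :
    ∀ᵐ x, MemLp (fun t => K lam t (t - x)) 2 := by
  have hfin : ∫⁻ x, ∫⁻ t, ‖K lam t (t - x)‖ₑ ^ 2 < ⊤ := by
    rw [lintegral_sheared hK]
    calc ∫⁻ t, ∫⁻ s, ‖K lam t s‖ₑ ^ 2 ≤ ∫⁻ t, ∫⁻ s, ‖p t‖ₑ ^ 2 * ‖q s‖ₑ ^ 2 := by
          refine lintegral_mono fun t => lintegral_mono fun s => ?_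
          rw [← mul_pow, ← enorm_mul]
          gcongr
          exact enorm_le_iff_norm_le.mpr ((hb _ _ _).trans (le_abs_self _))
      _ = (∫⁻ t, ‖p t‖ₑ ^ 2) * ∫⁻ s, ‖q s‖ₑ ^ 2 := by
          rw [← lintegral_mul_const'' _ (hp.1.enorm.pow_const 2)]
          refine lintegral_congr fun t => ?_
          rw [lintegral_const_mul'' _ (hq.1.enorm.pow_const 2)]
      _ < ⊤ := ENNReal.mul_lt_top hp.lintegral_enorm_sq_lt_top hq.lintegral_enorm_sq_lt_top
  have hm : StronglyMeasurable fun z : EuclideanSpace ℝ (Fin d) × EuclideanSpace ℝ (Fin d) => K lam z.2 (z.2 - z.1) :=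
    hK.comp_measurable (g := fun z : EuclideanSpace ℝ (Fin d) × EuclideanSpace ℝ (Fin d) => (lam, z.2, z.2 - z.1))
      (Continuous.measurable (by fun_prop))
  have hm2 : Measurable fun x => ∫⁻ t, ‖K lam t (t - x)‖ₑ ^ 2 :=
    (hm.enorm.pow_const 2).lintegral_prod_right'
  filter_upwards [ae_lt_top hm2 hfin.ne] with x hx
  exact memLp_two_of_lintegral
    (hm.comp_measurable (measurable_prodMk_left (x := x))).aestronglyMeasurable hx

/-- A bounded function supported in a bounded interval lies in every `L^r`, so the Fourier transform
in `λ` can be taken as an honest integral and in `L²` at once. -/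
theorem exists_bound_shearedFourier
    (hK : StronglyMeasurable fun p : ℝ × EuclideanSpace ℝ (Fin d) × EuclideanSpace ℝ (Fin d) => K p.1 p.2.1 p.2.2)
    (hp : MemLp p 2 volume) (hq : MemLp q 2 volume) (hb : ∀ lam t s, ‖K lam t s‖ ≤ p t * q s)
    (hR : ∀ lam t s, lam ∉ Icc (-R) R → K lam t s = 0) (x y : EuclideanSpace ℝ (Fin d)) :
    ∃ C, ∀ lam, ‖shearedFourier K x y lam‖ ≤ C ∧
      (lam ∉ Icc (-R) R → shearedFourier K x y lam = 0) := by
  have hq' : MemLp (fun t => q (t - x)) 2 :=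
    hq.comp_measurePreserving (measurePreserving_sub_right volume x)
  have h0 : ∀ lam, lam ∉ Icc (-R) R → shearedFourier K x y lam = 0 := by
    intro lam hlam
    simp [shearedFourier, hR lam _ _ hlam, Real.fourier_eq']
  refine ⟨|R| ^ d * ∫ t, p t * q (t - x), fun lam => ⟨?_, h0 lam⟩⟩
  have hI : 0 ≤ ∫ t, p t * q (t - x) :=
    integral_nonneg fun t => (norm_nonneg _).trans (hb 0 _ _)
  by_cases hlam : lam ∈ Icc (-R) R
  · have h1 : |lam| ≤ |R| := (abs_le.mpr hlam).trans (le_abs_self R)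
    rw [shearedFourier, norm_mul, Complex.norm_real, norm_pow, Real.norm_eq_abs, abs_abs]
    gcongr
    refine (VectorFourier.norm_fourierIntegral_le_integral_norm _ _ _ _ _).trans ?_
    exact integral_mono (integrable_sheared hK hp hq hb lam x).norm (hp.integrable_mul hq')
      fun t => hb _ _ _
  · rw [h0 lam hlam, norm_zero]
    positivity

theorem memLp_shearedFourier (hK : StronglyMeasurable fun p : ℝ × EuclideanSpace ℝ (Fin d) × EuclideanSpace ℝ (Fin d) => K p.1 p.2.1 p.2.2)
    (hp : MemLp p 2 volume) (hq : MemLp q 2 volume) (hb : ∀ lam t s, ‖K lam t s‖ ≤ p t * q s)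
    (hR : ∀ lam t s, lam ∉ Icc (-R) R → K lam t s = 0) (x y : EuclideanSpace ℝ (Fin d)) (r : ENNReal) :
    MemLp (shearedFourier K x y) r := by
  obtain ⟨C, hC⟩ := exists_bound_shearedFourier hK hp hq hb hR x y
  have hm : StronglyMeasurable (shearedFourier K x y) :=
    (stronglyMeasurable_shearedFourier hK).comp_measurable (measurable_prodMk_left (x := (x, y)))
  refine (memLp_top_of_bound hm.aestronglyMeasurable C
    (Eventually.of_forall fun lam => (hC lam).1)).mono_exponent_of_measure_support_ne_top
    (s := Icc (-R) R) (fun lam => (hC lam).2) ?_ le_top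
  simp

/-- The squared weight contributes `|λ|^{2d}`. The substitution `ξ = -λy` absorbs one factor
`|λ|^d`, Plancherel in `t` and the shear do the rest, and the other factor is left as the density.
-/
theorem lintegral_shearedFourier
    (hK : StronglyMeasurable fun p : ℝ × EuclideanSpace ℝ (Fin d) × EuclideanSpace ℝ (Fin d) =>
      K p.1 p.2.1 p.2.2)
    (hp : MemLp p 2 volume) (hq : MemLp q 2 volume) (hb : ∀ lam t s, ‖K lam t s‖ ≤ p t * q s)
    {lam : ℝ} (hlam : lam ≠ 0) :
    ∫⁻ x, ∫⁻ y, ‖shearedFourier K x y lam‖ₑ ^ 2 =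
      ENNReal.ofReal (|lam| ^ d) * ∫⁻ t, ∫⁻ s, ‖K lam t s‖ₑ ^ 2 := by
  rw [← lintegral_sheared hK, ← lintegral_const_mul' _ _ ENNReal.ofReal_ne_top]
  refine lintegral_congr_ae ?_
  filter_upwards [ae_memLp_sheared hK hp hq hb lam] with x hx
  rw [← lintegral_enorm_fourier_sq (integrable_sheared hK hp hq hb lam x) hx,
    ← lintegral_comp_smul (fun ξ => ‖𝓕 (fun t => K lam t (t - x)) ξ‖ₑ ^ 2)
      (neg_ne_zero.mpr hlam), ← mul_assoc,
    ← lintegral_const_mul' _ _ (ENNReal.mul_ne_top ENNReal.ofReal_ne_top ENNReal.ofReal_ne_top)]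
  refine lintegral_congr fun y => ?_
  have h3 : ‖((|lam| ^ d : ℝ) : ℂ)‖ₑ = ENNReal.ofReal (|lam| ^ d) := by
    rw [← ofReal_norm, Complex.norm_real, Real.norm_of_nonneg (by positivity)]
  rw [shearedFourier, enorm_mul, mul_pow, h3, abs_neg, sq, neg_smul]

theorem lintegral_shearedFourier_swap
    (hK : StronglyMeasurable fun p : ℝ × EuclideanSpace ℝ (Fin d) × EuclideanSpace ℝ (Fin d) =>
      K p.1 p.2.1 p.2.2) :
    ∫⁻ x, ∫⁻ y, ∫⁻ lam, ‖shearedFourier K x y lam‖ₑ ^ 2 =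
      ∫⁻ lam, ∫⁻ x, ∫⁻ y, ‖shearedFourier K x y lam‖ₑ ^ 2 := by
  have hG : Measurable fun p : (EuclideanSpace ℝ (Fin d) × EuclideanSpace ℝ (Fin d)) × ℝ =>
      ‖shearedFourier K p.1.1 p.1.2 p.2‖ₑ ^ 2 :=
    (stronglyMeasurable_shearedFourier hK).enorm.pow_const 2
  have h1 : ∀ x, ∫⁻ y, ∫⁻ lam : ℝ, ‖shearedFourier K x y lam‖ₑ ^ 2
      = ∫⁻ lam : ℝ, ∫⁻ y, ‖shearedFourier K x y lam‖ₑ ^ 2 := fun x =>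
    lintegral_lintegral_swap (hG.comp
      (g := fun p : (EuclideanSpace ℝ (Fin d) × EuclideanSpace ℝ (Fin d)) × ℝ =>
      ‖shearedFourier K p.1.1 p.1.2 p.2‖ₑ ^ 2)
      (f := fun z : EuclideanSpace ℝ (Fin d) × ℝ => ((x, z.1), z.2))
      (Continuous.measurable (by fun_prop))).aemeasurable
  simp only [h1]
  refine lintegral_lintegral_swap (Measurable.aemeasurable ?_)
  exact (hG.comp
    (f := fun z : (EuclideanSpace ℝ (Fin d) × ℝ) × EuclideanSpace ℝ (Fin d) =>
      ((z.1.1, z.2), z.1.2)) (Continuous.measurable (by fun_prop))).lintegral_prod_right'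

/-- The Plancherel identity for functions given by kernels. -/
theorem lintegral_kernelTransform
    (hK : StronglyMeasurable fun p : ℝ × EuclideanSpace ℝ (Fin d) × EuclideanSpace ℝ (Fin d) =>
      K p.1 p.2.1 p.2.2)
    (hp : MemLp p 2 volume) (hq : MemLp q 2 volume) (hb : ∀ lam t s, ‖K lam t s‖ ≤ p t * q s)
    (hR : ∀ lam t s, lam ∉ Icc (-R) R → K lam t s = 0)
    (hm : StronglyMeasurable (kernelTransform K)) :
    ∫⁻ g, ‖kernelTransform K g‖ₑ ^ 2 =
      ∫⁻ lam, (∫⁻ t, ∫⁻ s, ‖K lam t s‖ₑ ^ 2) ∂plancherelMeasure d := by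
  -- Euclidean Plancherel in the central variable `w`, for fixed `x` and `y`.
  have h1 : ∫⁻ g, ‖kernelTransform K g‖ₑ ^ 2 =
      ∫⁻ x, ∫⁻ y, ∫⁻ lam, ‖shearedFourier K x y lam‖ₑ ^ 2 := by
    have hm2 : Measurable fun g => ‖kernelTransform K g‖ₑ ^ 2 := hm.enorm.pow_const 2
    rw [Heisenberg.lintegral_eq hm2]
    refine lintegral_congr fun x => lintegral_congr fun y => ?_
    simp only [kernelTransform_mk]
    exact lintegral_enorm_fourier_sq
      (memLp_one_iff_integrable.mp (memLp_shearedFourier hK hp hq hb hR x y 1))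
      (memLp_shearedFourier hK hp hq hb hR x y 2)
  have hm2 : Measurable fun lam => ∫⁻ t, ∫⁻ s, ‖K lam t s‖ₑ ^ 2 := by
    have h2 : Measurable fun z : (ℝ × EuclideanSpace ℝ (Fin d)) × EuclideanSpace ℝ (Fin d) =>
        ‖K z.1.1 z.1.2 z.2‖ₑ ^ 2 :=
      (hK.comp_measurable (Continuous.measurable (by fun_prop) :
        Measurable fun z : (ℝ × EuclideanSpace ℝ (Fin d)) × EuclideanSpace ℝ (Fin d) =>
          (z.1.1, z.1.2, z.2))).enorm.pow_const 2
    exact h2.lintegral_prod_right'.lintegral_prod_right'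
  rw [h1, lintegral_shearedFourier_swap hK, lintegral_plancherelMeasure hm2]
  refine lintegral_congr_ae ?_
  filter_upwards [Measure.ae_ne volume (0 : ℝ)] with lam hlam
  exact lintegral_shearedFourier hK hp hq hb hlam

end KernelTransform

end

noncomputable section

variable {d : ℕ}

/-! ### Matrix coefficients of the Schrödinger representations. -/

section Schrodinger

open FourierTransform

theorem integrable_fourier_exp {V : Type*} [NormedAddCommGroup V] [InnerProductSpace ℝ V]
    [MeasurableSpace V] [BorelSpace V] [FiniteDimensional ℝ V] {f : V → ℂ} (hf : Integrable f)
    (w : V) : Integrable fun v =>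
      Complex.exp (((-2 * Real.pi * inner ℝ v w : ℝ) : ℂ) * Complex.I) • f v := by
  refine hf.bdd_mul (c := 1) (Continuous.aestronglyMeasurable (by fun_prop))
    (Eventually.of_forall fun v => ?_)
  rw [Complex.norm_exp_ofReal_mul_I]

theorem coeFn_schrodinger (lam : ℝ) (g : Heisenberg d) (u : EuclideanL2 d) :
    schrodinger lam g u =ᵐ[volume] schrodingerFun lam g u :=
  MemLp.coeFn_toLp _

/-- `π_λ(g)` as a linear isometry. -/
def schrodingerLI (lam : ℝ) (g : Heisenberg d) : EuclideanL2 d →ₗᵢ[ℂ] EuclideanL2 d where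
  toFun := schrodinger lam g
  map_add' u v := by
    refine Lp.ext ?_
    have h1 := (measurePreserving_sub_right volume g.1).quasiMeasurePreserving.ae_eq_comp
      (Lp.coeFn_add u v)
    filter_upwards [coeFn_schrodinger lam g (u + v), coeFn_schrodinger lam g u,
      coeFn_schrodinger lam g v, Lp.coeFn_add (schrodinger lam g u) (schrodinger lam g v), h1]
      with t e1 e2 e3 e4 e5
    simp only [Function.comp_apply, Pi.add_apply] at e5
    rw [e1, e4, Pi.add_apply, e2, e3, schrodingerFun, schrodingerFun, schrodingerFun, e5, mul_add]
  map_smul' c u := by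
    refine Lp.ext ?_
    have h1 := (measurePreserving_sub_right volume g.1).quasiMeasurePreserving.ae_eq_comp
      (Lp.coeFn_smul c u)
    filter_upwards [coeFn_schrodinger lam g (c • u), coeFn_schrodinger lam g u,
      Lp.coeFn_smul c (schrodinger lam g u), h1] with t e1 e2 e4 e5
    simp only [Function.comp_apply, Pi.smul_apply, smul_eq_mul] at e5
    simp only [RingHom.id_apply]
    rw [e1, e4, Pi.smul_apply, e2, schrodingerFun, schrodingerFun, e5, smul_eq_mul]
    ring
  norm_map' u := by
    rw [← toReal_enorm, ← toReal_enorm u]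
    congr 1
    rw [← ENNReal.pow_right_strictMono two_ne_zero |>.injective.eq_iff]
    change ‖schrodinger lam g u‖ₑ ^ 2 = ‖u‖ₑ ^ 2
    rw [Lp.enorm_sq_eq_lintegral, Lp.enorm_sq_eq_lintegral,
      ← lintegral_sub_right_eq_self (fun t => ‖u t‖ₑ ^ 2) g.1]
    refine lintegral_congr_ae ?_
    filter_upwards [coeFn_schrodinger lam g u] with t ht
    have h1 : ‖Complex.exp (2 * Real.pi * Complex.I * lam * g.2.2)‖ₑ = 1 := by
      rw [← ofReal_norm, Complex.norm_exp]; simp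
    have h2 : ‖Complex.exp (-(2 * Real.pi * Complex.I * lam * (inner ℝ g.2.1 t : ℝ)))‖ₑ = 1 := by
      rw [← ofReal_norm, Complex.norm_exp]; simp
    rw [ht, schrodingerFun, enorm_mul, enorm_mul, h1, h2, one_mul, one_mul]

theorem schrodingerLI_apply (lam : ℝ) (g : Heisenberg d) (u : EuclideanL2 d) :
    schrodingerLI lam g u = schrodinger lam g u := rfl

theorem norm_inner_schrodinger_le (lam : ℝ) (g : Heisenberg d) (u v : EuclideanL2 d) :
    ‖inner ℂ u (schrodinger lam g v)‖ ≤ ‖u‖ * ‖v‖ := by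
  refine (norm_inner_le_norm _ _).trans_eq ?_
  rw [← schrodingerLI_apply, LinearIsometry.norm_map]

theorem inner_schrodinger (lam : ℝ) (g : Heisenberg d) (u v : EuclideanL2 d) :
    inner ℂ u (schrodinger lam g v) =
      ∫ t, schrodingerFun lam g v t * (starRingEnd ℂ) (u t) := by
  rw [L2.inner_def]
  refine integral_congr_ae ?_
  filter_upwards [coeFn_schrodinger lam g v] with t ht
  rw [ht]
  rfl

theorem stronglyMeasurable_inner_schrodinger (u v : EuclideanL2 d) :
    StronglyMeasurable fun p : ℝ × Heisenberg d => inner ℂ u (schrodinger p.1 p.2 v) := by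
  simp only [inner_schrodinger]
  refine StronglyMeasurable.integral_prod_right
    (f := fun (p : ℝ × Heisenberg d) t => schrodingerFun p.1 p.2 v t * (starRingEnd ℂ) (u t)) ?_
  refine StronglyMeasurable.mul ?_ ?_
  · unfold schrodingerFun
    -- Continuity is stated on the underlying product, since `Heisenberg d` is given a measure
    -- structure but no topology here.
    refine StronglyMeasurable.mul (Continuous.stronglyMeasurable (α := (ℝ ×
      EuclideanSpace ℝ (Fin d) × EuclideanSpace ℝ (Fin d) × ℝ) × EuclideanSpace ℝ (Fin d)) ?_) ?_
    · fun_prop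
    · refine (Lp.stronglyMeasurable v).comp_measurable ?_
      exact Continuous.measurable (α := (ℝ × EuclideanSpace ℝ (Fin d) ×
        EuclideanSpace ℝ (Fin d) × ℝ) × EuclideanSpace ℝ (Fin d)) (by fun_prop)
  · exact ((Lp.stronglyMeasurable u).comp_measurable measurable_snd).star

/-- Apart from the weight, the right side is the integrand of `kernelTransform` for the kernel `u(t)
conj v(s)`; this identity ties the explicit inverse transform to the representation. -/
theorem conj_inner_schrodinger (lam : ℝ) (g : Heisenberg d) (u v : EuclideanL2 d) :
    (starRingEnd ℂ) (inner ℂ u (schrodinger lam g v)) =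
      Complex.exp (((-2 * Real.pi * inner ℝ lam g.2.2 : ℝ) : ℂ) * Complex.I) *
        𝓕 (fun t => u t * (starRingEnd ℂ) (v (t - g.1))) (-(lam • g.2.1)) := by
  rw [inner_schrodinger, Real.fourier_eq', ← integral_conj, ← integral_const_mul]
  refine integral_congr_ae (Eventually.of_forall fun t => ?_)
  have h1 : (starRingEnd ℂ) (2 * Real.pi * Complex.I * lam * g.2.2)
      = ((-2 * Real.pi * inner ℝ lam g.2.2 : ℝ) : ℂ) * Complex.I := by
    simp [map_ofNat (starRingEnd ℂ) 2]; ring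
  have h2 : (starRingEnd ℂ) (-(2 * Real.pi * Complex.I * lam * (inner ℝ g.2.1 t : ℝ)))
      = ((-2 * Real.pi * inner ℝ t (-(lam • g.2.1)) : ℝ) : ℂ) * Complex.I := by
    rw [inner_neg_right, inner_smul_right, real_inner_comm]
    simp [map_ofNat (starRingEnd ℂ) 2]; ring
  simp only [schrodingerFun]
  rw [map_mul, map_mul, map_mul, ← Complex.exp_conj, ← Complex.exp_conj, h1, h2,
    Complex.conj_conj, smul_eq_mul]
  ring

end Schrodinger

/-! ### Elementary tensors and their inverse transforms. -/

section TestFunctions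

open FourierTransform

variable (d) in
/-- Index set of the elementary tensors `1_s ⊗ |u⟩⟨v|`, with `s` a bounded measurable set. -/
abbrev TensorIndex : Type :=
  {s : Set ℝ // MeasurableSet s ∧ Bornology.IsBounded s} × EuclideanL2 d × EuclideanL2 d

/-- The kernels of the operators `1_s(λ) |u⟩⟨v|`. -/
def tensorKernel (i : TensorIndex d) (lam : ℝ) (t s : EuclideanSpace ℝ (Fin d)) : ℂ :=
  (i.1 : Set ℝ).indicator 1 lam * (i.2.1 t * (starRingEnd ℂ) (i.2.2 s))

theorem stronglyMeasurable_tensorKernel (i : TensorIndex d) :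
    StronglyMeasurable fun p : ℝ × EuclideanSpace ℝ (Fin d) × EuclideanSpace ℝ (Fin d) =>
      tensorKernel i p.1 p.2.1 p.2.2 := by
  refine StronglyMeasurable.mul ?_ (StronglyMeasurable.mul ?_ ?_)
  · exact (stronglyMeasurable_one.indicator i.1.2.1).comp_measurable measurable_fst
  · exact (Lp.stronglyMeasurable _).comp_measurable (measurable_fst.comp measurable_snd)
  · exact ((Lp.stronglyMeasurable _).comp_measurable (measurable_snd.comp measurable_snd)).star

theorem norm_tensorKernel_le (i : TensorIndex d) (lam : ℝ) (t s : EuclideanSpace ℝ (Fin d)) :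
    ‖tensorKernel i lam t s‖ ≤ ‖i.2.1 t‖ * ‖i.2.2 s‖ := by
  rw [tensorKernel, norm_mul, norm_mul, RCLike.norm_conj]
  refine mul_le_of_le_one_left (by positivity) ?_
  by_cases h : lam ∈ (i.1 : Set ℝ) <;> simp [h]

theorem stronglyMeasurable_kernelTransform
    {K : ℝ → EuclideanSpace ℝ (Fin d) → EuclideanSpace ℝ (Fin d) → ℂ}
    (hK : StronglyMeasurable fun p : ℝ × EuclideanSpace ℝ (Fin d) × EuclideanSpace ℝ (Fin d) =>
      K p.1 p.2.1 p.2.2) :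
    StronglyMeasurable (kernelTransform K) := by
  unfold kernelTransform
  simp only [Real.fourier_eq']
  refine StronglyMeasurable.integral_prod_right
    (f := fun (g : Heisenberg d) (lam : ℝ) => Complex.exp
      (((-2 * Real.pi * inner ℝ lam g.2.2 : ℝ) : ℂ) * Complex.I) •
        shearedFourier K g.1 g.2.1 lam) ?_
  have h1 : Continuous fun q : (EuclideanSpace ℝ (Fin d) × EuclideanSpace ℝ (Fin d) × ℝ) × ℝ =>
      Complex.exp (((-2 * Real.pi * inner ℝ q.2 q.1.2.2 : ℝ) : ℂ) * Complex.I) := by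
    fun_prop
  refine h1.stronglyMeasurable.smul ?_
  exact (stronglyMeasurable_shearedFourier hK).comp_measurable
    (g := fun q : (EuclideanSpace ℝ (Fin d) × EuclideanSpace ℝ (Fin d) × ℝ) × ℝ =>
      ((q.1.1, q.1.2.1), q.2)) (Continuous.measurable (by fun_prop))

/-- The kernel of a linear combination of elementary tensors. -/
def combKernel (a : TensorIndex d →₀ ℂ) (lam : ℝ) (t s : EuclideanSpace ℝ (Fin d)) : ℂ :=
  ∑ i ∈ a.support, a i * tensorKernel i lam t s

theorem stronglyMeasurable_combKernel (a : TensorIndex d →₀ ℂ) :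
    StronglyMeasurable fun p : ℝ × EuclideanSpace ℝ (Fin d) × EuclideanSpace ℝ (Fin d) =>
      combKernel a p.1 p.2.1 p.2.2 := by
  unfold combKernel
  exact Finset.stronglyMeasurable_fun_sum _ fun i _ =>
    (stronglyMeasurable_tensorKernel i).const_mul (a i)

theorem norm_combKernel_le (a : TensorIndex d →₀ ℂ) (lam : ℝ)
    (t s : EuclideanSpace ℝ (Fin d)) :
    ‖combKernel a lam t s‖ ≤
      (∑ i ∈ a.support, ‖i.2.1 t‖) * ∑ i ∈ a.support, ‖a i‖ * ‖i.2.2 s‖ := by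
  refine (norm_sum_le _ _).trans ?_
  rw [Finset.sum_mul]
  refine Finset.sum_le_sum fun i hi => ?_
  rw [norm_mul]
  calc ‖a i‖ * ‖tensorKernel i lam t s‖ ≤ ‖a i‖ * (‖i.2.1 t‖ * ‖i.2.2 s‖) := by
        gcongr
        exact norm_tensorKernel_le i lam t s
    _ = ‖i.2.1 t‖ * (‖a i‖ * ‖i.2.2 s‖) := by ring
    _ ≤ _ := by
        gcongr
        exact Finset.single_le_sum (f := fun i : TensorIndex d => ‖a i‖ * ‖i.2.2 s‖)
          (fun _ _ => by positivity) hi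

theorem exists_combKernel_support (a : TensorIndex d →₀ ℂ) :
    ∃ R, ∀ lam t s, lam ∉ Icc (-R) R → combKernel a lam t s = 0 := by
  have h : Bornology.IsBounded (⋃ i ∈ a.support, (i.1 : Set ℝ)) :=
    (Bornology.isBounded_biUnion_finset _).mpr fun i _ => i.1.2.2
  obtain ⟨R, hR⟩ := h.subset_closedBall 0
  refine ⟨R, fun lam t s hlam => Finset.sum_eq_zero fun i hi => ?_⟩
  have : lam ∉ (i.1 : Set ℝ) := fun hmem => hlam <| by
    have := hR (Set.mem_biUnion hi hmem)
    rwa [Real.closedBall_eq_Icc, zero_sub, zero_add] at this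
  simp [tensorKernel, this]

theorem memLp_combKernel_bounds (a : TensorIndex d →₀ ℂ) :
    MemLp (fun t => ∑ i ∈ a.support, ‖i.2.1 t‖) 2 volume ∧
      MemLp (fun s => ∑ i ∈ a.support, ‖a i‖ * ‖i.2.2 s‖) 2 volume :=
  ⟨memLp_finsetSum _ fun _ _ => (Lp.memLp _).norm,
    memLp_finsetSum _ fun _ _ => (Lp.memLp _).norm.const_mul _⟩

theorem tensorKernel_support (i : TensorIndex d) :
    ∃ R, ∀ lam t s, lam ∉ Icc (-R) R → tensorKernel i lam t s = 0 := by
  obtain ⟨R, hR⟩ := exists_combKernel_support (Finsupp.single i 1)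
  refine ⟨R, fun lam t s h => ?_⟩
  simpa [combKernel] using hR lam t s h

theorem shearedFourier_combKernel (a : TensorIndex d →₀ ℂ) (x y : EuclideanSpace ℝ (Fin d))
    (lam : ℝ) : shearedFourier (combKernel a) x y lam =
      ∑ i ∈ a.support, a i * shearedFourier (tensorKernel i) x y lam := by
  simp only [shearedFourier, Real.fourier_eq', combKernel, Finset.smul_sum]
  rw [integral_finsetSum, Finset.mul_sum]
  · refine Finset.sum_congr rfl fun i _ => ?_
    rw [mul_left_comm]
    congr 1
    rw [← integral_const_mul]
    refine integral_congr_ae (Eventually.of_forall fun t => ?_)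
    simp only [smul_eq_mul]
    ring
  · intro i _
    have h := (integrable_sheared (stronglyMeasurable_tensorKernel i) (Lp.memLp i.2.1).norm
      (Lp.memLp i.2.2).norm (norm_tensorKernel_le i) lam x).const_mul (a i)
    exact integrable_fourier_exp h _

theorem memLp_shearedFourier_tensorKernel (i : TensorIndex d) (x y : EuclideanSpace ℝ (Fin d))
    (r : ENNReal) : MemLp (shearedFourier (tensorKernel i) x y) r := by
  obtain ⟨R, hR⟩ := tensorKernel_support i
  exact memLp_shearedFourier (stronglyMeasurable_tensorKernel i) (Lp.memLp i.2.1).norm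
      (Lp.memLp i.2.2).norm (norm_tensorKernel_le i) hR x y r

theorem kernelTransform_combKernel (a : TensorIndex d →₀ ℂ) (g : Heisenberg d) :
    kernelTransform (combKernel a) g = ∑ i ∈ a.support, a i * kernelTransform (tensorKernel i) g := by
  simp only [kernelTransform, Real.fourier_eq', shearedFourier_combKernel, Finset.smul_sum]
  rw [integral_finsetSum]
  · refine Finset.sum_congr rfl fun i _ => ?_
    rw [← integral_const_mul]
    refine integral_congr_ae (Eventually.of_forall fun t => ?_)
    simp only [smul_eq_mul]
    ring
  · intro i _
    exact integrable_fourier_exp ((memLp_one_iff_integrable.mp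
      (memLp_shearedFourier_tensorKernel i g.1 g.2.1 1)).const_mul (a i)) _

/-- This is the inversion formula in trace form: the integrand is `tr (π_λ(g)* |u⟩⟨v|)`, the
conjugate of a matrix coefficient. -/
theorem kernelTransform_tensorKernel (i : TensorIndex d) (g : Heisenberg d) :
    kernelTransform (tensorKernel i) g = ∫ lam in (i.1 : Set ℝ),
      (starRingEnd ℂ) (inner ℂ i.2.1 (schrodinger lam g i.2.2)) ∂plancherelMeasure d := by
  rw [← integral_indicator i.1.2.1, integral_plancherelMeasure, kernelTransform,
    Real.fourier_eq']
  refine integral_congr_ae (Eventually.of_forall fun lam => ?_)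
  by_cases h : lam ∈ (i.1 : Set ℝ)
  · simp only [Set.indicator_of_mem h, conj_inner_schrodinger, shearedFourier, tensorKernel,
      Pi.one_apply, one_mul, smul_eq_mul, Complex.real_smul]
    ring
  · simp [Set.indicator_of_notMem h, shearedFourier, tensorKernel, Real.fourier_eq']

end TestFunctions

end

noncomputable section

variable {d : ℕ}

namespace HilbertSchmidt

variable (H : Type*) [NormedAddCommGroup H] [InnerProductSpace ℂ H] [CompleteSpace H]

/-- The inclusion of the Hilbert-Schmidt operators into the bounded operators. -/
def toCLMₗ : HilbertSchmidt H →ₗ[ℂ] H →L[ℂ] H where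
  toFun := toCLM
  map_add' _ _ := rfl
  map_smul' _ _ := rfl

variable {H}

theorem toCLMₗ_apply (T : HilbertSchmidt H) : toCLMₗ H T = T.toCLM := rfl

end HilbertSchmidt

open HilbertSchmidt

/-! ### The inverse Plancherel transform as an isometry. -/

section TensorIsometry

theorem coeFn_linearCombination {α ι F : Type*} [MeasurableSpace α] {μ : Measure α}
    [NormedAddCommGroup F] [InnerProductSpace ℂ F] (y : ι → Lp F 2 μ) (a : ι →₀ ℂ) :
    Finsupp.linearCombination ℂ y a =ᵐ[μ] fun x => ∑ i ∈ a.support, a i • y i x := by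
  rw [Finsupp.linearCombination_apply, Finsupp.sum]
  have h : ∀ᵐ x ∂μ, ∀ i ∈ a.support, (a i • y i : Lp F 2 μ) x = a i • y i x := by
    rw [eventually_all_finset]
    intro i _
    filter_upwards [Lp.coeFn_smul (a i) (y i)] with x hx
    rw [hx, Pi.smul_apply]
  filter_upwards [h, Lp.coeFn_fun_finsetSum a.support fun i => a i • y i] with x h1 h2
  rw [h2]
  exact Finset.sum_congr rfl h1

theorem lintegral_combKernel (a : TensorIndex d →₀ ℂ) :
    ∫⁻ g, ‖kernelTransform (combKernel a) g‖ₑ ^ 2 =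
      ∫⁻ lam, (∫⁻ t, ∫⁻ s, ‖combKernel a lam t s‖ₑ ^ 2) ∂plancherelMeasure d := by
  obtain ⟨R, hR⟩ := exists_combKernel_support a
  exact lintegral_kernelTransform (stronglyMeasurable_combKernel a) (memLp_combKernel_bounds a).1
    (memLp_combKernel_bounds a).2 (norm_combKernel_le a) hR
    (stronglyMeasurable_kernelTransform (stronglyMeasurable_combKernel a))

theorem measure_tensorIndex_ne_top (i : TensorIndex d) :
    plancherelMeasure d (i.1 : Set ℝ) ≠ ⊤ :=
  i.1.2.2.measure_lt_top.ne

/-- The elementary tensor `1_s ⊗ |u⟩⟨v|`. -/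
def tensorLp (i : TensorIndex d) : Lp (HS d) 2 (plancherelMeasure d) :=
  indicatorConstLp 2 i.1.2.1 (measure_tensorIndex_ne_top i) (rankOne i.2.1 i.2.2)

/-- At each fixed `λ` the combination is a finite rank operator with kernel `combKernel a lam`.
Arbitrary combinations are needed, because the elementary tensors are not orthogonal. -/
theorem enorm_combKernel (a : TensorIndex d →₀ ℂ) (lam : ℝ) :
    ‖∑ i ∈ a.support, a i • (i.1 : Set ℝ).indicator (fun _ => rankOne i.2.1 i.2.2) lam‖ₑ ^ 2 =
      ∫⁻ t, ∫⁻ s, ‖combKernel a lam t s‖ₑ ^ 2 := by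
  have hK : ∀ t, combKernel a lam t = fun s => ∑ i ∈ a.support,
      (a i * ((i.1 : Set ℝ).indicator 1 lam * i.2.1 t)) * (starRingEnd ℂ) (i.2.2 s) := by
    intro t
    ext s
    exact Finset.sum_congr rfl fun i _ => by rw [tensorKernel]; ring
  refine enorm_sq_eq_lintegral_kernel _ (Eventually.of_forall fun t => ?_) fun v => ?_
  · rw [hK]
    exact memLp_finsetSum _ fun i _ => ((Lp.memLp i.2.2).star.const_mul _)
  · have hv : ∀ i : TensorIndex d, (i.1 : Set ℝ).indicator (fun _ => rankOne i.2.1 i.2.2) lam =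
        ((i.1 : Set ℝ).indicator 1 lam : ℂ) • rankOne i.2.1 i.2.2 := by
      intro i
      by_cases h : lam ∈ (i.1 : Set ℝ) <;> simp [h]
    have h1 : ((∑ i ∈ a.support, a i • (i.1 : Set ℝ).indicator
        (fun _ => rankOne i.2.1 i.2.2) lam : HS d).toCLM v) =
        ∑ i ∈ a.support, (a i * ((i.1 : Set ℝ).indicator 1 lam * inner ℂ i.2.2 v)) • i.2.1 := by
      rw [← toCLMₗ_apply, map_sum, sum_apply]
      refine Finset.sum_congr rfl fun i _ => ?_
      rw [hv, map_smul, map_smul, toCLMₗ_apply]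
      simp only [smul_apply, rankOne_apply, smul_smul]
      ring_nf
    rw [h1]
    have h2 : ∀ᵐ t, ∀ i ∈ a.support,
        ((a i * ((i.1 : Set ℝ).indicator 1 lam * inner ℂ i.2.2 v)) • i.2.1 : EuclideanL2 d) t =
        (a i * ((i.1 : Set ℝ).indicator 1 lam * inner ℂ i.2.2 v)) • i.2.1 t := by
      rw [eventually_all_finset]
      intro i _
      filter_upwards [Lp.coeFn_smul (a i * ((i.1 : Set ℝ).indicator 1 lam * inner ℂ i.2.2 v))
        i.2.1] with x hx
      rw [hx, Pi.smul_apply]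
    filter_upwards [h2, Lp.coeFn_fun_finsetSum a.support fun i : TensorIndex d =>
      (a i * ((i.1 : Set ℝ).indicator 1 lam * inner ℂ i.2.2 v)) • i.2.1] with t e1 e2
    rw [e2, Finset.sum_congr rfl e1, hK]
    simp only [Finset.sum_mul]
    rw [integral_finsetSum]
    · refine Finset.sum_congr rfl fun i _ => ?_
      rw [L2.inner_def]
      simp only [mul_assoc]
      rw [integral_const_mul, integral_const_mul, integral_const_mul, smul_eq_mul]
      have h3 : ∫ s, inner ℂ (i.2.2 s) (v s) = ∫ s, (starRingEnd ℂ) (i.2.2 s) * v s :=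
        integral_congr_ae (Eventually.of_forall fun s => mul_comm _ _)
      rw [h3]
      ring
    · intro i _
      exact ((Lp.memLp i.2.2).star.const_mul _).integrable_mul (Lp.memLp v)

theorem enorm_linearCombination_tensorLp (a : TensorIndex d →₀ ℂ) :
    ‖Finsupp.linearCombination ℂ tensorLp a‖ₑ ^ 2 =
      ∫⁻ g, ‖kernelTransform (combKernel a) g‖ₑ ^ 2 := by
  rw [Lp.enorm_sq_eq_lintegral, lintegral_combKernel]
  refine lintegral_congr_ae ?_
  have h : ∀ᵐ lam ∂plancherelMeasure d, ∀ i ∈ a.support, tensorLp i lam =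
      (i.1 : Set ℝ).indicator (fun _ => rankOne i.2.1 i.2.2) lam := by
    rw [eventually_all_finset]
    intro i _
    exact indicatorConstLp_coeFn
  filter_upwards [coeFn_linearCombination tensorLp a, h] with lam h1 h2
  rw [h1, ← enorm_combKernel]
  congr 2
  exact Finset.sum_congr rfl fun i hi => by rw [h2 i hi]

theorem memLp_kernelTransform_tensorKernel (i : TensorIndex d) :
    MemLp (kernelTransform (tensorKernel i)) 2 volume := by
  refine memLp_two_of_lintegral (stronglyMeasurable_kernelTransform
    (stronglyMeasurable_tensorKernel i)).aestronglyMeasurable ?_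
  have h1 := enorm_linearCombination_tensorLp (Finsupp.single i 1)
  have h2 : kernelTransform (combKernel (Finsupp.single i 1)) =
      kernelTransform (tensorKernel i) := by
    ext g
    rw [kernelTransform_combKernel]
    simp
  rw [h2] at h1
  rw [← h1]
  exact ENNReal.pow_lt_top enorm_lt_top

/-- The inverse Plancherel transform of the elementary tensor `1_s ⊗ |u⟩⟨v|`. -/
def tensorInv (i : TensorIndex d) : HeisenbergL2 d :=
  (memLp_kernelTransform_tensorKernel i).toLp _

/-- With formal combinations no well-definedness has to be checked: equality of the norms already
forces relations among the tensors to hold among their inverse transforms, and gives the extension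
by density. -/
theorem norm_linearCombination_tensorInv (a : TensorIndex d →₀ ℂ) :
    ‖Finsupp.linearCombination ℂ tensorInv a‖ = ‖Finsupp.linearCombination ℂ tensorLp a‖ := by
  rw [← toReal_enorm, ← toReal_enorm (Finsupp.linearCombination ℂ tensorLp a)]
  congr 1
  rw [← ENNReal.pow_right_strictMono two_ne_zero |>.injective.eq_iff]
  rw [enorm_linearCombination_tensorLp, Lp.enorm_sq_eq_lintegral]
  refine lintegral_congr_ae ?_
  have h : ∀ᵐ g, ∀ i ∈ a.support, tensorInv i g = kernelTransform (tensorKernel i) g := by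
    rw [eventually_all_finset]
    intro i _
    exact MemLp.coeFn_toLp _
  filter_upwards [coeFn_linearCombination tensorInv a, h] with g h1 h2
  rw [h1, kernelTransform_combKernel]
  congr 2
  exact Finset.sum_congr rfl fun i hi => by rw [h2 i hi, smul_eq_mul]

theorem inner_tensorLp (i : TensorIndex d) (F : Lp (HS d) 2 (plancherelMeasure d)) :
    inner ℂ (tensorLp i) F =
      ∫ lam in (i.1 : Set ℝ), inner ℂ i.2.1 ((F lam).toCLM i.2.2) ∂plancherelMeasure d := by
  rw [tensorLp, L2.inner_indicatorConstLp_eq_setIntegral_inner]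
  simp only [inner_rankOne]

/-- A function whose integrals over bounded measurable sets vanish is zero almost everywhere. -/
theorem ae_eq_zero_of_forall_setIntegral_bounded {V : Type*} [NormedAddCommGroup V]
    [MeasurableSpace V] [BorelSpace V] {μ : Measure V} {h : V → ℂ}
    (hi : ∀ s, Bornology.IsBounded s → IntegrableOn h s μ)
    (h0 : ∀ s, MeasurableSet s → Bornology.IsBounded s → ∫ x in s, h x ∂μ = 0) :
    ∀ᵐ x ∂μ, h x = 0 := by
  have key : ∀ n : ℕ, ∀ᵐ x ∂μ.restrict (Metric.ball 0 n), h x = 0 := by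
    intro n
    refine (hi _ Metric.isBounded_ball).ae_eq_zero_of_forall_setIntegral_eq_zero fun s hs _ => ?_
    rw [Measure.restrict_restrict hs]
    exact h0 _ (hs.inter measurableSet_ball) (Metric.isBounded_ball.subset inter_subset_right)
  have := ae_restrict_iUnion_iff (μ := μ) (fun n : ℕ => Metric.ball (0 : V) n) (fun x => h x = 0)
  rw [Metric.iUnion_ball_nat, Measure.restrict_univ] at this
  exact this.mpr key

theorem integrableOn_inner_toCLM (F : Lp (HS d) 2 (plancherelMeasure d)) (u v : EuclideanL2 d)
    {s : Set ℝ} (hs : Bornology.IsBounded s) :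
    IntegrableOn (fun lam => inner ℂ u ((F lam).toCLM v)) s (plancherelMeasure d) := by
  have : IsFiniteMeasure ((plancherelMeasure d).restrict s) :=
    ⟨by rw [Measure.restrict_apply_univ]; exact hs.measure_lt_top⟩
  simp only [← inner_rankOne]
  have h1 : MemLp (fun _ : ℝ => rankOne u v) 2 ((plancherelMeasure d).restrict s) :=
    memLp_const _
  have h2 := (Lp.memLp F).restrict s
  refine (L2.integrable_inner (𝕜 := ℂ) (h1.toLp _) (h2.toLp _)).congr ?_
  filter_upwards [h1.coeFn_toLp, h2.coeFn_toLp] with lam e1 e2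
  rw [e1, e2]

theorem HilbertSchmidt.eq_of_inner_basis {S T : HS d}
    (h : ∀ i j, inner ℂ (hsBasis (EuclideanL2 d) i) (S.toCLM (hsBasis (EuclideanL2 d) j)) =
      inner ℂ (hsBasis (EuclideanL2 d) i) (T.toCLM (hsBasis (EuclideanL2 d) j))) : S = T := by
  refine toL2_injective _ (lp.ext (funext fun j => ?_))
  refine (hsBasis (EuclideanL2 d)).repr.injective (lp.ext (funext fun i => ?_))
  rw [HilbertBasis.repr_apply_apply, HilbertBasis.repr_apply_apply]
  exact h i j

/-- The hypothesis makes each matrix coefficient of `F - G` integrate to zero over all bounded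
measurable sets. Countably many pairs of basis vectors then leave a single null set. -/
theorem eq_of_inner_tensorLp {F G : Lp (HS d) 2 (plancherelMeasure d)}
    (h : ∀ i, inner ℂ (tensorLp i) F = inner ℂ (tensorLp i) G) : F = G := by
  refine Lp.ext ?_
  have key : ∀ u v : EuclideanL2 d, ∀ᵐ lam ∂plancherelMeasure d,
      inner ℂ u ((F lam).toCLM v) - inner ℂ u ((G lam).toCLM v) = 0 := by
    intro u v
    refine ae_eq_zero_of_forall_setIntegral_bounded
      (fun s hs => (integrableOn_inner_toCLM F u v hs).sub (integrableOn_inner_toCLM G u v hs)) ?_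
    intro s hs hb
    have h1 := h ⟨⟨s, hs, hb⟩, u, v⟩
    rw [inner_tensorLp, inner_tensorLp] at h1
    rw [integral_sub (integrableOn_inner_toCLM F u v hb) (integrableOn_inner_toCLM G u v hb)]
    exact sub_eq_zero.mpr h1
  filter_upwards [ae_all_iff.mpr fun i => ae_all_iff.mpr fun j =>
    key (hsBasis (EuclideanL2 d) i) (hsBasis (EuclideanL2 d) j)] with lam hlam
  exact eq_of_inner_basis fun i j => sub_eq_zero.mp (hlam i j)

theorem denseRange_linearCombination_tensorLp :
    DenseRange (Finsupp.linearCombination ℂ (tensorLp (d := d))) := by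
  have h : (LinearMap.range (Finsupp.linearCombination ℂ (tensorLp (d := d))))ᗮ = ⊥ := by
    rw [eq_bot_iff]
    intro F hF
    refine eq_of_inner_tensorLp fun i => ?_
    rw [inner_zero_right]
    refine (Submodule.mem_orthogonal _ _).mp hF _ ⟨Finsupp.single i 1, ?_⟩
    simp
  have h2 := Submodule.dense_iff_topologicalClosure_eq_top.mpr
    (Submodule.topologicalClosure_eq_top_iff.mpr h)
  exact h2

variable (d) in
/-- The inverse Plancherel transform as a linear isometry. -/
def plancherelInv : Lp (HS d) 2 (plancherelMeasure d) →ₗᵢ[ℂ] HeisenbergL2 d where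
  toLinearMap := ((Finsupp.linearCombination ℂ tensorInv).extendOfNorm
    (Finsupp.linearCombination ℂ tensorLp)).toLinearMap
  norm_map' F := by
    refine denseRange_linearCombination_tensorLp.induction_on (p := fun F =>
      ‖(Finsupp.linearCombination ℂ tensorInv).extendOfNorm
      (Finsupp.linearCombination ℂ tensorLp) F‖ = ‖F‖) F ?_ fun a => ?_
    · exact isClosed_eq (by fun_prop) (by fun_prop)
    · rw [LinearMap.extendOfNorm_eq denseRange_linearCombination_tensorLp
        ⟨1, fun x => by rw [norm_linearCombination_tensorInv, one_mul]⟩]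
      exact norm_linearCombination_tensorInv a

theorem plancherelInv_tensorLp (i : TensorIndex d) :
    plancherelInv d (tensorLp i) = tensorInv i := by
  have h := LinearMap.extendOfNorm_eq (f := Finsupp.linearCombination ℂ (tensorInv (d := d)))
    denseRange_linearCombination_tensorLp
    ⟨1, fun x => by rw [norm_linearCombination_tensorInv, one_mul]⟩ (Finsupp.single i 1)
  simp only [Finsupp.linearCombination_single, one_smul] at h
  exact h

/-- Fubini in `(λ, g)`, legitimate because matrix coefficients are bounded, `f` is integrable and
the set of `λ` has finite measure. The formula identifies the adjoint of the inverse transform in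
the weak sense. -/
theorem inner_tensorInv (i : TensorIndex d) (f : HeisenbergL2 d) (hf : Integrable f volume) :
    inner ℂ (tensorInv i) f = ∫ lam in (i.1 : Set ℝ),
      (∫ g, f g * inner ℂ i.2.1 (schrodinger lam g i.2.2)) ∂plancherelMeasure d := by
  have : IsFiniteMeasure ((plancherelMeasure d).restrict (i.1 : Set ℝ)) :=
    ⟨by rw [Measure.restrict_apply_univ]; exact i.1.2.2.measure_lt_top⟩
  have : SFinite (volume : Measure (Heisenberg d)) :=
    inferInstanceAs (SFinite (volume : Measure
      (EuclideanSpace ℝ (Fin d) × EuclideanSpace ℝ (Fin d) × ℝ)))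
  rw [L2.inner_def, integral_integral_swap]
  · refine integral_congr_ae ?_
    filter_upwards [(memLp_kernelTransform_tensorKernel i).coeFn_toLp] with g hg
    rw [tensorInv, hg, kernelTransform_tensorKernel, integral_const_mul, RCLike.inner_apply,
      ← integral_conj]
    simp only [Complex.conj_conj]
  · have h1 : Integrable (fun p : ℝ × Heisenberg d => f p.2)
        (((plancherelMeasure d).restrict (i.1 : Set ℝ)).prod volume) :=
      hf.comp_snd _
    refine (h1.bdd_mul (c := ‖i.2.1‖ * ‖i.2.2‖)
      (stronglyMeasurable_inner_schrodinger i.2.1 i.2.2).aestronglyMeasurable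
      (Eventually.of_forall fun p => norm_inner_schrodinger_le _ _ _ _)).congr ?_
    exact Eventually.of_forall fun p => mul_comm _ _

end TensorIsometry

end

noncomputable section

variable {d : ℕ}

open HilbertSchmidt

instance : SFinite (volume : Measure (Heisenberg d)) :=
  inferInstanceAs (SFinite (volume : Measure
    (EuclideanSpace ℝ (Fin d) × EuclideanSpace ℝ (Fin d) × ℝ)))

/-! ### The adjoint agrees with the operator-valued Fourier transform. -/

section Adjoint

theorem integrable_mul_inner_schrodinger (i : TensorIndex d) {f : Heisenberg d → ℂ}
    (hf : Integrable f volume) :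
    Integrable (fun p : ℝ × Heisenberg d => f p.2 * inner ℂ i.2.1 (schrodinger p.1 p.2 i.2.2))
      (((plancherelMeasure d).restrict (i.1 : Set ℝ)).prod volume) := by
  have : IsFiniteMeasure ((plancherelMeasure d).restrict (i.1 : Set ℝ)) :=
    ⟨by rw [Measure.restrict_apply_univ]; exact i.1.2.2.measure_lt_top⟩
  have h1 : Integrable (fun p : ℝ × Heisenberg d => f p.2)
      (((plancherelMeasure d).restrict (i.1 : Set ℝ)).prod volume) :=
    hf.comp_snd _
  refine (h1.bdd_mul (c := ‖i.2.1‖ * ‖i.2.2‖)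
    (stronglyMeasurable_inner_schrodinger i.2.1 i.2.2).aestronglyMeasurable
    (Eventually.of_forall fun p => norm_inner_schrodinger_le _ _ _ _)).congr ?_
  exact Eventually.of_forall fun p => mul_comm _ _

variable (d) in
/-- The adjoint of the inverse Plancherel transform. -/
def plancherelAdj : HeisenbergL2 d →L[ℂ] Lp (HS d) 2 (plancherelMeasure d) :=
  ContinuousLinearMap.adjoint (plancherelInv d).toContinuousLinearMap

theorem inner_plancherelAdj (F : Lp (HS d) 2 (plancherelMeasure d)) (f : HeisenbergL2 d) :
    inner ℂ F (plancherelAdj d f) = inner ℂ (plancherelInv d F) f :=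
  ContinuousLinearMap.adjoint_inner_right _ _ _

/-- Both fields have the same pairings with all elementary tensors. Hence the Fourier graph lies in
the graph of one bounded operator. -/
theorem eq_plancherelAdj_of_mem_fourierGraph {f : HeisenbergL2 d}
    {F : Lp (HS d) 2 (plancherelMeasure d)} (h : (f, F) ∈ fourierGraph d) :
    F = plancherelAdj d f := by
  refine eq_of_inner_tensorLp fun i => ?_
  rw [inner_plancherelAdj, plancherelInv_tensorLp, inner_tensorInv i f h.1, inner_tensorLp]
  refine integral_congr_ae ?_
  filter_upwards [ae_restrict_of_ae h.2] with lam hlam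
  exact hlam i.2.2 i.2.1

/-- Dominated convergence. Continuity in the two vectors lets an identity known on a countable dense
set of pairs, off one null set of `λ`, spread to all pairs. -/
theorem continuous_integral_mul_inner_schrodinger {f : Heisenberg d → ℂ}
    (hf : Integrable f volume) (lam : ℝ) :
    Continuous fun p : EuclideanL2 d × EuclideanL2 d =>
      ∫ g, f g * inner ℂ p.1 (schrodinger lam g p.2) := by
  refine continuous_iff_continuousAt.mpr fun p₀ => ?_
  refine continuousAt_of_dominated (bound := fun g => ‖f g‖ * ((‖p₀.1‖ + 1) * (‖p₀.2‖ + 1)))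
    (Eventually.of_forall fun p => ?_) ?_ (hf.norm.mul_const _) (Eventually.of_forall fun g => ?_)
  · exact hf.1.mul ((stronglyMeasurable_inner_schrodinger p.1 p.2).comp_measurable
      (measurable_prodMk_left (x := lam))).aestronglyMeasurable
  · have h1 : ∀ᶠ p in 𝓝 p₀, ‖p.1‖ < ‖p₀.1‖ + 1 :=
      (continuous_fst.norm.tendsto p₀).eventually_lt_const (by simp)
    have h2 : ∀ᶠ p in 𝓝 p₀, ‖p.2‖ < ‖p₀.2‖ + 1 :=
      (continuous_snd.norm.tendsto p₀).eventually_lt_const (by simp)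
    filter_upwards [h1, h2] with p e1 e2
    refine Eventually.of_forall fun g => ?_
    rw [norm_mul]
    gcongr
    refine (norm_inner_schrodinger_le _ _ _ _).trans ?_
    gcongr
  · refine (Continuous.continuousAt ?_)
    simp only [← schrodingerLI_apply]
    exact continuous_const.mul
      (continuous_fst.inner ((schrodingerLI lam g).continuous.comp continuous_snd))

theorem mem_fourierGraph_of_integrable {f : HeisenbergL2 d} (hf : Integrable f volume) :
    (f, plancherelAdj d f) ∈ fourierGraph d := by
  refine ⟨hf, ?_⟩
  have key : ∀ u v : EuclideanL2 d, ∀ᵐ lam ∂plancherelMeasure d,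
      inner ℂ u ((plancherelAdj d f lam).toCLM v) -
        ∫ g, f g * inner ℂ u (schrodinger lam g v) = 0 := by
    intro u v
    have hi : ∀ s, MeasurableSet s → Bornology.IsBounded s → IntegrableOn
        (fun lam => ∫ g, f g * inner ℂ u (schrodinger lam g v)) s (plancherelMeasure d) :=
      fun s hs hb => (integrable_mul_inner_schrodinger ⟨⟨s, hs, hb⟩, u, v⟩ hf).integral_prod_left
    refine ae_eq_zero_of_forall_setIntegral_bounded (fun s hb => ?_) ?_
    · refine (integrableOn_inner_toCLM _ u v hb).sub ?_
      obtain ⟨R, hR⟩ := hb.subset_closedBall 0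
      exact (hi _ measurableSet_closedBall Metric.isBounded_closedBall).mono_set hR
    · intro s hs hb
      have h1 := inner_plancherelAdj (tensorLp ⟨⟨s, hs, hb⟩, u, v⟩) f
      rw [plancherelInv_tensorLp, inner_tensorInv _ f hf, inner_tensorLp] at h1
      rw [integral_sub (integrableOn_inner_toCLM _ u v hb) (hi s hs hb)]
      exact sub_eq_zero.mpr h1
  -- The exceptional set depends on `u` and `v`; a dense sequence of pairs keeps it null.
  filter_upwards [ae_all_iff.mpr fun i => ae_all_iff.mpr fun j =>
    key (TopologicalSpace.denseSeq _ i) (TopologicalSpace.denseSeq _ j)] with lam hlam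
  have hd := (TopologicalSpace.denseRange_denseSeq (EuclideanL2 d)).prodMap
    (TopologicalSpace.denseRange_denseSeq (EuclideanL2 d))
  unfold IsOperatorFourier
  generalize (plancherelAdj d f lam).toCLM = S at hlam ⊢
  have h1 : Continuous fun p : EuclideanL2 d × EuclideanL2 d => inner ℂ p.1 (S p.2) := by fun_prop
  have h2 := continuous_integral_mul_inner_schrodinger hf lam
  have h3 := hd.equalizer h1 h2 (funext fun p => sub_eq_zero.mp (hlam p.1 p.2))
  exact fun u v => congrFun h3 (v, u)

end Adjoint

/-! ### Integrable functions determined by their integrals over boxes. -/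

section Totality

/-- Dynkin's argument: sets with vanishing integral are stable under complements, thanks to `huniv`,
and under countable disjoint unions. -/
theorem ae_eq_zero_of_setIntegral_piSystem {α : Type*} [m : MeasurableSpace α] {μ : Measure α}
    {f : α → ℂ} (hf : Integrable f μ) {C : Set (Set α)} (hgen : m = MeasurableSpace.generateFrom C)
    (hpi : IsPiSystem C) (huniv : Set.univ ∈ C) (h0 : ∀ s ∈ C, ∫ x in s, f x ∂μ = 0) :
    f =ᵐ[μ] 0 := by
  have htot : ∫ x, f x ∂μ = 0 := by simpa using h0 _ huniv
  refine hf.ae_eq_zero_of_forall_setIntegral_eq_zero fun s hs hμ => ?_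
  clear hμ
  induction s, hs using MeasurableSpace.induction_on_inter hgen hpi with
  | empty => simp
  | basic t ht => exact h0 t ht
  | compl t ht ih =>
    have := integral_add_compl ht hf
    rw [ih, htot, zero_add] at this
    exact this
  | iUnion g hd hm ih =>
    rw [integral_iUnion hm hd hf.integrableOn]
    simp only [ih, tsum_zero]

/-- The box `A × B × C` in the Heisenberg group. -/
def Heisenberg.box (A B : Set (EuclideanSpace ℝ (Fin d))) (C : Set ℝ) : Set (Heisenberg d) :=
  A ×ˢ B ×ˢ C

theorem Heisenberg.measurableSet_box {A B : Set (EuclideanSpace ℝ (Fin d))} {C : Set ℝ}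
    (hA : MeasurableSet A) (hB : MeasurableSet B) (hC : MeasurableSet C) :
    MeasurableSet (box A B C) :=
  MeasurableSet.prod hA (hB.prod hC)

theorem Heisenberg.volume_box (A B : Set (EuclideanSpace ℝ (Fin d))) (C : Set ℝ) :
    volume (box A B C) = volume A * (volume B * volume C) := by
  refine (Measure.prod_prod (μ := (volume : Measure (EuclideanSpace ℝ (Fin d))))
    (ν := (volume : Measure (EuclideanSpace ℝ (Fin d) × ℝ))) A (B ×ˢ C)).trans ?_
  rw [Measure.volume_eq_prod, Measure.prod_prod]

theorem Heisenberg.ae_eq_zero_of_setIntegral_box {f : Heisenberg d → ℂ} (hf : Integrable f volume)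
    (h0 : ∀ A B C, MeasurableSet A → MeasurableSet B → MeasurableSet C →
      ∫ g in box A B C, f g = 0) : f =ᵐ[volume] 0 := by
  have hspan : ∀ {α : Type} [MeasurableSpace α],
      IsCountablySpanning {s : Set α | MeasurableSet s} := isCountablySpanning_measurableSet
  have hgen1 : (inferInstance : MeasurableSpace (EuclideanSpace ℝ (Fin d) × ℝ)) =
      MeasurableSpace.generateFrom (image2 (· ×ˢ ·) {s : Set (EuclideanSpace ℝ (Fin d)) |
        MeasurableSet s} {s : Set ℝ | MeasurableSet s}) := generateFrom_prod.symm
  set D := image2 (· ×ˢ ·) {s : Set (EuclideanSpace ℝ (Fin d)) |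
        MeasurableSet s} {s : Set ℝ | MeasurableSet s} with hD
  have hDspan : IsCountablySpanning D := isCountablySpanning_measurableSet.prod
    isCountablySpanning_measurableSet
  have hgen : (inferInstance : MeasurableSpace (EuclideanSpace ℝ (Fin d) ×
      EuclideanSpace ℝ (Fin d) × ℝ)) = MeasurableSpace.generateFrom
        (image2 (· ×ˢ ·) {s : Set (EuclideanSpace ℝ (Fin d)) | MeasurableSet s} D) := by
    exact (generateFrom_eq_prod MeasurableSpace.generateFrom_measurableSet hgen1.symm
      isCountablySpanning_measurableSet hDspan).symm
  refine ae_eq_zero_of_setIntegral_piSystem hf hgen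
    (MeasurableSpace.isPiSystem_measurableSet.prod (isPiSystem_prod)) ?_ ?_
  · exact ⟨univ, by simp, univ, ⟨univ, by simp, univ, by simp, univ_prod_univ⟩, univ_prod_univ⟩
  · rintro _ ⟨A, hA, _, ⟨B, hB, C, hC, rfl⟩, rfl⟩
    exact h0 A B C hA hB hC

end Totality

end

noncomputable section

variable {d : ℕ}

open HilbertSchmidt FourierTransform

/-! ### The operator-valued Fourier transform of a box. -/

section Boxes

theorem Heisenberg.restrict_box {E : Type*} [NormedAddCommGroup E] [NormedSpace ℝ E]
    (A B : Set (EuclideanSpace ℝ (Fin d))) (C : Set ℝ) (F : Heisenberg d → E) :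
    ∫ g in box A B C, F g = ∫ p : EuclideanSpace ℝ (Fin d) × EuclideanSpace ℝ (Fin d) × ℝ, F p
      ∂((volume.restrict A).prod ((volume.restrict B).prod (volume.restrict C))) := by
  rw [Measure.prod_restrict, Measure.prod_restrict]
  rfl

variable {A B S : Set (EuclideanSpace ℝ (Fin d))} {C : Set ℝ}

/-- The integrand is a product of functions of `x`, `y` and `w` separately. The phases in `w` and
`y` produce the two Fourier transforms, and `x` produces a convolution with `1_A`. -/
theorem setIntegral_box_schrodingerFun (hA : MeasurableSet A) (hB : MeasurableSet B)
    (hC : MeasurableSet C) (lam : ℝ) (v : EuclideanSpace ℝ (Fin d) → ℂ)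
    (s : EuclideanSpace ℝ (Fin d)) :
    ∫ g in Heisenberg.box A B C, schrodingerFun lam g v s =
      (𝓕 (C.indicator (1 : ℝ → ℂ)) (-lam) *
        𝓕 (B.indicator (1 : EuclideanSpace ℝ (Fin d) → ℂ)) (lam • s)) *
        ∫ t, A.indicator 1 (s - t) * v t := by
  have e1 : ∫ x in A, v (s - x) = ∫ t, A.indicator 1 (s - t) * v t := by
    rw [← integral_indicator hA, ← integral_sub_left_eq_self _ volume s]
    refine integral_congr_ae (Eventually.of_forall fun t => ?_)
    by_cases h : s - t ∈ A <;> simp [h]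
  have e2 : ∫ y in B, Complex.exp (-(2 * Real.pi * Complex.I * lam * (inner ℝ y s : ℝ))) =
      𝓕 (B.indicator (1 : EuclideanSpace ℝ (Fin d) → ℂ)) (lam • s) := by
    rw [← integral_indicator hB, Real.fourier_eq']
    refine integral_congr_ae (Eventually.of_forall fun y => ?_)
    by_cases h : y ∈ B
    · simp only [indicator_of_mem h, Pi.one_apply, smul_eq_mul, mul_one, inner_smul_right]
      congr 1
      push_cast
      ring
    · simp [h]
  have e3 : ∫ w in C, Complex.exp (2 * Real.pi * Complex.I * lam * w) =
      𝓕 (C.indicator (1 : ℝ → ℂ)) (-lam) := by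
    rw [← integral_indicator hC, Real.fourier_eq']
    refine integral_congr_ae (Eventually.of_forall fun w => ?_)
    by_cases h : w ∈ C
    · simp only [indicator_of_mem h, Pi.one_apply, smul_eq_mul, mul_one, RCLike.inner_apply,
        conj_trivial]
      congr 1
      push_cast
      ring
    · simp [h]
  rw [Heisenberg.restrict_box, ← e1, ← e2, ← e3]
  have h1 := integral_prod_mul (μ := volume.restrict B) (ν := volume.restrict C)
    (fun y : EuclideanSpace ℝ (Fin d) =>
      Complex.exp (-(2 * Real.pi * Complex.I * lam * (inner ℝ y s : ℝ))))
    (fun w : ℝ => Complex.exp (2 * Real.pi * Complex.I * lam * w))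
  have h2 := integral_prod_mul (μ := volume.restrict A)
    (ν := (volume.restrict B).prod (volume.restrict C))
    (fun x => v (s - x)) (fun p : EuclideanSpace ℝ (Fin d) × ℝ =>
      Complex.exp (-(2 * Real.pi * Complex.I * lam * (inner ℝ p.1 s : ℝ))) *
      Complex.exp (2 * Real.pi * Complex.I * lam * p.2))
  rw [h1] at h2
  rw [mul_comm (∫ w in C, _), mul_comm _ (∫ x in A, _), ← h2]
  refine integral_congr_ae (Eventually.of_forall fun p => ?_)
  simp only [schrodingerFun]
  ring

theorem Heisenberg.volume_box_lt_top (hA : Bornology.IsBounded A) (hB : Bornology.IsBounded B)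
    (hC : Bornology.IsBounded C) : volume (box A B C) < ⊤ := by
  rw [volume_box]
  exact ENNReal.mul_lt_top hA.measure_lt_top
    (ENNReal.mul_lt_top hB.measure_lt_top hC.measure_lt_top)

theorem enorm_schrodingerFun (lam : ℝ) (g : Heisenberg d) (v : EuclideanSpace ℝ (Fin d) → ℂ)
    (t : EuclideanSpace ℝ (Fin d)) : ‖schrodingerFun lam g v t‖ₑ = ‖v (t - g.1)‖ₑ := by
  have h1 : ‖Complex.exp (2 * Real.pi * Complex.I * lam * g.2.2)‖ₑ = 1 := by
    rw [← ofReal_norm, Complex.norm_exp]; simp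
  have h2 : ‖Complex.exp (-(2 * Real.pi * Complex.I * lam * (inner ℝ g.2.1 t : ℝ)))‖ₑ = 1 := by
    rw [← ofReal_norm, Complex.norm_exp]; simp
  rw [schrodingerFun, enorm_mul, enorm_mul, h1, h2, one_mul, one_mul]

theorem stronglyMeasurable_schrodingerFun (lam : ℝ) (v : EuclideanL2 d) :
    StronglyMeasurable fun p : Heisenberg d × EuclideanSpace ℝ (Fin d) =>
      schrodingerFun lam p.1 v p.2 := by
  unfold schrodingerFun
  refine StronglyMeasurable.mul (Continuous.stronglyMeasurable (α := (
      EuclideanSpace ℝ (Fin d) × EuclideanSpace ℝ (Fin d) × ℝ) × EuclideanSpace ℝ (Fin d)) ?_) ?_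
  · fun_prop
  · refine (Lp.stronglyMeasurable v).comp_measurable ?_
    exact Continuous.measurable (α := (EuclideanSpace ℝ (Fin d) ×
        EuclideanSpace ℝ (Fin d) × ℝ) × EuclideanSpace ℝ (Fin d)) (by fun_prop)

theorem integrable_schrodingerFun (hA : Bornology.IsBounded A) (hB : Bornology.IsBounded B)
    (hC : Bornology.IsBounded C) (hS : Bornology.IsBounded S) (lam : ℝ) (v : EuclideanL2 d) :
    Integrable (fun p : Heisenberg d × EuclideanSpace ℝ (Fin d) => schrodingerFun lam p.1 v p.2)
      ((volume.restrict (Heisenberg.box A B C)).prod (volume.restrict S)) := by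
  have : IsFiniteMeasure ((volume : Measure (Heisenberg d)).restrict (Heisenberg.box A B C)) :=
    ⟨by rw [Measure.restrict_apply_univ]; exact Heisenberg.volume_box_lt_top hA hB hC⟩
  have : IsFiniteMeasure ((volume : Measure (EuclideanSpace ℝ (Fin d))).restrict S) :=
    ⟨by rw [Measure.restrict_apply_univ]; exact hS.measure_lt_top⟩
  have hm := stronglyMeasurable_schrodingerFun lam v
  refine (memLp_two_of_lintegral hm.aestronglyMeasurable ?_).integrable one_le_two
  rw [lintegral_prod _ (hm.enorm.pow_const 2).aemeasurable]
  simp only [enorm_schrodingerFun]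
  calc ∫⁻ g in Heisenberg.box A B C, ∫⁻ t in S, ‖v (t - g.1)‖ₑ ^ 2
      ≤ ∫⁻ g in Heisenberg.box A B C, ‖v‖ₑ ^ 2 := by
        refine lintegral_mono fun g => ?_
        rw [Lp.enorm_sq_eq_lintegral, ← lintegral_sub_right_eq_self (fun t => ‖v t‖ₑ ^ 2) g.1]
        exact setLIntegral_le_lintegral _ _
    _ < ⊤ := by
        rw [lintegral_const]
        exact ENNReal.mul_lt_top (ENNReal.pow_lt_top enorm_lt_top) (measure_lt_top _ _)

theorem setIntegral_box_inner_schrodinger (hA : MeasurableSet A) (hB : MeasurableSet B)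
    (hC : MeasurableSet C) (hA' : Bornology.IsBounded A) (hB' : Bornology.IsBounded B)
    (hC' : Bornology.IsBounded C) (hS : MeasurableSet S) (hS' : Bornology.IsBounded S)
    (lam : ℝ) (v : EuclideanL2 d) :
    ∫ g in Heisenberg.box A B C, inner ℂ (indicatorConstLp 2 hS hS'.measure_lt_top.ne (1 : ℂ))
      (schrodinger lam g v) =
    ∫ s in S, (𝓕 (C.indicator (1 : ℝ → ℂ)) (-lam) *
        𝓕 (B.indicator (1 : EuclideanSpace ℝ (Fin d) → ℂ)) (lam • s)) *
        ∫ t, A.indicator 1 (s - t) * v t := by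
  have h1 : ∀ g, inner ℂ (indicatorConstLp 2 hS hS'.measure_lt_top.ne (1 : ℂ))
      (schrodinger lam g v) = ∫ s in S, schrodingerFun lam g v s := by
    intro g
    rw [L2.inner_indicatorConstLp_one]
    exact integral_congr_ae (ae_restrict_of_ae (coeFn_schrodinger lam g v))
  simp only [h1]
  rw [integral_integral_swap (integrable_schrodingerFun hA' hB' hC' hS' lam v)]
  simp only [setIntegral_box_schrodingerFun hA hB hC]

theorem integrable_indicator_one {V : Type*} [NormedAddCommGroup V] [MeasurableSpace V]
    [ProperSpace V] {μ : Measure V} [IsLocallyFiniteMeasure μ] {D : Set V}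
    (hD : MeasurableSet D) (hD' : Bornology.IsBounded D) :
    Integrable (D.indicator (1 : V → ℂ)) μ :=
  (integrable_indicator_iff hD).mpr (integrableOn_const hD'.measure_lt_top.ne)

theorem memLp_indicator_one {V : Type*} [NormedAddCommGroup V] [MeasurableSpace V]
    [ProperSpace V] {μ : Measure V} [IsLocallyFiniteMeasure μ] {D : Set V}
    (hD : MeasurableSet D) (hD' : Bornology.IsBounded D) (p : ENNReal) :
    MemLp (D.indicator (1 : V → ℂ)) p μ :=
  memLp_indicator_const p hD 1 (Or.inr hD'.measure_lt_top.ne)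

theorem lintegral_indicator_one_sq {V : Type*} [MeasurableSpace V]
    {μ : Measure V} {D : Set V} (hD : MeasurableSet D) :
    ∫⁻ x, ‖D.indicator (1 : V → ℂ) x‖ₑ ^ 2 ∂μ = μ D := by
  rw [← lintegral_indicator_one hD]
  refine lintegral_congr fun x => ?_
  by_cases h : x ∈ D <;> simp [h]

theorem continuous_fourier {V : Type*} [NormedAddCommGroup V] [InnerProductSpace ℝ V]
    [FiniteDimensional ℝ V] [MeasurableSpace V] [BorelSpace V] {f : V → ℂ} (hf : Integrable f) :
    Continuous (𝓕 f) :=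
  VectorFourier.fourierIntegral_continuous Real.continuous_fourierChar
    (by exact continuous_inner) hf

/-- The kernel of the operator-valued Fourier transform of the indicator function of a box. -/
theorem toCLM_ae_eq_of_isOperatorFourier_box (hA : MeasurableSet A) (hB : MeasurableSet B)
    (hC : MeasurableSet C) (hA' : Bornology.IsBounded A) (hB' : Bornology.IsBounded B)
    (hC' : Bornology.IsBounded C) {lam : ℝ} {T : HS d}
    (hT : IsOperatorFourier ((Heisenberg.box A B C).indicator 1) lam T) (v : EuclideanL2 d) :
    ∀ᵐ s, T.toCLM v s = ∫ t, (𝓕 (C.indicator (1 : ℝ → ℂ)) (-lam) *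
        𝓕 (B.indicator (1 : EuclideanSpace ℝ (Fin d) → ℂ)) (lam • s)) *
        A.indicator 1 (s - t) * v t := by
  have hbox := Heisenberg.measurableSet_box hA hB hC
  simp only [mul_assoc, integral_const_mul]
  simp only [← mul_assoc]
  set G : EuclideanSpace ℝ (Fin d) → ℂ := fun s => (𝓕 (C.indicator (1 : ℝ → ℂ)) (-lam) *
        𝓕 (B.indicator (1 : EuclideanSpace ℝ (Fin d) → ℂ)) (lam • s)) *
        ∫ t, A.indicator 1 (s - t) * v t with hG
  have hTi : ∀ D : Set (EuclideanSpace ℝ (Fin d)), Bornology.IsBounded D →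
      IntegrableOn (T.toCLM v) D volume := by
    intro D hD
    have : IsFiniteMeasure ((volume : Measure (EuclideanSpace ℝ (Fin d))).restrict D) :=
      ⟨by rw [Measure.restrict_apply_univ]; exact hD.measure_lt_top⟩
    exact ((Lp.memLp (T.toCLM v)).restrict D).integrable one_le_two
  have hGi : ∀ D : Set (EuclideanSpace ℝ (Fin d)), Bornology.IsBounded D →
      IntegrableOn G D volume := by
    intro D hD
    have h1 := (integrable_schrodingerFun hA' hB' hC' hD lam v).integral_prod_right
    simp only [setIntegral_box_schrodingerFun hA hB hC] at h1
    exact h1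
  -- Both functions of `s` are integrable on bounded sets, so testing against indicators of such
  -- sets is enough; these indicators are vectors of `L²` to which `hT` applies.
  have key := ae_eq_zero_of_forall_setIntegral_bounded (μ := volume)
    (h := fun s => T.toCLM v s - G s) (fun D hD => (hTi D hD).sub (hGi D hD)) ?_
  · filter_upwards [key] with s hs using sub_eq_zero.mp hs
  intro D hD hD'
  rw [integral_sub (hTi D hD') (hGi D hD'), sub_eq_zero,
    ← setIntegral_box_inner_schrodinger hA hB hC hA' hB' hC' hD hD',
    ← L2.inner_indicatorConstLp_one hD hD'.measure_lt_top.ne, hT, ← integral_indicator hbox]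
  refine integral_congr_ae (Eventually.of_forall fun g => ?_)
  by_cases h : g ∈ Heisenberg.box A B C <;> simp [h]

/-- The kernel is `1̂_C(-λ) 1̂_B(λs) 1_A(s - t)`. Integrating in `t` gives `|A|`; integrating in `s`
after scaling by `λ` uses up the weight and gives `|B|` by Plancherel. -/
theorem enorm_sq_of_isOperatorFourier_box (hA : MeasurableSet A) (hB : MeasurableSet B)
    (hC : MeasurableSet C) (hA' : Bornology.IsBounded A) (hB' : Bornology.IsBounded B)
    (hC' : Bornology.IsBounded C) {lam : ℝ} (hlam : lam ≠ 0) {T : HS d}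
    (hT : IsOperatorFourier ((Heisenberg.box A B C).indicator 1) lam T) :
    ENNReal.ofReal (|lam| ^ d) * ‖T‖ₑ ^ 2 =
      ‖𝓕 (C.indicator (1 : ℝ → ℂ)) (-lam)‖ₑ ^ 2 * volume B * volume A := by
  set b := 𝓕 (B.indicator (1 : EuclideanSpace ℝ (Fin d) → ℂ)) with hb
  set c := 𝓕 (C.indicator (1 : ℝ → ℂ)) (-lam) with hc
  have hbc : Continuous b := continuous_fourier (integrable_indicator_one hB hB')
  have hK : ∀ᵐ s : EuclideanSpace ℝ (Fin d),
      MemLp (fun t => (c * b (lam • s)) * A.indicator 1 (s - t)) 2 volume := by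
    refine Eventually.of_forall fun s => MemLp.const_mul ?_ _
    exact (memLp_indicator_one hA hA' 2).comp_measurePreserving
      (Measure.measurePreserving_sub_left volume s)
  rw [enorm_sq_eq_lintegral_kernel T hK
    (toCLM_ae_eq_of_isOperatorFourier_box hA hB hC hA' hB' hC' hT)]
  have h1 : ∀ s : EuclideanSpace ℝ (Fin d),
      ∫⁻ t, ‖(c * b (lam • s)) * A.indicator (1 : EuclideanSpace ℝ (Fin d) → ℂ) (s - t)‖ₑ ^ 2 =
        (‖c‖ₑ ^ 2 * volume A) * ‖b (lam • s)‖ₑ ^ 2 := by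
    intro s
    simp only [enorm_mul, mul_pow]
    rw [lintegral_const_mul' _ _ (by finiteness), lintegral_sub_left_eq_self
      (fun t => ‖A.indicator (1 : EuclideanSpace ℝ (Fin d) → ℂ) t‖ₑ ^ 2),
      lintegral_indicator_one_sq hA]
    ring
  have hAfin : volume A ≠ ⊤ := hA'.measure_lt_top.ne
  simp only [h1]
  rw [lintegral_const_mul' _ _ (by finiteness), mul_left_comm,
    lintegral_comp_smul (fun s => ‖b s‖ₑ ^ 2) hlam,
    lintegral_enorm_fourier_sq (integrable_indicator_one hB hB') (memLp_indicator_one hB hB' 2),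
    lintegral_indicator_one_sq hB]
  ring

end Boxes

end

noncomputable section

variable {d : ℕ}

open HilbertSchmidt FourierTransform

/-! ### Unitarity of the Plancherel transform. -/

section Surjectivity

theorem ae_plancherelMeasure_ne_zero : ∀ᵐ lam ∂plancherelMeasure d, lam ≠ 0 :=
  (withDensity_absolutelyContinuous _ _).ae_le (Measure.ae_ne volume 0)

variable {A B : Set (EuclideanSpace ℝ (Fin d))} {C : Set ℝ}

theorem IsOperatorFourier.congr {φ ψ : Heisenberg d → ℂ} (h : φ =ᵐ[volume] ψ) {lam : ℝ} {T : HS d}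
    (hT : IsOperatorFourier φ lam T) : IsOperatorFourier ψ lam T := by
  intro u v
  rw [hT u v]
  refine integral_congr_ae ?_
  filter_upwards [h] with g hg
  rw [hg]

/-- The density cancels against the factor found at each `λ ≠ 0`, and Plancherel for `1_C`
contributes `|C|`, so the total is the volume of the box. -/
theorem enorm_plancherelAdj_box (hA : MeasurableSet A) (hB : MeasurableSet B)
    (hC : MeasurableSet C) (hA' : Bornology.IsBounded A) (hB' : Bornology.IsBounded B)
    (hC' : Bornology.IsBounded C) {f : HeisenbergL2 d}
    (hf : f =ᵐ[volume] (Heisenberg.box A B C).indicator 1) :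
    ‖plancherelAdj d f‖ₑ ^ 2 = ‖f‖ₑ ^ 2 := by
  have hbox := Heisenberg.measurableSet_box hA hB hC
  have hint : Integrable f volume := by
    refine Integrable.congr ?_ hf.symm
    exact (integrable_indicator_iff hbox).mpr
      (integrableOn_const (Heisenberg.volume_box_lt_top hA' hB' hC').ne)
  have hCc : Continuous (𝓕 (C.indicator (1 : ℝ → ℂ))) :=
    continuous_fourier (integrable_indicator_one hC hC')
  have h1 : ∀ᵐ lam ∂plancherelMeasure d, ‖plancherelAdj d f lam‖ₑ ^ 2 =
      (ENNReal.ofReal (|lam| ^ d))⁻¹ *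
        (‖𝓕 (C.indicator (1 : ℝ → ℂ)) (-lam)‖ₑ ^ 2 * volume B * volume A) := by
    filter_upwards [(mem_fourierGraph_of_integrable hint).2, ae_plancherelMeasure_ne_zero]
      with lam h2 h3
    have hpos : 0 < |lam| ^ d := by positivity
    rw [← enorm_sq_of_isOperatorFourier_box hA hB hC hA' hB' hC' h3 (h2.congr hf), ← mul_assoc,
      ENNReal.inv_mul_cancel (ENNReal.ofReal_pos.mpr hpos).ne' ENNReal.ofReal_ne_top, one_mul]
  have hm : Measurable fun lam : ℝ => (ENNReal.ofReal (|lam| ^ d))⁻¹ *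
        (‖𝓕 (C.indicator (1 : ℝ → ℂ)) (-lam)‖ₑ ^ 2 * volume B * volume A) := by
    refine Measurable.mul ?_ ?_
    · exact (ENNReal.measurable_ofReal.comp (Continuous.measurable (by fun_prop))).inv
    · refine Measurable.mul_const (Measurable.mul_const (Measurable.pow_const ?_ 2) _) _
      exact (hCc.comp continuous_neg).measurable.enorm
  rw [Lp.enorm_sq_eq_lintegral, lintegral_congr_ae h1, lintegral_plancherelMeasure hm]
  have h4 : ∫⁻ lam : ℝ, ENNReal.ofReal (|lam| ^ d) * ((ENNReal.ofReal (|lam| ^ d))⁻¹ *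
        (‖𝓕 (C.indicator (1 : ℝ → ℂ)) (-lam)‖ₑ ^ 2 * volume B * volume A)) =
      ∫⁻ lam : ℝ, ‖𝓕 (C.indicator (1 : ℝ → ℂ)) (-lam)‖ₑ ^ 2 * (volume B * volume A) := by
    refine lintegral_congr_ae ?_
    filter_upwards [Measure.ae_ne volume (0 : ℝ)] with lam h3
    have hpos : 0 < |lam| ^ d := by positivity
    rw [← mul_assoc, ENNReal.mul_inv_cancel (ENNReal.ofReal_pos.mpr hpos).ne'
      ENNReal.ofReal_ne_top, one_mul, mul_assoc]
  rw [h4, lintegral_mul_const' _ _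
    (ENNReal.mul_lt_top hB'.measure_lt_top hA'.measure_lt_top).ne,
    lintegral_neg_eq_self (fun lam => ‖𝓕 (C.indicator (1 : ℝ → ℂ)) lam‖ₑ ^ 2),
    lintegral_enorm_fourier_sq (integrable_indicator_one hC hC') (memLp_indicator_one hC hC' 2),
    lintegral_indicator_one_sq hC, Lp.enorm_sq_eq_lintegral]
  have h5 : ∫⁻ g, ‖f g‖ₑ ^ 2 = ∫⁻ g, ‖(Heisenberg.box A B C).indicator
      (1 : Heisenberg d → ℂ) g‖ₑ ^ 2 := by
    refine lintegral_congr_ae ?_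
    filter_upwards [hf] with g hg
    rw [hg]
  rw [h5, lintegral_indicator_one_sq hbox, Heisenberg.volume_box]
  ring

/-- The indicator function of a bounded box as an element of `L²(ℍ^d)`. -/
def boxLp (hA : MeasurableSet A) (hB : MeasurableSet B)
    (hC : MeasurableSet C) (hA' : Bornology.IsBounded A) (hB' : Bornology.IsBounded B)
    (hC' : Bornology.IsBounded C) : HeisenbergL2 d :=
  indicatorConstLp 2 (Heisenberg.measurableSet_box hA hB hC)
    (Heisenberg.volume_box_lt_top hA' hB' hC').ne (1 : ℂ)

theorem coeFn_boxLp (hA : MeasurableSet A) (hB : MeasurableSet B)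
    (hC : MeasurableSet C) (hA' : Bornology.IsBounded A) (hB' : Bornology.IsBounded B)
    (hC' : Bornology.IsBounded C) :
    boxLp hA hB hC hA' hB' hC' =ᵐ[volume] (Heisenberg.box A B C).indicator 1 :=
  indicatorConstLp_coeFn

theorem Heisenberg.mem_box {g : Heisenberg d} :
    g ∈ box A B C ↔ g.1 ∈ A ∧ g.2.1 ∈ B ∧ g.2.2 ∈ C := Iff.rfl

/-- The indicator functions of bounded boxes are total in `L²(ℍ^d)`. -/
theorem eq_zero_of_inner_boxLp {f : HeisenbergL2 d}
    (h : ∀ (A B : Set (EuclideanSpace ℝ (Fin d))) (C : Set ℝ) (hA : MeasurableSet A)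
      (hB : MeasurableSet B) (hC : MeasurableSet C) (hA' : Bornology.IsBounded A)
      (hB' : Bornology.IsBounded B) (hC' : Bornology.IsBounded C),
      inner ℂ (boxLp hA hB hC hA' hB' hC') f = 0) : f = 0 := by
  have key : ∀ n : ℕ, ∀ᵐ g, g ∈ Heisenberg.box (Metric.ball 0 n) (Metric.ball 0 n)
      (Metric.ball 0 n) → f g = 0 := by
    intro n
    set Q : Set (Heisenberg d) :=
      Heisenberg.box (Metric.ball 0 n) (Metric.ball 0 n) (Metric.ball 0 n) with hQ
    have hQm : MeasurableSet Q := Heisenberg.measurableSet_box measurableSet_ball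
      measurableSet_ball measurableSet_ball
    have hQf : volume Q < ⊤ := Heisenberg.volume_box_lt_top Metric.isBounded_ball
      Metric.isBounded_ball Metric.isBounded_ball
    have hfin : IsFiniteMeasure ((volume : Measure (Heisenberg d)).restrict Q) :=
      ⟨by rwa [Measure.restrict_apply_univ]⟩
    have hint : Integrable (Q.indicator f) volume :=
      (integrable_indicator_iff hQm).mpr (((Lp.memLp f).restrict Q).integrable one_le_two)
    have h0 := Heisenberg.ae_eq_zero_of_setIntegral_box hint ?_
    · filter_upwards [h0] with g hg hgQ
      rwa [indicator_of_mem hgQ] at hg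
    intro A B C hA hB hC
    have h1 := h (Metric.ball 0 n ∩ A) (Metric.ball 0 n ∩ B) (Metric.ball 0 n ∩ C)
      (measurableSet_ball.inter hA) (measurableSet_ball.inter hB) (measurableSet_ball.inter hC)
      (Metric.isBounded_ball.subset inter_subset_left)
      (Metric.isBounded_ball.subset inter_subset_left)
      (Metric.isBounded_ball.subset inter_subset_left)
    rw [boxLp, L2.inner_indicatorConstLp_one] at h1
    rw [setIntegral_indicator hQm, ← h1]
    congr 2
    ext g
    simp only [Q, mem_inter_iff, Heisenberg.mem_box]
    tauto
  refine (Lp.eq_zero_iff_ae_eq_zero).mpr ?_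
  filter_upwards [ae_all_iff.mpr key] with g hg
  obtain ⟨n, hn⟩ := exists_nat_gt (max ‖g.1‖ (max ‖g.2.1‖ ‖g.2.2‖))
  refine hg n ⟨?_, ?_, ?_⟩
  · exact mem_ball_zero_iff.mpr ((le_max_left _ _).trans_lt hn)
  · exact mem_ball_zero_iff.mpr (((le_max_left _ _).trans (le_max_right _ _)).trans_lt hn)
  · exact mem_ball_zero_iff.mpr (((le_max_right _ _).trans (le_max_right _ _)).trans_lt hn)

/-- For an isometry `U`, `‖UU*f - f‖² = ‖f‖² - ‖U*f‖²`. -/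
theorem plancherelInv_plancherelAdj {f : HeisenbergL2 d} (h : ‖plancherelAdj d f‖ = ‖f‖) :
    plancherelInv d (plancherelAdj d f) = f := by
  rw [← sub_eq_zero, ← norm_eq_zero, ← sq_eq_zero_iff, @norm_sub_sq ℂ,
    ← inner_plancherelAdj, LinearIsometry.norm_map, inner_self_eq_norm_sq, h]
  ring

/-- An isometry of complete spaces has closed range, and this range contains every box, because the
adjoint preserves the norms of boxes. A vector orthogonal to all boxes is zero. -/
theorem plancherelInv_surjective : Function.Surjective (plancherelInv d) := by
  have hclosed : IsClosed (LinearMap.range (plancherelInv d).toLinearMap :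
      Set (HeisenbergL2 d)) := by
    have := (plancherelInv d).isometry.isClosedEmbedding.isClosed_range
    rw [LinearMap.coe_range]
    exact this
  have hbot : (LinearMap.range (plancherelInv d).toLinearMap)ᗮ = ⊥ := by
    rw [eq_bot_iff]
    intro f hf
    refine eq_zero_of_inner_boxLp fun A B C hA hB hC hA' hB' hC' => ?_
    refine (Submodule.mem_orthogonal _ _).mp hf _ ⟨plancherelAdj d _,
      plancherelInv_plancherelAdj ?_⟩
    have h1 := enorm_plancherelAdj_box hA hB hC hA' hB' hC' (coeFn_boxLp hA hB hC hA' hB' hC')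
    rw [← toReal_enorm, ← toReal_enorm (boxLp hA hB hC hA' hB' hC')]
    congr 1
    exact (ENNReal.pow_right_strictMono two_ne_zero).injective h1
  have htop := Submodule.topologicalClosure_eq_top_iff.mpr hbot
  rw [hclosed.submodule_topologicalClosure_eq] at htop
  exact LinearMap.range_eq_top.mp htop

variable (d) in
/-- The Plancherel transform as a unitary operator. -/
def plancherelEquiv : HeisenbergL2 d ≃ₗᵢ[ℂ] Lp (HS d) 2 (plancherelMeasure d) :=
  (LinearIsometryEquiv.ofSurjective (plancherelInv d) plancherelInv_surjective).symm

theorem plancherelEquiv_eq_adj (f : HeisenbergL2 d) : plancherelEquiv d f = plancherelAdj d f := by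
  obtain ⟨F, rfl⟩ := plancherelInv_surjective f
  refine ext_inner_left ℂ fun G => ?_
  rw [inner_plancherelAdj, LinearIsometry.inner_map_map]
  congr 1
  exact LinearIsometryEquiv.symm_apply_apply
    (LinearIsometryEquiv.ofSurjective (plancherelInv d) plancherelInv_surjective) F

theorem dense_integrable : Dense {f : HeisenbergL2 d | Integrable f volume} := by
  let S : Submodule ℂ (HeisenbergL2 d) :=
    { carrier := {f | Integrable f volume}
      add_mem' := fun {f g} hf hg => (Integrable.add hf hg).congr (Lp.coeFn_add f g).symm
      zero_mem' := (integrable_zero _ _ _).congr (Lp.coeFn_zero ℂ 2 volume).symm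
      smul_mem' := fun c f hf => (Integrable.smul c hf).congr (Lp.coeFn_smul c f).symm }
  have hbot : Sᗮ = ⊥ := by
    rw [eq_bot_iff]
    intro f hf
    refine eq_zero_of_inner_boxLp fun A B C hA hB hC hA' hB' hC' => ?_
    refine (Submodule.mem_orthogonal _ _).mp hf _ ?_
    refine Integrable.congr ?_ (coeFn_boxLp hA hB hC hA' hB' hC').symm
    exact (integrable_indicator_iff (Heisenberg.measurableSet_box hA hB hC)).mpr
      (integrableOn_const (Heisenberg.volume_box_lt_top hA' hB' hC').ne)
  exact Submodule.dense_iff_topologicalClosure_eq_top.mpr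
    (Submodule.topologicalClosure_eq_top_iff.mpr hbot)

/-- The Plancherel theorem: the Plancherel transform is the unitary operator `plancherelEquiv`. -/
theorem plancherel_eq_plancherelEquiv (f : HeisenbergL2 d) :
    plancherel f = plancherelEquiv d f := by
  rw [plancherelEquiv_eq_adj]
  have h1 : (f, plancherelAdj d f) ∈ closure (fourierGraph d) :=
    map_mem_closure (f := fun f => (f, plancherelAdj d f))
      (continuous_id.prodMk (plancherelAdj d).continuous) (dense_integrable f)
      fun g hg => mem_fourierGraph_of_integrable hg
  have h2 : ∃ F, (f, F) ∈ closure (fourierGraph d) := ⟨_, h1⟩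
  -- The graph of a continuous operator is closed, so taking closures creates no further values and
  -- the chosen one is forced.
  have h3 : closure (fourierGraph d) ⊆
      {p : HeisenbergL2 d × Lp (HS d) 2 (plancherelMeasure d) | p.2 = plancherelAdj d p.1} :=
    closure_minimal (fun p hp => eq_plancherelAdj_of_mem_fourierGraph hp)
      (isClosed_eq continuous_snd ((plancherelAdj d).continuous.comp continuous_fst))
  rw [plancherel, dif_pos h2]
  exact h3 h2.choose_spec

end Surjectivity

/-! ### Central translations as multiplication by characters. -/

section CentralTranslations

theorem Lp.memLp_bdd_smul {α F : Type*} [MeasurableSpace α] {μ : Measure α}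
    [NormedAddCommGroup F] [InnerProductSpace ℂ F] {m : α → ℂ} (hm : Measurable m)
    (hb : ∀ x, ‖m x‖ ≤ 1) (f : Lp F 2 μ) : MemLp (fun x => m x • f x) 2 μ :=
  (Lp.memLp f).of_le
    (hm.stronglyMeasurable.aestronglyMeasurable.smul (Lp.aestronglyMeasurable f))
    (Eventually.of_forall fun x => by
      rw [norm_smul]; exact mul_le_of_le_one_left (norm_nonneg _) (hb x))

/-- Multiplication by a measurable function bounded by `1`, as an operator on `L²`. -/
def Lp.mulBdd {α F : Type*} [MeasurableSpace α] (μ : Measure α) [NormedAddCommGroup F]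
    [InnerProductSpace ℂ F] (m : α → ℂ) (hm : Measurable m) (hb : ∀ x, ‖m x‖ ≤ 1) :
    Lp F 2 μ →L[ℂ] Lp F 2 μ :=
  LinearMap.mkContinuous
    { toFun := fun f => (Lp.memLp_bdd_smul hm hb f).toLp _
      map_add' := fun f g => by
        refine Lp.ext ?_
        filter_upwards [(Lp.memLp_bdd_smul hm hb (f + g)).coeFn_toLp, Lp.coeFn_add f g,
          Lp.coeFn_add ((Lp.memLp_bdd_smul hm hb f).toLp _) ((Lp.memLp_bdd_smul hm hb g).toLp _),
          (Lp.memLp_bdd_smul hm hb f).coeFn_toLp,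
          (Lp.memLp_bdd_smul hm hb g).coeFn_toLp] with x e1 e2 e3 e4 e5
        rw [e1, e3, Pi.add_apply, e4, e5, e2, Pi.add_apply, smul_add]
      map_smul' := fun c f => by
        refine Lp.ext ?_
        filter_upwards [(Lp.memLp_bdd_smul hm hb (c • f)).coeFn_toLp, Lp.coeFn_smul c f,
          Lp.coeFn_smul c ((Lp.memLp_bdd_smul hm hb f).toLp _),
          (Lp.memLp_bdd_smul hm hb f).coeFn_toLp] with x e1 e2 e3 e4
        rw [e1, RingHom.id_apply, e3, Pi.smul_apply, e4, e2, Pi.smul_apply, smul_comm] }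
    1 fun f => by
      rw [one_mul]
      refine Lp.norm_le_norm_of_ae_le ?_
      filter_upwards [(Lp.memLp_bdd_smul hm hb f).coeFn_toLp] with x hx
      refine (congrArg norm hx).trans_le ?_
      rw [norm_smul]
      exact mul_le_of_le_one_left (norm_nonneg _) (hb x)

theorem Lp.coeFn_mulBdd {α F : Type*} [MeasurableSpace α] (μ : Measure α) [NormedAddCommGroup F]
    [InnerProductSpace ℂ F] (m : α → ℂ) (hm : Measurable m) (hb : ∀ x, ‖m x‖ ≤ 1)
    (f : Lp F 2 μ) : Lp.mulBdd μ m hm hb f =ᵐ[μ] fun x => m x • f x :=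
  (Lp.memLp_bdd_smul hm hb f).coeFn_toLp

/-- The character `λ ↦ e^{2πiλw}`. -/
def centralChar (w lam : ℝ) : ℂ := Complex.exp (2 * Real.pi * Complex.I * lam * w)

theorem norm_centralChar (w lam : ℝ) : ‖centralChar w lam‖ = 1 := by
  rw [centralChar, Complex.norm_exp]; simp

theorem continuous_centralChar (w : ℝ) : Continuous (centralChar w) := by
  unfold centralChar
  fun_prop

/-- The central element `(0, 0, w)`. -/
def Heisenberg.central (w : ℝ) : Heisenberg d := (0, 0, w)

theorem Heisenberg.central_mul_fst (w : ℝ) (g : Heisenberg d) : (central w * g).1 = g.1 :=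
  zero_add _

theorem Heisenberg.central_mul_snd_fst (w : ℝ) (g : Heisenberg d) :
    (central w * g).2.1 = g.2.1 :=
  zero_add _

theorem Heisenberg.central_mul_snd_snd (w : ℝ) (g : Heisenberg d) :
    (central w * g).2.2 = w + g.2.2 := by
  change w + g.2.2 + inner ℝ (0 : EuclideanSpace ℝ (Fin d)) g.2.1 = w + g.2.2
  simp

theorem schrodinger_central_mul (lam w : ℝ) (g : Heisenberg d) (u : EuclideanL2 d) :
    schrodinger lam (Heisenberg.central w * g) u = centralChar w lam • schrodinger lam g u := by
  refine Lp.ext ?_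
  filter_upwards [coeFn_schrodinger lam (Heisenberg.central w * g) u, coeFn_schrodinger lam g u,
    Lp.coeFn_smul (centralChar w lam) (schrodinger lam g u)] with t e1 e2 e3
  rw [e1, e3, Pi.smul_apply, e2]
  simp only [schrodingerFun, Heisenberg.central_mul_fst, Heisenberg.central_mul_snd_fst,
    Heisenberg.central_mul_snd_snd, centralChar, smul_eq_mul, ← mul_assoc, ← Complex.exp_add]
  congr 2
  push_cast
  ring

/-- Left translation as a linear isometry. -/
def leftTranslationLI (g : Heisenberg d) : HeisenbergL2 d →ₗᵢ[ℂ] HeisenbergL2 d :=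
  Lp.compMeasurePreservingₗᵢ ℂ (fun q => g⁻¹ * q) (Heisenberg.measurePreserving_mul_left g⁻¹)

theorem leftTranslationLI_apply (g : Heisenberg d) (f : HeisenbergL2 d) :
    leftTranslationLI g f = leftTranslation g f := rfl

theorem coeFn_leftTranslation (g : Heisenberg d) (f : HeisenbergL2 d) :
    leftTranslation g f =ᵐ[volume] fun q => f (g⁻¹ * q) :=
  Lp.coeFn_compMeasurePreserving _ _

theorem leftTranslation_mul (g h : Heisenberg d) (f : HeisenbergL2 d) :
    leftTranslation (g * h) f = leftTranslation g (leftTranslation h f) := by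
  refine Lp.ext ?_
  filter_upwards [coeFn_leftTranslation (g * h) f, coeFn_leftTranslation g (leftTranslation h f),
    (Heisenberg.measurePreserving_mul_left g⁻¹).quasiMeasurePreserving.ae_eq_comp
      (coeFn_leftTranslation h f)] with q e1 e2 e3
  rw [e1, e2]
  simp only [Function.comp_apply] at e3
  rw [e3, mul_inv_rev, mul_assoc]

/-- The centre acts under `π_λ` by the scalar `e^{2πiλw}`; left invariance of the measure moves the
translation from `f` onto `π_λ`. -/
theorem isOperatorFourier_central {f : Heisenberg d → ℂ} (hf : Integrable f volume) {lam : ℝ}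
    {T : HS d} (hT : IsOperatorFourier f lam T) (w : ℝ) :
    IsOperatorFourier (fun q => f ((Heisenberg.central w)⁻¹ * q)) lam (centralChar w lam • T) := by
  intro u v
  set z : Heisenberg d := Heisenberg.central w with hz
  have hmp := Heisenberg.measurePreserving_mul_left z⁻¹
  have h1 : ∀ q, f (z⁻¹ * q) * inner ℂ v (schrodinger lam q u) =
      centralChar w lam * (f (z⁻¹ * q) * inner ℂ v (schrodinger lam (z⁻¹ * q) u)) := by
    intro q
    have h2 := schrodinger_central_mul lam w (z⁻¹ * q) u
    rw [← hz, mul_inv_cancel_left] at h2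
    rw [h2, inner_smul_right]
    ring
  have h3 : ∫ q, f (z⁻¹ * q) * inner ℂ v (schrodinger lam (z⁻¹ * q) u) =
      ∫ q, f q * inner ℂ v (schrodinger lam q u) := by
    have hF : AEStronglyMeasurable (fun q => f q * inner ℂ v (schrodinger lam q u))
        (Measure.map (fun q => z⁻¹ * q) volume) := by
      rw [hmp.map_eq]
      exact hf.1.mul ((stronglyMeasurable_inner_schrodinger v u).comp_measurable
        (measurable_prodMk_left (x := lam))).aestronglyMeasurable
    have h4 := integral_map hmp.measurable.aemeasurable hF
    rw [hmp.map_eq] at h4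
    exact h4.symm
  simp only [h1]
  rw [integral_const_mul, h3, ← hT u v, ← inner_smul_right]
  rfl

theorem IsOperatorFourier.unique {f : Heisenberg d → ℂ} {lam : ℝ} {S T : HS d}
    (hS : IsOperatorFourier f lam S) (hT : IsOperatorFourier f lam T) : S = T :=
  HilbertSchmidt.eq_of_inner_basis fun _ _ => (hS _ _).trans (hT _ _).symm

/-- Central translations correspond to multiplication by characters. -/
theorem plancherelEquiv_central (w : ℝ) (f : HeisenbergL2 d) :
    plancherelEquiv d (leftTranslation (Heisenberg.central w) f) =
      Lp.mulBdd (plancherelMeasure d) (centralChar w) (continuous_centralChar w).measurable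
        (fun lam => (norm_centralChar w lam).le) (plancherelEquiv d f) := by
  simp only [plancherelEquiv_eq_adj, ← leftTranslationLI_apply]
  -- Both sides are continuous in `f`, so the integral formula on `L¹ ∩ L²` decides.
  refine congrFun (Continuous.ext_on (dense_integrable (d := d))
    (f := fun f => plancherelAdj d (leftTranslationLI (Heisenberg.central w) f))
    (g := fun f => Lp.mulBdd (plancherelMeasure d) (centralChar w)
      (continuous_centralChar w).measurable (fun lam => (norm_centralChar w lam).le)
      (plancherelAdj d f)) ?_ ?_ fun f hf => ?_) f
  · exact (plancherelAdj d).continuous.comp (leftTranslationLI _).continuous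
  · exact (ContinuousLinearMap.continuous _).comp (plancherelAdj d).continuous
  refine Lp.ext ?_
  have hint : Integrable (leftTranslation (Heisenberg.central w) f) volume := by
    refine Integrable.congr ?_ (coeFn_leftTranslation _ f).symm
    exact (Heisenberg.measurePreserving_mul_left _).integrable_comp_of_integrable hf
  filter_upwards [(mem_fourierGraph_of_integrable hf).2, (mem_fourierGraph_of_integrable hint).2,
    Lp.coeFn_mulBdd (plancherelMeasure d) (centralChar w) (continuous_centralChar w).measurable
      (fun lam => (norm_centralChar w lam).le) (plancherelAdj d f)] with lam h1 h2 h3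
  rw [h3]
  exact IsOperatorFourier.unique (h2.congr (coeFn_leftTranslation _ f))
    (isOperatorFourier_central hf h1 w)

end CentralTranslations

end

noncomputable section

/-! ### Periodic multipliers and invariant subspaces. -/

section PeriodicMultipliers

theorem Function.Periodic.measurable_lift {T : ℝ} [hT : Fact (0 < T)] {φ : ℝ → ℂ}
    (hφ : Function.Periodic φ T) (hm : Measurable φ) :
    Measurable (hφ.lift : AddCircle T → ℂ) := by
  have h : (hφ.lift : AddCircle T → ℂ) =
      fun x => φ (AddCircle.measurableEquivIco T 0 x : ℝ) := by
    ext x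
    conv_lhs => rw [← AddCircle.coe_equivIco (p := T) (a := 0) (y := x)]
    rw [Function.Periodic.lift_coe]
    rfl
  rw [h]
  exact hm.comp (measurable_subtype_coe.comp (AddCircle.measurableEquivIco T 0).measurable)

/-- If all Fourier coefficients of the periodization of `Ψ` vanish, then `Ψ` integrates to zero
against every bounded measurable periodic function. -/
theorem integral_periodic_mul_eq_zero {μ : Measure ℝ} {Ψ : ℝ → ℂ} (hΨ : Integrable Ψ μ) {T : ℝ}
    (hT : 0 < T) (h0 : ∀ k : ℤ, ∫ x, centralChar (k / T) x * Ψ x ∂μ = 0) {φ : ℝ → ℂ}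
    (hm : Measurable φ) (hb : ∀ x, ‖φ x‖ ≤ 1) (hφ : Function.Periodic φ T) :
    ∫ x, φ x * Ψ x ∂μ = 0 := by
  have : Fact (0 < T) := ⟨hT⟩
  have hmk : Measurable ((↑) : ℝ → AddCircle T) := (AddCircle.continuous_mk' T).measurable
  have hint : ∀ h : C(AddCircle T, ℂ), Integrable (fun x : ℝ => h x * Ψ x) μ := fun h =>
    hΨ.bdd_mul (c := ‖h‖) (h.continuous.measurable.comp hmk).aestronglyMeasurable
      (Eventually.of_forall fun x => h.norm_coe_le_norm _)
  -- The functional `h ↦ ∫ h Ψ` is bounded by `∫ ‖Ψ‖` in the uniform norm and kills the characters,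
  -- whose span is dense by Stone-Weierstrass.
  have hcont : ∀ h : C(AddCircle T, ℂ), ∫ x : ℝ, h x * Ψ x ∂μ = 0 := by
    let L : C(AddCircle T, ℂ) →ₗ[ℂ] ℂ :=
      { toFun := fun h => ∫ x : ℝ, h x * Ψ x ∂μ
        map_add' := fun h h' => by
          simp only [ContinuousMap.add_apply, add_mul]
          exact integral_add (hint h) (hint h')
        map_smul' := fun c h => by
          simp only [ContinuousMap.smul_apply, smul_eq_mul, mul_assoc, RingHom.id_apply]
          exact integral_const_mul _ _ }
    let L' : C(AddCircle T, ℂ) →L[ℂ] ℂ := L.mkContinuous (∫ x, ‖Ψ x‖ ∂μ) fun h => by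
      refine (norm_integral_le_integral_norm _).trans ?_
      rw [mul_comm, ← integral_const_mul]
      refine integral_mono (hint h).norm (hΨ.norm.const_mul _) fun x => ?_
      simp only [norm_mul]
      gcongr
      exact h.norm_coe_le_norm _
    have hL : L' = 0 := by
      refine ContinuousLinearMap.ext_on (Submodule.dense_iff_topologicalClosure_eq_top.mpr
        (span_fourier_closure_eq_top (T := T))) ?_
      rintro _ ⟨k, rfl⟩
      refine Eq.trans ?_ (h0 k)
      refine integral_congr_ae (Eventually.of_forall fun x => ?_)
      simp only [fourier_coe_apply, centralChar]
      congr 2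
      push_cast
      ring
    exact fun h => congrArg (fun l : C(AddCircle T, ℂ) →L[ℂ] ℂ => l h) hL
  -- The passage to measurable `φ` is an `L¹` approximation by continuous functions for the finite
  -- measure `‖Ψ‖ dμ` pushed to the circle: the `L¹(ν)` error bounds the error in the integral.
  set ν : Measure (AddCircle T) := (μ.withDensity fun x => ‖Ψ x‖ₑ).map (↑) with hν
  have hfin : IsFiniteMeasure (μ.withDensity fun x => ‖Ψ x‖ₑ) :=
    isFiniteMeasure_withDensity hΨ.2.ne
  have hφm := hφ.measurable_lift hm
  have hφi : Integrable (hφ.lift : AddCircle T → ℂ) ν := by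
    refine Integrable.of_bound hφm.aestronglyMeasurable 1 (Eventually.of_forall fun x => ?_)
    induction x using QuotientAddGroup.induction_on with
    | H x => rw [Function.Periodic.lift_coe]; exact hb x
  rw [← enorm_eq_zero]
  refine nonpos_iff_eq_zero.mp (ENNReal.le_of_forall_pos_le_add fun ε hε _ => ?_)
  rw [zero_add]
  obtain ⟨g, hg, -⟩ := hφi.exists_boundedContinuous_lintegral_sub_le
    (ε := ε) (by exact_mod_cast hε.ne')
  have hφΨ : Integrable (fun x => φ x * Ψ x) μ :=
    hΨ.bdd_mul hm.aestronglyMeasurable (Eventually.of_forall hb)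
  have h1 : ∫ x, φ x * Ψ x ∂μ = ∫ x : ℝ, (φ x - g x) * Ψ x ∂μ := by
    have h2 := hcont g.toContinuousMap
    have h3 := integral_sub hφΨ (hint g.toContinuousMap)
    rw [h2, sub_zero] at h3
    simp only [sub_mul]
    exact h3.symm
  have hgm : Measurable fun x => ‖hφ.lift x - g x‖ₑ :=
    (hφm.sub g.continuous.measurable).enorm
  have hgm' : Measurable fun x : ℝ => ‖hφ.lift (x : AddCircle T) - g x‖ₑ := hgm.comp hmk
  rw [h1]
  refine (enorm_integral_le_lintegral_enorm _).trans (le_trans (le_of_eq ?_) hg)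
  rw [hν, lintegral_map hgm hmk, lintegral_withDensity_eq_lintegral_mul₀ hΨ.1.enorm
    hgm'.aemeasurable]
  refine lintegral_congr fun x => ?_
  simp only [Pi.mul_apply, enorm_mul, Function.Periodic.lift_coe]
  exact mul_comm _ _

variable {d : ℕ}

/-- The operator on `L²(ℍ^d)` corresponding to multiplication by `m` on the Plancherel side. -/
def multiplier (m : ℝ → ℂ) (hm : Measurable m) (hb : ∀ x, ‖m x‖ ≤ 1) :
    HeisenbergL2 d →L[ℂ] HeisenbergL2 d :=
  (plancherelEquiv d).symm.toContinuousLinearEquiv.toContinuousLinearMap ∘L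
    Lp.mulBdd (plancherelMeasure d) m hm hb ∘L
    (plancherelEquiv d).toContinuousLinearEquiv.toContinuousLinearMap

theorem plancherelEquiv_multiplier (m : ℝ → ℂ) (hm : Measurable m) (hb : ∀ x, ‖m x‖ ≤ 1)
    (f : HeisenbergL2 d) : plancherelEquiv d (multiplier m hm hb f) =
      Lp.mulBdd (plancherelMeasure d) m hm hb (plancherelEquiv d f) :=
  (plancherelEquiv d).apply_symm_apply _

theorem coeFn_multiplier (m : ℝ → ℂ) (hm : Measurable m) (hb : ∀ x, ‖m x‖ ≤ 1)
    (f : HeisenbergL2 d) : plancherelEquiv d (multiplier m hm hb f) =ᵐ[plancherelMeasure d]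
      fun lam => m lam • plancherelEquiv d f lam := by
  rw [plancherelEquiv_multiplier]
  exact Lp.coeFn_mulBdd _ _ _ _ _

theorem eq_multiplier_of_ae (m : ℝ → ℂ) (hm : Measurable m) (hb : ∀ x, ‖m x‖ ≤ 1)
    {f g : HeisenbergL2 d} (h : plancherelEquiv d f =ᵐ[plancherelMeasure d]
      fun lam => m lam • plancherelEquiv d g lam) : f = multiplier m hm hb g :=
  (plancherelEquiv d).injective (Lp.ext (h.trans (coeFn_multiplier m hm hb g).symm))

theorem inner_multiplier (m : ℝ → ℂ) (hm : Measurable m) (hb : ∀ x, ‖m x‖ ≤ 1)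
    (f g : HeisenbergL2 d) : inner ℂ f (multiplier m hm hb g) =
      ∫ lam, m lam * inner ℂ (plancherelEquiv d f lam) (plancherelEquiv d g lam)
        ∂plancherelMeasure d := by
  rw [← (plancherelEquiv d).inner_map_map, L2.inner_def]
  refine integral_congr_ae ?_
  filter_upwards [coeFn_multiplier m hm hb g] with lam h
  rw [h, inner_smul_right]

theorem leftTranslation_central_eq (w : ℝ) (f : HeisenbergL2 d) :
    leftTranslation (Heisenberg.central w) f =
      multiplier (centralChar w) (continuous_centralChar w).measurable
        (fun lam => (norm_centralChar w lam).le) f := by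
  refine (plancherelEquiv d).injective ?_
  rw [plancherelEquiv_multiplier, plancherelEquiv_central]

theorem integrable_inner_plancherelEquiv (f g : HeisenbergL2 d) :
    Integrable (fun lam => inner ℂ (plancherelEquiv d f lam) (plancherelEquiv d g lam))
      (plancherelMeasure d) :=
  L2.integrable_inner _ _

/-- A closed subspace invariant under the central translations by `T⁻¹ℤ` is invariant under
`T`-periodic multipliers. -/
theorem multiplier_mem {W : Submodule ℂ (HeisenbergL2 d)}
    (hW : IsClosed (W : Set (HeisenbergL2 d))) {T : ℝ} (hT : 0 < T)
    (hinv : ∀ k : ℤ, ∀ f ∈ W, leftTranslation (Heisenberg.central (k / T)) f ∈ W)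
    (m : ℝ → ℂ) (hm : Measurable m) (hb : ∀ x, ‖m x‖ ≤ 1) (hφ : Function.Periodic m T)
    {f : HeisenbergL2 d} (hf : f ∈ W) : multiplier m hm hb f ∈ W := by
  -- Membership becomes orthogonality to each `h` in `Wᗮ`, that is, the vanishing of a scalar
  -- integral of `m` against the integrable function `⟪ĥ, f̂⟫`.
  have hWW : Wᗮᗮ = W := by
    rw [Submodule.orthogonal_orthogonal_eq_closure, hW.submodule_topologicalClosure_eq]
  rw [← hWW, Submodule.mem_orthogonal]
  intro h hh
  rw [inner_multiplier]
  refine integral_periodic_mul_eq_zero (integrable_inner_plancherelEquiv h f) hT (fun k => ?_)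
    hm hb hφ
  rw [← inner_multiplier _ (continuous_centralChar _).measurable
    (fun lam => (norm_centralChar _ lam).le), ← leftTranslation_central_eq]
  exact Submodule.inner_left_of_mem_orthogonal (hinv k f hf) hh

theorem inner_leftTranslation (g : Heisenberg d) (f h : HeisenbergL2 d) :
    inner ℂ h (leftTranslation g f) = inner ℂ (leftTranslation g⁻¹ h) f := by
  have h1 : leftTranslation g (leftTranslation g⁻¹ h) = h := by
    rw [← leftTranslation_mul, mul_inv_cancel]
    refine Lp.ext ?_
    filter_upwards [coeFn_leftTranslation 1 h] with q hq
    rw [hq, inv_one, one_mul]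
  conv_lhs => rw [← h1]
  exact (leftTranslationLI g).inner_map_map _ _

theorem Heisenberg.central_mul_comm (w : ℝ) (g : Heisenberg d) :
    central w * g = g * central w := by
  refine Prod.ext ?_ (Prod.ext ?_ ?_)
  · exact (zero_add g.1).trans (add_zero g.1).symm
  · exact (zero_add g.2.1).trans (add_zero g.2.1).symm
  · change w + g.2.2 + inner ℝ (0 : EuclideanSpace ℝ (Fin d)) g.2.1 =
      g.2.2 + w + inner ℝ g.1 (0 : EuclideanSpace ℝ (Fin d))
    rw [inner_zero_left, inner_zero_right, add_comm w]

/-- Periodic multipliers commute with left translations. -/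
theorem leftTranslation_multiplier (g : Heisenberg d) {T : ℝ} (hT : 0 < T) (m : ℝ → ℂ)
    (hm : Measurable m) (hb : ∀ x, ‖m x‖ ≤ 1) (hφ : Function.Periodic m T) (f : HeisenbergL2 d) :
    leftTranslation g (multiplier m hm hb f) = multiplier m hm hb (leftTranslation g f) := by
  refine ext_inner_left ℂ fun h => ?_
  have hi : ∀ (c : ℝ → ℂ) (hc : Measurable c) (hcb : ∀ x, ‖c x‖ ≤ 1) (a b : HeisenbergL2 d),
      Integrable (fun lam => c lam *
        inner ℂ (plancherelEquiv d a lam) (plancherelEquiv d b lam)) (plancherelMeasure d) :=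
    fun c hc hcb a b => (integrable_inner_plancherelEquiv a b).bdd_mul hc.aestronglyMeasurable
      (Eventually.of_forall hcb)
  rw [inner_leftTranslation, inner_multiplier, inner_multiplier, ← sub_eq_zero,
    ← integral_sub (hi m hm hb _ _) (hi m hm hb _ _)]
  simp only [← mul_sub]
  -- For the characters themselves, the difference vanishes because central elements commute with
  -- `g`; periodic multipliers inherit this.
  refine integral_periodic_mul_eq_zero ((integrable_inner_plancherelEquiv _ _).sub
    (integrable_inner_plancherelEquiv _ _)) hT (fun k => ?_) hm hb hφ
  have hc := (continuous_centralChar (k / T)).measurable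
  have hcb := fun lam => (norm_centralChar (k / T) lam).le
  simp only [Pi.sub_apply, mul_sub]
  rw [integral_sub (hi _ hc hcb _ _) (hi _ hc hcb _ _), ← inner_multiplier _ hc hcb,
    ← inner_multiplier _ hc hcb, ← leftTranslation_central_eq, ← leftTranslation_central_eq,
    ← inner_leftTranslation, ← leftTranslation_mul, ← leftTranslation_mul,
    Heisenberg.central_mul_comm, sub_self]

end PeriodicMultipliers

end

noncomputable section

/-! ### Measurable families of square summable sequences. -/

section SquareSummable

variable {F : Type*} [NormedAddCommGroup F] {ι : Type*}

theorem memℓp_two_iff {x : ι → F} : Memℓp x 2 ↔ ∑' n, ‖x n‖ₑ ^ 2 ≠ ⊤ := by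
  rw [memℓp_gen_iff (by norm_num)]
  simp only [ENNReal.toReal_ofNat, Real.rpow_ofNat]
  have h : ∀ n, ‖x n‖ₑ ^ 2 = ((‖x n‖₊ ^ 2 : NNReal) : ENNReal) := fun n => by
    rw [ENNReal.coe_pow]; rfl
  simp only [h]
  rw [ENNReal.tsum_coe_ne_top_iff_summable, ← NNReal.summable_coe]
  simp only [NNReal.coe_pow, coe_nnnorm]

theorem lp.enorm_sq_eq_tsum (x : lp (fun _ : ι => F) 2) : ‖x‖ₑ ^ 2 = ∑' n, ‖x n‖ₑ ^ 2 := by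
  have h := lp.hasSum_norm (p := 2) (by norm_num) x
  simp only [ENNReal.toReal_ofNat, Real.rpow_ofNat] at h
  rw [← ofReal_norm, ← ENNReal.ofReal_pow (norm_nonneg _), ← h.tsum_eq,
    ENNReal.ofReal_tsum_of_nonneg (fun _ => by positivity) h.summable]
  simp only [ENNReal.ofReal_pow (norm_nonneg _), ofReal_norm]

open Classical in
/-- A sequence as an element of `ℓ²`, with value `0` if it is not square summable. -/
def lpOfSeq (x : ι → F) : lp (fun _ : ι => F) 2 :=
  if h : Memℓp x 2 then ⟨x, h⟩ else 0

theorem coeFn_lpOfSeq {x : ι → F} (h : Memℓp x 2) : ⇑(lpOfSeq x) = x := by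
  rw [lpOfSeq, dif_pos h]

theorem lpOfSeq_coeFn (x : lp (fun _ : ι => F) 2) : lpOfSeq ⇑x = x :=
  lp.ext (coeFn_lpOfSeq (lp.memℓp x))

theorem enorm_lpOfSeq_sq {x : ι → F} (h : Memℓp x 2) :
    ‖lpOfSeq x‖ₑ ^ 2 = ∑' n, ‖x n‖ₑ ^ 2 := by
  rw [lp.enorm_sq_eq_tsum, coeFn_lpOfSeq h]

variable {α : Type*} [MeasurableSpace α] [Countable ι]

/-- Finite truncations are measurable and converge pointwise in `ℓ²`. -/
theorem lp.stronglyMeasurable_of_coord {f : α → lp (fun _ : ι => F) 2}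
    (h : ∀ n, StronglyMeasurable fun a => f a n) : StronglyMeasurable f := by
  classical
  refine stronglyMeasurable_of_tendsto (u := (atTop : Filter (Finset ι)))
    (f := fun s a => ∑ n ∈ s, lp.single 2 n (f a n)) (fun s => ?_) ?_
  · refine Finset.stronglyMeasurable_fun_sum s fun n _ => ?_
    exact (lp.isometry_single (E := fun _ : ι => F) (p := 2) n).continuous.comp_stronglyMeasurable
      (h n)
  · exact tendsto_pi_nhds.mpr fun a => lp.hasSum_single ENNReal.ofNat_ne_top (f a)

theorem stronglyMeasurable_lpOfSeq {x : α → ι → F} (h : ∀ n, StronglyMeasurable fun a => x a n) :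
    StronglyMeasurable fun a => lpOfSeq (x a) := by
  refine lp.stronglyMeasurable_of_coord fun n => ?_
  have hs : MeasurableSet {a | Memℓp (x a) 2} := by
    simp only [memℓp_two_iff]
    exact (Measurable.tsum fun n => (h n).enorm.pow_const 2)
      (measurableSet_singleton ⊤).compl
  have heq : (fun a => lpOfSeq (x a) n) = {a | Memℓp (x a) 2}.indicator fun a => x a n := by
    ext a
    by_cases ha : Memℓp (x a) 2
    · rw [coeFn_lpOfSeq ha]
      exact (indicator_of_mem (s := {a | Memℓp (x a) 2}) ha fun a => x a n).symm
    · rw [lpOfSeq, dif_neg ha]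
      exact (indicator_of_notMem (s := {a | Memℓp (x a) 2}) ha fun a => x a n).symm
  rw [heq]
  exact (h n).indicator hs

end SquareSummable

/-! ### Periodization of functions on the line. -/

section Periodization

/-- Lebesgue measure on `[0, 1)`. -/
def unitMeasure : Measure ℝ := volume.restrict (Ico (0 : ℝ) 1)

theorem ae_forall_add_int {p : ℝ → Prop} (h : ∀ᵐ x, p x) :
    ∀ᵐ ξ ∂unitMeasure, ∀ n : ℤ, p (ξ + n) := by
  refine ae_all_iff.mpr fun n => ae_restrict_of_ae ?_
  exact (measurePreserving_add_right volume (n : ℝ)).quasiMeasurePreserving.ae h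

theorem lintegral_eq_lintegral_tsum_add_int {g : ℝ → ENNReal} (hg : Measurable g) :
    ∫⁻ x, g x = ∫⁻ ξ, ∑' n : ℤ, g (ξ + n) ∂unitMeasure := by
  have hgn : ∀ n : ℤ, AEMeasurable (fun ξ => g (ξ + n)) unitMeasure := fun n =>
    (hg.comp (measurable_add_const (n : ℝ))).aemeasurable
  rw [lintegral_tsum hgn, ← setLIntegral_univ, ← iUnion_Ico_intCast ℝ, lintegral_iUnion (fun _ => measurableSet_Ico)
    (pairwise_disjoint_Ico_intCast ℝ)]
  refine tsum_congr fun n => ?_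
  have h1 := (measurePreserving_add_right volume (n : ℝ)).setLIntegral_comp_preimage
    (measurableSet_Ico (a := (n : ℝ)) (b := n + 1)) hg
  rw [← h1, unitMeasure]
  congr 2
  ext x
  simp only [mem_preimage, mem_Ico]
  constructor <;> rintro ⟨h2, h3⟩ <;> constructor <;> linarith

variable {F : Type*} [NormedAddCommGroup F] {G : ℝ → F}

theorem ae_memℓp_add_int (hG : StronglyMeasurable G) (h : ∫⁻ x, ‖G x‖ₑ ^ 2 ≠ ⊤) :
    ∀ᵐ ξ ∂unitMeasure, Memℓp (fun n : ℤ => G (ξ + n)) 2 := by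
  have hm : Measurable fun x => ‖G x‖ₑ ^ 2 := hG.enorm.pow_const 2
  rw [lintegral_eq_lintegral_tsum_add_int hm] at h
  filter_upwards [ae_lt_top (Measurable.tsum fun n : ℤ =>
    hm.comp (measurable_add_const (n : ℝ))) h] with ξ hξ
  exact memℓp_two_iff.mpr hξ.ne

theorem lintegral_enorm_lpOfSeq_sq (hG : StronglyMeasurable G) (h : ∫⁻ x, ‖G x‖ₑ ^ 2 ≠ ⊤) :
    ∫⁻ ξ, ‖lpOfSeq fun n : ℤ => G (ξ + n)‖ₑ ^ 2 ∂unitMeasure = ∫⁻ x, ‖G x‖ₑ ^ 2 := by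
  rw [lintegral_eq_lintegral_tsum_add_int (hG.enorm.pow_const 2)]
  refine lintegral_congr_ae ?_
  filter_upwards [ae_memℓp_add_int hG h] with ξ hξ
  exact enorm_lpOfSeq_sq hξ

end Periodization

/-! ### Fiberization as a unitary operator. -/

section Fiberization

variable {d : ℕ}

/-- The square root `|λ|^{d/2}` of the Plancherel density. -/
def plancherelWeight (d : ℕ) (lam : ℝ) : ℂ := ((|lam| ^ ((d : ℝ) / 2) : ℝ) : ℂ)

theorem measurable_plancherelWeight : Measurable (plancherelWeight d) := by
  unfold plancherelWeight
  exact Complex.measurable_ofReal.comp (measurable_norm.pow_const _)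

theorem plancherelWeight_ne_zero {lam : ℝ} (h : lam ≠ 0) : plancherelWeight d lam ≠ 0 :=
  Complex.ofReal_ne_zero.mpr (Real.rpow_pos_of_pos (abs_pos.mpr h) _).ne'

theorem enorm_plancherelWeight_sq (lam : ℝ) :
    ‖plancherelWeight d lam‖ₑ ^ 2 = ENNReal.ofReal (|lam| ^ d) := by
  rw [← ofReal_norm, plancherelWeight, Complex.norm_real, Real.norm_of_nonneg (by positivity),
    ← ENNReal.ofReal_pow (by positivity), ← Real.rpow_natCast, ← Real.rpow_mul (abs_nonneg _)]
  congr 1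
  push_cast
  rw [div_mul_cancel₀ _ two_ne_zero, Real.rpow_natCast]

/-- The density is positive off the single point `0`, so Plancherel null sets are Lebesgue null. -/
theorem ae_volume_of_ae_plancherelMeasure {p : ℝ → Prop} (h : ∀ᵐ lam ∂plancherelMeasure d, p lam) :
    ∀ᵐ lam, p lam := by
  have hm : Measurable fun lam : ℝ => ENNReal.ofReal (|lam| ^ d) :=
    ENNReal.measurable_ofReal.comp (Continuous.measurable (by fun_prop))
  rw [plancherelMeasure, ae_withDensity_iff hm] at h
  filter_upwards [h, Measure.ae_ne volume (0 : ℝ)] with lam h1 h2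
  exact h1 (ENNReal.ofReal_pos.mpr (by positivity)).ne'

/-- The weighted Plancherel transform `|λ|^{d/2} f̂(λ)`. -/
def weightedPlancherel (f : HeisenbergL2 d) (lam : ℝ) : HS d :=
  plancherelWeight d lam • plancherelEquiv d f lam

theorem stronglyMeasurable_weightedPlancherel (f : HeisenbergL2 d) :
    StronglyMeasurable (weightedPlancherel f) :=
  measurable_plancherelWeight.stronglyMeasurable.smul (Lp.stronglyMeasurable _)

theorem lintegral_enorm_weight_smul {F : ℝ → HS d} (hF : StronglyMeasurable F) :
    ∫⁻ lam, ‖plancherelWeight d lam • F lam‖ₑ ^ 2 = ∫⁻ lam, ‖F lam‖ₑ ^ 2 ∂plancherelMeasure d := by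
  rw [lintegral_plancherelMeasure (hF.enorm.pow_const 2)]
  refine lintegral_congr fun lam => ?_
  rw [enorm_smul, mul_pow, enorm_plancherelWeight_sq]

theorem lintegral_enorm_weightedPlancherel (f : HeisenbergL2 d) :
    ∫⁻ lam, ‖weightedPlancherel f lam‖ₑ ^ 2 = ‖f‖ₑ ^ 2 := by
  rw [← (plancherelEquiv d).enorm_map, Lp.enorm_sq_eq_lintegral,
    ← lintegral_enorm_weight_smul (Lp.stronglyMeasurable _)]
  rfl

theorem lintegral_enorm_weightedPlancherel_ne_top (f : HeisenbergL2 d) :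
    ∫⁻ lam, ‖weightedPlancherel f lam‖ₑ ^ 2 ≠ ⊤ := by
  rw [lintegral_enorm_weightedPlancherel]
  exact ENNReal.pow_ne_top enorm_ne_top

theorem fiberization_eq (f : HeisenbergL2 d) (ξ : ℝ) :
    fiberization f ξ = lpOfSeq fun n : ℤ => weightedPlancherel f (ξ + n) := by
  unfold fiberization lpOfSeq weightedPlancherel plancherelWeight
  rw [plancherel_eq_plancherelEquiv]

theorem stronglyMeasurable_fiberization (f : HeisenbergL2 d) :
    StronglyMeasurable (fiberization f) := by
  simp only [funext (fiberization_eq f)]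
  exact stronglyMeasurable_lpOfSeq fun n =>
    (stronglyMeasurable_weightedPlancherel f).comp_measurable (measurable_add_const (n : ℝ))

theorem lintegral_enorm_fiberization (f : HeisenbergL2 d) :
    ∫⁻ ξ, ‖fiberization f ξ‖ₑ ^ 2 ∂unitMeasure = ‖f‖ₑ ^ 2 := by
  simp only [funext (fiberization_eq f)]
  rw [lintegral_enorm_lpOfSeq_sq (stronglyMeasurable_weightedPlancherel f)
    (lintegral_enorm_weightedPlancherel_ne_top f), lintegral_enorm_weightedPlancherel]

theorem ae_coeFn_fiberization (f : HeisenbergL2 d) : ∀ᵐ ξ ∂unitMeasure,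
    ⇑(fiberization f ξ) = fun n : ℤ => weightedPlancherel f (ξ + n) := by
  filter_upwards [ae_memℓp_add_int (stronglyMeasurable_weightedPlancherel f)
    (lintegral_enorm_weightedPlancherel_ne_top f)] with ξ hξ
  rw [fiberization_eq, coeFn_lpOfSeq hξ]

theorem memLp_fiberization (f : HeisenbergL2 d) : MemLp (fiberization f) 2 unitMeasure := by
  refine memLp_two_of_lintegral (stronglyMeasurable_fiberization f).aestronglyMeasurable ?_
  rw [lintegral_enorm_fiberization]
  exact ENNReal.pow_lt_top enorm_lt_top

theorem ae_fiberization_add (f g : HeisenbergL2 d) : ∀ᵐ ξ ∂unitMeasure,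
    fiberization (f + g) ξ = fiberization f ξ + fiberization g ξ := by
  have h := Lp.coeFn_add (plancherelEquiv d f) (plancherelEquiv d g)
  rw [← map_add] at h
  filter_upwards [ae_coeFn_fiberization (f + g), ae_coeFn_fiberization f, ae_coeFn_fiberization g,
    ae_forall_add_int (ae_volume_of_ae_plancherelMeasure h)] with ξ h1 h2 h3 h4
  refine lp.ext (funext fun n => ?_)
  rw [h1, lp.coeFn_add, Pi.add_apply, h2, h3]
  simp only [weightedPlancherel, h4 n, Pi.add_apply, smul_add]

/-- A `1`-periodic `m` takes one value on the whole coset `ξ + ℤ`, hence acts on the fibre as a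
scalar. -/
theorem ae_fiberization_multiplier (m : ℝ → ℂ) (hm : Measurable m) (hb : ∀ x, ‖m x‖ ≤ 1)
    (hp : Function.Periodic m 1) (f : HeisenbergL2 d) : ∀ᵐ ξ ∂unitMeasure,
    fiberization (multiplier m hm hb f) ξ = m ξ • fiberization f ξ := by
  filter_upwards [ae_coeFn_fiberization (multiplier m hm hb f), ae_coeFn_fiberization f,
    ae_forall_add_int (ae_volume_of_ae_plancherelMeasure (coeFn_multiplier m hm hb f))]
    with ξ h1 h2 h3
  refine lp.ext (funext fun n => ?_)
  have h4 : m (ξ + n) = m ξ := by simpa using hp.int_mul n ξ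
  rw [h1, lp.coeFn_smul, Pi.smul_apply, h2]
  simp only [weightedPlancherel, h3 n, h4]
  exact smul_comm _ _ _

theorem ae_fiberization_smul (c : ℂ) (f : HeisenbergL2 d) : ∀ᵐ ξ ∂unitMeasure,
    fiberization (c • f) ξ = c • fiberization f ξ := by
  have h := Lp.coeFn_smul c (plancherelEquiv d f)
  rw [← map_smul] at h
  filter_upwards [ae_coeFn_fiberization (c • f), ae_coeFn_fiberization f,
    ae_forall_add_int (ae_volume_of_ae_plancherelMeasure h)] with ξ h1 h2 h4
  refine lp.ext (funext fun n => ?_)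
  rw [h1, lp.coeFn_smul, Pi.smul_apply, h2]
  simp only [weightedPlancherel, h4 n, Pi.smul_apply]
  exact smul_comm _ _ _

variable (d) in
/-- Fiberization as a linear isometry into `L²([0, 1); ℓ²(ℤ, HS(L²(ℝ^d))))`. -/
def fiberizationLI : HeisenbergL2 d →ₗᵢ[ℂ] Lp (FiberSpace d) 2 unitMeasure where
  toFun f := (memLp_fiberization f).toLp _
  map_add' f g := by
    rw [← MemLp.toLp_add]
    exact MemLp.toLp_congr _ _ (ae_fiberization_add f g)
  map_smul' c f := by
    rw [RingHom.id_apply, ← MemLp.toLp_const_smul]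
    exact MemLp.toLp_congr _ _ (ae_fiberization_smul c f)
  norm_map' f := by
    rw [← toReal_enorm, ← toReal_enorm f]
    congr 1
    refine (ENNReal.pow_right_strictMono two_ne_zero).injective ?_
    change ‖(memLp_fiberization f).toLp _‖ₑ ^ 2 = ‖f‖ₑ ^ 2
    rw [Lp.enorm_sq_eq_lintegral, ← lintegral_enorm_fiberization]
    refine lintegral_congr_ae ?_
    filter_upwards [(memLp_fiberization f).coeFn_toLp] with ξ hξ
    rw [hξ]

theorem coeFn_fiberizationLI (f : HeisenbergL2 d) :
    fiberizationLI d f =ᵐ[unitMeasure] fiberization f :=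
  (memLp_fiberization f).coeFn_toLp

theorem stronglyMeasurable_unfold {F : Type*} [NormedAddCommGroup F] [InnerProductSpace ℂ F]
    [TopologicalSpace.SeparableSpace F] {H : ℝ → lp (fun _ : ℤ => F) 2}
    (hH : StronglyMeasurable H) :
    StronglyMeasurable fun lam : ℝ => H (Int.fract lam) ⌊lam⌋ := by
  borelize F
  have h1 : Measurable fun p : ℝ × ℤ => H p.1 p.2 :=
    measurable_from_prod_countable_left fun n =>
      ((lp.evalCLM ℂ (fun _ : ℤ => F) 2 n).continuous.comp_stronglyMeasurable hH).measurable
  exact (h1.comp (measurable_fract.prodMk Int.measurable_floor)).stronglyMeasurable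

theorem fiberizationLI_surjective : Function.Surjective (fiberizationLI d) := by
  intro H
  -- Periodization is undone by reading `λ` as `{λ} + ⌊λ⌋`; dividing by the weight, nonzero off `0`,
  -- then gives the Plancherel transform of the preimage.
  set G : ℝ → HS d := fun lam => H (Int.fract lam) ⌊lam⌋ with hG
  have hGm : StronglyMeasurable G := stronglyMeasurable_unfold (Lp.stronglyMeasurable H)
  have hGH : ∀ᵐ ξ ∂unitMeasure, ∀ n : ℤ, G (ξ + n) = H ξ n := by
    filter_upwards [ae_restrict_mem measurableSet_Ico] with ξ hξ n
    have h1 : ⌊ξ⌋ = 0 := Int.floor_eq_zero_iff.mpr hξ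
    have h2 : Int.fract ξ = ξ := Int.fract_eq_self.mpr hξ
    simp only [hG, Int.fract_add_intCast, Int.floor_add_intCast, h1, h2, zero_add]
  set F : ℝ → HS d := fun lam => (plancherelWeight d lam)⁻¹ • G lam with hF
  have hFm : StronglyMeasurable F :=
    measurable_plancherelWeight.inv.stronglyMeasurable.smul hGm
  have hFG : ∀ᵐ lam : ℝ, plancherelWeight d lam • F lam = G lam := by
    filter_upwards [Measure.ae_ne volume (0 : ℝ)] with lam h0
    rw [hF, smul_inv_smul₀ (plancherelWeight_ne_zero h0)]
  have hFL : MemLp F 2 (plancherelMeasure d) := by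
    refine memLp_two_of_lintegral hFm.aestronglyMeasurable ?_
    have h1 : ∫⁻ lam, ‖plancherelWeight d lam • F lam‖ₑ ^ 2 = ∫⁻ lam, ‖G lam‖ₑ ^ 2 := by
      refine lintegral_congr_ae ?_
      filter_upwards [hFG] with lam h
      rw [h]
    have h2 : ∫⁻ ξ, ∑' n : ℤ, ‖G (ξ + n)‖ₑ ^ 2 ∂unitMeasure = ∫⁻ ξ, ‖H ξ‖ₑ ^ 2 ∂unitMeasure := by
      refine lintegral_congr_ae ?_
      filter_upwards [hGH] with ξ h
      simp only [h]
      exact (lp.enorm_sq_eq_tsum _).symm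
    rw [← lintegral_enorm_weight_smul hFm, h1,
      lintegral_eq_lintegral_tsum_add_int (hGm.enorm.pow_const 2), h2]
    exact (Lp.memLp H).lintegral_enorm_sq_lt_top
  refine ⟨(plancherelEquiv d).symm (hFL.toLp F), Lp.ext ?_⟩
  have h3 : ∀ᵐ lam : ℝ, weightedPlancherel ((plancherelEquiv d).symm (hFL.toLp F)) lam =
      G lam := by
    filter_upwards [ae_volume_of_ae_plancherelMeasure hFL.coeFn_toLp, hFG] with lam h4 h5
    rw [weightedPlancherel, LinearIsometryEquiv.apply_symm_apply, h4, h5]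
  filter_upwards [coeFn_fiberizationLI ((plancherelEquiv d).symm (hFL.toLp F)), hGH,
    ae_forall_add_int h3] with ξ h6 h7 h8
  rw [h6, fiberization_eq]
  simp only [h8, h7]
  exact lpOfSeq_coeFn _

variable (d) in
/-- Fiberization as a unitary operator onto `L²([0, 1); ℓ²(ℤ, HS(L²(ℝ^d))))`. -/
def fiberizationEquiv : HeisenbergL2 d ≃ₗᵢ[ℂ] Lp (FiberSpace d) 2 unitMeasure :=
  LinearIsometryEquiv.ofSurjective (fiberizationLI d) fiberizationLI_surjective

theorem coeFn_fiberizationEquiv (f : HeisenbergL2 d) :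
    fiberizationEquiv d f =ᵐ[unitMeasure] fiberization f :=
  coeFn_fiberizationLI f

end Fiberization

end

noncomputable section

/-! ### Range functions of multiplication-invariant subspaces. -/

section RangeFamily

theorem Lp.exists_seq_tendsto_ae {α E : Type*} [MeasurableSpace α] [NormedAddCommGroup E]
    {ν : Measure α} {f : ℕ → Lp E 2 ν} {g : Lp E 2 ν} (hg : g ∈ closure (range f)) :
    ∃ φ : ℕ → ℕ, ∀ᵐ x ∂ν, Tendsto (fun k => f (φ k) x) atTop (𝓝 (g x)) := by
  obtain ⟨u, hu, hug⟩ := mem_closure_iff_seq_limit.mp hg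
  choose φ hφ using hu
  obtain ⟨n, -, hn⟩ := (tendstoInMeasure_of_tendsto_Lp hug).exists_seq_tendsto_ae
  refine ⟨fun k => φ (n k), ?_⟩
  simpa only [hφ] using hn

variable {α : Type*} [MeasurableSpace α] {K : Type*} [NormedAddCommGroup K] [InnerProductSpace ℂ K]

/-- Pettis' theorem in a separable Hilbert space: the partial sums of the basis expansion are
measurable and converge pointwise. -/
theorem aestronglyMeasurable_of_inner [CompleteSpace K] [TopologicalSpace.SeparableSpace K]
    {ν : Measure α} {p : α → K}
    (h : ∀ b : K, AEMeasurable (fun x => inner ℂ b (p x)) ν) : AEStronglyMeasurable p ν := by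
  classical
  obtain ⟨w, e, -⟩ := exists_hilbertBasis ℂ K
  have : Countable w := e.orthonormal.countable_index
  refine aestronglyMeasurable_of_tendsto_ae (u := (atTop : Filter (Finset w)))
    (f := fun s x => ∑ i ∈ s, e.repr (p x) i • e i) (fun s => ?_)
    (Eventually.of_forall fun x => e.hasSum_repr (p x))
  refine Finset.aestronglyMeasurable_fun_sum s fun i _ => ?_
  simp only [e.repr_apply_apply]
  exact (h _).aestronglyMeasurable.smul_const _

/-- `J` is a measurable family of closed subspaces such that `V` consists of the square integrable
functions with values in `J`. -/
structure IsRangeFamily (ν : Measure α) (V : Submodule ℂ (Lp K 2 ν)) (J : α → Submodule ℂ K) :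
    Prop where
  isClosed : ∀ x, IsClosed (J x : Set K)
  exists_proj : ∀ a : K, ∃ p : α → K, (∀ x, p x ∈ J x ∧ a - p x ∈ (J x)ᗮ) ∧
    ∀ b : K, AEMeasurable (fun x => inner ℂ b (p x)) ν
  mem_iff : ∀ f : Lp K 2 ν, f ∈ V ↔ ∀ᵐ x ∂ν, f x ∈ J x

variable {ν : Measure α} {V V' : Submodule ℂ (Lp K 2 ν)} {J J' : α → Submodule ℂ K}

/-- Pointwise orthogonality of orthogonal subspaces one of which is invariant under
multiplications. -/
theorem ae_inner_eq_zero
    (hV : ∀ (m : α → ℂ) (hm : Measurable m) (hb : ∀ x, ‖m x‖ ≤ 1), ∀ f ∈ V,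
      Lp.mulBdd ν m hm hb f ∈ V) {f g : Lp K 2 ν} (hf : f ∈ V) (hg : g ∈ Vᗮ) :
    ∀ᵐ x ∂ν, inner ℂ (g x) (f x) = 0 := by
  refine (L2.integrable_inner (𝕜 := ℂ) g f).ae_eq_zero_of_forall_setIntegral_eq_zero
    fun s hs _ => ?_
  -- Multiplying `f` by `1_s` stays in `V` and localizes the global orthogonality to `s`.
  have hm : Measurable (s.indicator (1 : α → ℂ)) := measurable_one.indicator hs
  have hb : ∀ x, ‖s.indicator (1 : α → ℂ) x‖ ≤ 1 := fun x => by
    refine (norm_indicator_le_norm_self _ _).trans ?_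
    simp
  have h1 := Submodule.inner_left_of_mem_orthogonal (hV _ hm hb f hf) hg
  rw [L2.inner_def] at h1
  rw [← h1, ← integral_indicator hs]
  refine integral_congr_ae ?_
  filter_upwards [Lp.coeFn_mulBdd ν _ hm hb f] with x hx
  rw [hx, inner_smul_right]
  by_cases hxs : x ∈ s <;> simp [hxs]

namespace IsRangeFamily

theorem mulBdd_mem (h : IsRangeFamily ν V J) (m : α → ℂ) (hm : Measurable m)
    (hb : ∀ x, ‖m x‖ ≤ 1) (f : Lp K 2 ν) (hf : f ∈ V) : Lp.mulBdd ν m hm hb f ∈ V := by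
  rw [h.mem_iff] at hf ⊢
  filter_upwards [hf, Lp.coeFn_mulBdd ν m hm hb f] with x h1 h2
  rw [h2]
  exact (J x).smul_mem _ h1

variable [CompleteSpace K] [TopologicalSpace.SeparableSpace K] [IsFiniteMeasure ν]

/-- The spaces `J x` are spanned by countably many elements of `V`. -/
theorem exists_seq (h : IsRangeFamily ν V J) :
    ∃ p : ℕ → Lp K 2 ν, (∀ k, p k ∈ V) ∧
      ∀ᵐ x ∂ν, ∀ v ∈ J x, v ∈ closure (range fun k => p k x) := by
  have key : ∀ k : ℕ, ∃ p : Lp K 2 ν, p ∈ V ∧ ∀ᵐ x ∂ν,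
      TopologicalSpace.denseSeq K k - p x ∈ (J x)ᗮ ∧ p x ∈ J x := by
    intro k
    -- The sequence consists of the fibrewise projections of a dense sequence of constant vectors.
    -- These are bounded, hence square integrable as `ν` is finite.
    obtain ⟨q, hq, hqm⟩ := h.exists_proj (TopologicalSpace.denseSeq K k)
    have hL : MemLp q 2 ν := by
      refine MemLp.of_bound (aestronglyMeasurable_of_inner hqm) ‖TopologicalSpace.denseSeq K k‖
        (Eventually.of_forall fun x => ?_)
      have := (h.isClosed x).completeSpace_coe
      rw [← Submodule.eq_starProjection_of_mem_orthogonal (hq x).1 (hq x).2]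
      exact Submodule.norm_starProjection_apply_le _ _
    refine ⟨hL.toLp q, ?_, ?_⟩
    · rw [h.mem_iff]
      filter_upwards [hL.coeFn_toLp] with x hx
      rw [hx]
      exact (hq x).1
    · filter_upwards [hL.coeFn_toLp] with x hx
      rw [hx]
      exact ⟨(hq x).2, (hq x).1⟩
  choose p hpV hp using key
  refine ⟨p, hpV, ?_⟩
  filter_upwards [ae_all_iff.mpr hp] with x hx v hv
  have := (h.isClosed x).completeSpace_coe
  have h1 : ∀ k, p k x = (J x).starProjection (TopologicalSpace.denseSeq K k) := fun k =>
    (Submodule.eq_starProjection_of_mem_orthogonal (hx k).2 (hx k).1).symm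
  rw [← Submodule.starProjection_eq_self_iff.mpr hv]
  refine map_mem_closure (J x).starProjection.continuous
    (TopologicalSpace.denseRange_denseSeq K v) ?_
  rintro _ ⟨k, rfl⟩
  exact ⟨k, h1 k⟩

/-- Countably many elements of `V` have values dense in `J x`, so only countably many null sets are
discarded before taking closures. -/
theorem ae_le (h : IsRangeFamily ν V J) (h' : IsRangeFamily ν V' J') (hVV' : V ≤ V') :
    ∀ᵐ x ∂ν, J x ≤ J' x := by
  obtain ⟨p, hpV, hp⟩ := h.exists_seq
  filter_upwards [hp, ae_all_iff.mpr fun k => (h'.mem_iff _).mp (hVV' (hpV k))] with x h1 h2 v hv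
  refine closure_minimal ?_ (h'.isClosed x) (h1 v hv)
  rintro _ ⟨k, rfl⟩
  exact h2 k

theorem ae_isOrtho (h : IsRangeFamily ν V J) (h' : IsRangeFamily ν V' J') (hVV' : V ⟂ V') :
    ∀ᵐ x ∂ν, J x ⟂ J' x := by
  obtain ⟨p, hpV, hp⟩ := h.exists_seq
  obtain ⟨q, hqV, hq⟩ := h'.exists_seq
  have h1 : ∀ᵐ x ∂ν, ∀ k l, inner ℂ (p k x) (q l x) = 0 :=
    ae_all_iff.mpr fun k => ae_all_iff.mpr fun l =>
      ae_inner_eq_zero h'.mulBdd_mem (hqV l) (hVV' (hpV k))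
  filter_upwards [h1, hp, hq] with x h2 h3 h4
  rw [Submodule.isOrtho_iff_inner_eq]
  intro v hv w hw
  have h5 : ∀ l, inner ℂ v (q l x) = 0 := fun l => by
    refine closure_minimal (s := range fun k => p k x) (t := {v | inner ℂ v (q l x) = 0}) ?_
      (isClosed_eq (by fun_prop) continuous_const) (h3 v hv)
    rintro _ ⟨k, rfl⟩
    exact h2 k l
  refine closure_minimal (s := range fun k => q k x) (t := {w | inner ℂ v w = 0}) ?_
    (isClosed_eq (by fun_prop) continuous_const) (h4 w hw)
  rintro _ ⟨k, rfl⟩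
  exact h5 k

end IsRangeFamily

variable [CompleteSpace K] [TopologicalSpace.SeparableSpace K] [IsFiniteMeasure ν]
  [MeasurableSpace.CountablyGenerated α]

/-- Take `J x` to be the closed span of the values at `x` of a dense sequence of `V`. Invariance
under multiplications makes elements of `Vᗮ` pointwise orthogonal to `J x`. -/
theorem exists_isRangeFamily (hc : IsClosed (V : Set (Lp K 2 ν)))
    (hV : ∀ (m : α → ℂ) (hm : Measurable m) (hb : ∀ x, ‖m x‖ ≤ 1), ∀ f ∈ V,
      Lp.mulBdd ν m hm hb f ∈ V) : ∃ J : α → Submodule ℂ K, IsRangeFamily ν V J := by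
  have : Fact ((2 : ENNReal) ≠ ⊤) := ⟨ENNReal.ofNat_ne_top⟩
  have hcs : CompleteSpace V := hc.completeSpace_coe
  set u : ℕ → Lp K 2 ν := fun k => (TopologicalSpace.denseSeq V k : Lp K 2 ν) with hu
  have huV : ∀ k, u k ∈ V := fun k => (TopologicalSpace.denseSeq V k).2
  have hdense : ∀ f ∈ V, f ∈ closure (range u) := by
    intro f hf
    refine map_mem_closure continuous_subtype_val
      (TopologicalSpace.denseRange_denseSeq V ⟨f, hf⟩) ?_
    rintro _ ⟨k, rfl⟩
    exact ⟨k, rfl⟩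
  set J : α → Submodule ℂ K := fun x =>
    (Submodule.span ℂ (range fun k => u k x)).topologicalClosure with hJ
  have hJc : ∀ x, IsClosed (J x : Set K) := fun x => Submodule.isClosed_topologicalClosure _
  have hJcs : ∀ x, CompleteSpace (J x) := fun x => (hJc x).completeSpace_coe
  have hVJ : ∀ f ∈ V, ∀ᵐ x ∂ν, f x ∈ J x := by
    intro f hf
    obtain ⟨φ, hφ⟩ := Lp.exists_seq_tendsto_ae (hdense f hf)
    filter_upwards [hφ] with x hx
    refine (hJc x).mem_of_tendsto hx (Eventually.of_forall fun k => ?_)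
    exact Submodule.le_topologicalClosure _ (Submodule.subset_span ⟨φ k, rfl⟩)
  have hVperp : ∀ g ∈ Vᗮ, ∀ᵐ x ∂ν, g x ∈ (J x)ᗮ := by
    intro g hg
    filter_upwards [ae_all_iff.mpr fun k => ae_inner_eq_zero hV (huV k) hg] with x hx
    rw [hJ, Submodule.orthogonal_closure, Submodule.mem_orthogonal']
    intro v hv
    have h1 : Submodule.span ℂ (range fun k => u k x) ≤ (ℂ ∙ g x)ᗮ := by
      refine Submodule.span_le.mpr ?_
      rintro _ ⟨k, rfl⟩
      exact Submodule.mem_orthogonal_singleton_iff_inner_right.mpr (hx k)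
    exact Submodule.mem_orthogonal_singleton_iff_inner_right.mp (h1 hv)
  -- The projection onto `V` acts fibre by fibre. Applied to constants this gives measurability of
  -- `J`, and applied to a function with values in `J` it gives membership in `V`.
  have hsplit : ∀ f : Lp K 2 ν, ∀ᵐ x ∂ν, V.starProjection f x = (J x).starProjection (f x) := by
    intro f
    filter_upwards [hVJ _ (V.starProjection_apply_mem f),
      hVperp _ (V.sub_starProjection_mem_orthogonal f),
      Lp.coeFn_sub f (V.starProjection f)] with x h1 h2 h3
    rw [h3, Pi.sub_apply] at h2
    exact (Submodule.eq_starProjection_of_mem_orthogonal h1 h2).symm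
  refine ⟨J, hJc, fun a => ⟨fun x => (J x).starProjection a, fun x =>
    ⟨(J x).starProjection_apply_mem a, (J x).sub_starProjection_mem_orthogonal a⟩, fun b => ?_⟩,
    fun f => ⟨hVJ f, fun hf => ?_⟩⟩
  · have ha : MemLp (fun _ : α => a) 2 ν := memLp_const a
    have h1 := (Lp.aestronglyMeasurable (V.starProjection (ha.toLp _))).const_inner (𝕜 := ℂ) (c := b)
    refine h1.aemeasurable.congr ?_
    filter_upwards [hsplit (ha.toLp _), ha.coeFn_toLp] with x h2 h3
    rw [h2, h3]
  · rw [← Submodule.starProjection_eq_self_iff]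
    refine Lp.ext ?_
    filter_upwards [hf, hsplit f] with x h1 h2
    rw [h2, Submodule.starProjection_eq_self_iff.mpr h1]

end RangeFamily

/-! ### Additivity of the dimension function. -/

section Dimension

variable {K : Type*} [NormedAddCommGroup K] [InnerProductSpace ℂ K]

theorem iSupIndep.rank_iSup_eq_sum {E : Type*} [AddCommGroup E] [Module ℂ E] {ι : Type*} [Fintype ι]
    {U : ι → Submodule ℂ E} (h : iSupIndep U) :
    Module.rank ℂ (⨆ i, U i : Submodule ℂ E) = ∑ i, Module.rank ℂ (U i) := by
  classical
  have key : ∀ s : Finset ι, Module.rank ℂ (s.sup U : Submodule ℂ E) =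
      ∑ i ∈ s, Module.rank ℂ (U i) := by
    intro s
    induction s using Finset.induction_on with
    | empty => simp
    | insert a s ha ih =>
      have hd : Disjoint (U a) (s.sup U) :=
        h.supIndep' (Finset.univ) (Finset.subset_univ s) (Finset.mem_univ a) ha
      have h1 := Submodule.rank_sup_add_rank_inf_eq (U a) (s.sup U)
      rw [hd.eq_bot, rank_bot, add_zero] at h1
      rw [Finset.sup_insert, Finset.sum_insert ha, h1, ih]
  rw [← key, Finset.sup_univ_eq_iSup]

variable {α : Type*} [MeasurableSpace α] {ν : Measure α} [CompleteSpace K]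
  [TopologicalSpace.SeparableSpace K] [IsFiniteMeasure ν]

/-- The dimensions of the range families of a finite orthogonal decomposition add up. -/
theorem IsRangeFamily.ae_toENat_rank_eq_sum {ι : Type*} [Fintype ι] {V : Submodule ℂ (Lp K 2 ν)}
    {U : ι → Submodule ℂ (Lp K 2 ν)} {J : α → Submodule ℂ K} {I : ι → α → Submodule ℂ K}
    (hV : IsRangeFamily ν V J) (hU : ∀ i, IsRangeFamily ν (U i) (I i))
    (hortho : Pairwise fun i j => U i ⟂ U j) (hle : ∀ i, U i ≤ V)
    (hsum : ∀ f ∈ V, ∃ g : ι → Lp K 2 ν, (∀ i, g i ∈ U i) ∧ f = ∑ i, g i) :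
    ∀ᵐ x ∂ν, Cardinal.toENat (Module.rank ℂ (J x)) =
      ∑ i, Cardinal.toENat (Module.rank ℂ (I i x)) := by
  classical
  obtain ⟨p, hpV, hp⟩ := hV.exists_seq
  choose g hgU hg using fun k => hsum (p k) (hpV k)
  have h1 : ∀ᵐ x ∂ν, ∀ i j, i ≠ j → I i x ⟂ I j x := by
    refine ae_all_iff.mpr fun i => ae_all_iff.mpr fun j => ?_
    by_cases hij : i = j
    · exact Eventually.of_forall fun x hne => absurd hij hne
    · filter_upwards [(hU i).ae_isOrtho (hU j) (hortho hij)] with x hx _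
      exact hx
  have h2 : ∀ᵐ x ∂ν, ∀ i, I i x ≤ J x := ae_all_iff.mpr fun i => (hU i).ae_le hV (hle i)
  have h3 : ∀ᵐ x ∂ν, ∀ k i, g k i x ∈ I i x :=
    ae_all_iff.mpr fun k => ae_all_iff.mpr fun i => ((hU i).mem_iff _).mp (hgU k i)
  have h4 : ∀ᵐ x ∂ν, ∀ k, p k x = ∑ i, g k i x := by
    refine ae_all_iff.mpr fun k => ?_
    have h5 := Lp.coeFn_finsetSum (p := 2) (μ := ν) Finset.univ (g k)
    rw [← hg k] at h5
    filter_upwards [h5] with x hx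
    rw [hx, Finset.sum_apply]
  filter_upwards [hp, h1, h2, h3, h4] with x hp h1 h2 h3 h4
  have hcs : ∀ i, CompleteSpace (I i x) := fun i => ((hU i).isClosed x).completeSpace_coe
  have hfam : OrthogonalFamily ℂ (fun i => I i x) fun i => (I i x).subtypeₗᵢ :=
    OrthogonalFamily.of_pairwise fun i j hij => h1 i j hij
  have hJ : J x = ⨆ i, I i x := by
    refine le_antisymm (fun v hv => ?_) (iSup_le h2)
    -- The identity `v = ∑ Pᵢ v` is a closed condition that holds for the dense vectors `p k x`, so
    -- `J x` is the algebraic sum of the `I i x`, with no closure needed.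
    have h6 : v = ∑ i, (I i x).starProjection v := by
      refine closure_minimal (s := range fun k => p k x)
        (t := {v | v = ∑ i, (I i x).starProjection v}) ?_
        (isClosed_eq continuous_id (by fun_prop)) (hp v hv)
      rintro _ ⟨k, rfl⟩
      change p k x = ∑ i, (I i x).starProjection (p k x)
      rw [h4 k]
      refine Finset.sum_congr rfl fun i _ => ?_
      rw [map_sum, Finset.sum_eq_single i]
      · exact (Submodule.starProjection_eq_self_iff.mpr (h3 k i)).symm
      · intro j _ hji
        refine Submodule.eq_starProjection_of_mem_orthogonal' (u := g k j x) (v := 0)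
          (Submodule.zero_mem _) (h1 j i hji (h3 k j)) (zero_add _).symm
      · exact fun hi => absurd (Finset.mem_univ i) hi
    rw [h6]
    exact Submodule.sum_mem _ fun i _ =>
      Submodule.mem_iSup_of_mem i ((I i x).starProjection_apply_mem v)
  rw [hJ, hfam.independent.rank_iSup_eq_sum, map_sum]

end Dimension

end

noncomputable section

variable {d : ℕ}

/-! ### The cut-off projections for `[n, n + 1) + Nℤ`. -/

section CutoffMultipliers

theorem multiplier_multiplier_congr {m m' q q' : ℝ → ℂ} {hm : Measurable m} {hm' : Measurable m'}
    {hq : Measurable q} {hq' : Measurable q'} {bm : ∀ x, ‖m x‖ ≤ 1} {bm' : ∀ x, ‖m' x‖ ≤ 1}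
    {bq : ∀ x, ‖q x‖ ≤ 1} {bq' : ∀ x, ‖q' x‖ ≤ 1} (h : ∀ x, m x * m' x = q x * q' x)
    (f : HeisenbergL2 d) :
    multiplier m hm bm (multiplier m' hm' bm' f) = multiplier q hq bq (multiplier q' hq' bq' f) := by
  refine eq_multiplier_of_ae q hq bq ?_
  filter_upwards [coeFn_multiplier m hm bm (multiplier m' hm' bm' f),
    coeFn_multiplier m' hm' bm' f, coeFn_multiplier q' hq' bq' f] with x h1 h2 h3
  rw [h1, h2, h3, smul_smul, smul_smul, h]

/-- Only the residue of `⌊x⌋` modulo `N` matters; measurability, periodicity and the partition of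
the line into these sets are read off from this form. -/
theorem mem_cutoffSet {N n : ℕ} {x : ℝ} : x ∈ cutoffSet N n ↔ ∃ k : ℤ, ⌊x⌋ = n + N * k := by
  constructor
  · rintro ⟨t, ht, k, rfl⟩
    refine ⟨k, ?_⟩
    have h1 : ⌊t⌋ = n := Int.floor_eq_iff.mpr (by exact_mod_cast ht)
    have h2 : (N : ℝ) * k = ((N * k : ℤ) : ℝ) := by push_cast; ring
    rw [h2, Int.floor_add_intCast, h1]
  · rintro ⟨k, hk⟩
    obtain ⟨h1, h2⟩ := Int.floor_eq_iff.mp hk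
    push_cast at h1 h2
    exact ⟨x - N * k, ⟨by linarith, by linarith⟩, k, by ring⟩

theorem measurableSet_cutoffSet (N n : ℕ) : MeasurableSet (cutoffSet N n) := by
  have h : cutoffSet N n = Int.floor ⁻¹' {j : ℤ | ∃ k : ℤ, j = n + N * k} := by
    ext x
    exact mem_cutoffSet
  rw [h]
  exact Int.measurable_floor (MeasurableSet.of_discrete)

/-- The indicator function of `[n, n + 1) + Nℤ`. -/
def cutoffFun (N n : ℕ) : ℝ → ℂ := (cutoffSet N n).indicator 1

theorem measurable_cutoffFun (N n : ℕ) : Measurable (cutoffFun N n) :=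
  measurable_one.indicator (measurableSet_cutoffSet N n)

theorem norm_cutoffFun_le (N n : ℕ) (x : ℝ) : ‖cutoffFun N n x‖ ≤ 1 := by
  refine (norm_indicator_le_norm_self _ _).trans ?_
  simp

theorem cutoffFun_smul {E : Type*} [AddCommGroup E] [Module ℂ E] (N n : ℕ) (F : ℝ → E) (x : ℝ) :
    cutoffFun N n x • F x = (cutoffSet N n).indicator F x := by
  by_cases hx : x ∈ cutoffSet N n <;> simp [cutoffFun, hx]

theorem periodic_cutoffFun (N n : ℕ) : Function.Periodic (cutoffFun N n) N := by
  intro x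
  have h : x + N ∈ cutoffSet N n ↔ x ∈ cutoffSet N n := by
    rw [mem_cutoffSet, mem_cutoffSet, Int.floor_add_natCast]
    constructor
    · rintro ⟨k, hk⟩
      exact ⟨k - 1, by linarith⟩
    · rintro ⟨k, hk⟩
      exact ⟨k + 1, by linarith⟩
  by_cases hx : x ∈ cutoffSet N n <;> simp [cutoffFun, h, hx]

theorem exists_mem_cutoffSet {N : ℕ} (hN : 0 < N) (x : ℝ) : ∃ n : Fin N, x ∈ cutoffSet N n := by
  have h1 : (0 : ℤ) < N := by exact_mod_cast hN
  have h2 := Int.emod_nonneg ⌊x⌋ h1.ne'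
  have h3 := Int.emod_lt_of_pos ⌊x⌋ h1
  refine ⟨⟨(⌊x⌋ % N).toNat, by omega⟩, mem_cutoffSet.mpr ⟨⌊x⌋ / N, ?_⟩⟩
  rw [Int.toNat_of_nonneg h2, Int.emod_add_mul_ediv]

theorem eq_of_mem_cutoffSet {N : ℕ} {n m : Fin N} {x : ℝ} (hn : x ∈ cutoffSet N n)
    (hm : x ∈ cutoffSet N m) : n = m := by
  obtain ⟨k, hk⟩ := mem_cutoffSet.mp hn
  obtain ⟨l, hl⟩ := mem_cutoffSet.mp hm
  have h1 := congrArg (· % (N : ℤ)) (hk.symm.trans hl)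
  simp only [Int.add_mul_emod_self_left] at h1
  rw [Int.emod_eq_of_lt (by omega) (by exact_mod_cast n.2),
    Int.emod_eq_of_lt (by omega) (by exact_mod_cast m.2)] at h1
  exact Fin.ext (by exact_mod_cast h1)

theorem sum_cutoffFun {N : ℕ} (hN : 0 < N) (x : ℝ) : ∑ n : Fin N, cutoffFun N n x = 1 := by
  obtain ⟨n, hn⟩ := exists_mem_cutoffSet hN x
  rw [Finset.sum_eq_single n]
  · simp [cutoffFun, hn]
  · intro m _ hmn
    have hm : x ∉ cutoffSet N m := fun hm => hmn (eq_of_mem_cutoffSet hm hn)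
    simp [cutoffFun, hm]
  · exact fun h => absurd (Finset.mem_univ n) h

/-- The orthogonal projection `f ↦ (χ f̂)ˇ` with `χ` the indicator function of `[n, n + 1) + Nℤ`. -/
def cutoff (N n : ℕ) : HeisenbergL2 d →L[ℂ] HeisenbergL2 d :=
  multiplier (cutoffFun N n) (measurable_cutoffFun N n) (norm_cutoffFun_le N n)

theorem cutoff_cutoff (N n : ℕ) (f : HeisenbergL2 d) :
    cutoff N n (cutoff N n f) = cutoff N n f := by
  refine eq_multiplier_of_ae _ _ _ ?_
  filter_upwards [coeFn_multiplier (cutoffFun N n) (measurable_cutoffFun N n)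
    (norm_cutoffFun_le N n) (cutoff N n f), coeFn_multiplier (cutoffFun N n)
    (measurable_cutoffFun N n) (norm_cutoffFun_le N n) f] with x h1 h2
  refine h1.trans ?_
  rw [cutoff, h2, smul_smul]
  congr 1
  by_cases hx : x ∈ cutoffSet N n <;> simp [cutoffFun, hx]

theorem sum_cutoff {N : ℕ} (hN : 0 < N) (f : HeisenbergL2 d) :
    ∑ n : Fin N, cutoff N n f = f := by
  refine (plancherelEquiv d).injective (Lp.ext ?_)
  rw [map_sum]
  filter_upwards [Lp.coeFn_finsetSum (p := 2) Finset.univ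
    fun n : Fin N => plancherelEquiv d (cutoff N n f), ae_all_iff.mpr fun n : Fin N =>
      coeFn_multiplier (cutoffFun N n) (measurable_cutoffFun N n) (norm_cutoffFun_le N n) f]
    with x h1 h2
  rw [h1, Finset.sum_apply]
  simp only [cutoff, h2]
  rw [← Finset.sum_smul, sum_cutoffFun hN, one_smul]

theorem inner_cutoff_cutoff {N : ℕ} {n m : Fin N} (h : n ≠ m) (f g : HeisenbergL2 d) :
    inner ℂ (cutoff N n f) (cutoff N m g) = 0 := by
  rw [cutoff, cutoff, inner_multiplier]
  refine (integral_congr_ae ?_).trans (integral_zero _ _)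
  filter_upwards [coeFn_multiplier (cutoffFun N n) (measurable_cutoffFun N n)
    (norm_cutoffFun_le N n) f] with x hx
  rw [hx, inner_smul_left, ← mul_assoc]
  by_cases hn : x ∈ cutoffSet N n
  · have hm : x ∉ cutoffSet N m := fun hm => h (eq_of_mem_cutoffSet hn hm)
    simp [cutoffFun, hm]
  · simp [cutoffFun, hn]

/-- Injectivity of the Plancherel transform turns the defining relation into an equation `f = cutoff
N n g`. -/
theorem cutoffSpace_eq (W : Submodule ℂ (HeisenbergL2 d)) (N n : ℕ) :
    cutoffSpace W N n = W.map (cutoff N n).toLinearMap := by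
  ext f
  have key : ∀ g : HeisenbergL2 d, (plancherel f =ᵐ[plancherelMeasure d]
      (cutoffSet N n).indicator (plancherel g)) ↔ cutoff N n g = f := by
    intro g
    rw [plancherel_eq_plancherelEquiv, plancherel_eq_plancherelEquiv]
    have h1 := coeFn_multiplier (cutoffFun N n) (measurable_cutoffFun N n)
      (norm_cutoffFun_le N n) g
    simp only [cutoffFun_smul] at h1
    constructor
    · exact fun h => (plancherelEquiv d).injective (Lp.ext (h1.trans h.symm))
    · rintro rfl
      exact h1
  simp only [cutoffSpace, key, mem_ofPred_eq, SetLike.mem_coe, Submodule.mem_map]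
  rfl

/-- On each set `[n, n + 1) + Nℤ` the character `λ ↦ e^{2πiλj/N}` agrees with a periodic
function. -/
theorem centralChar_mul_cutoffFun {N n : ℕ} (hN : 0 < N) (j : ℤ) (x : ℝ) :
    cutoffFun N n x * centralChar (j / N) x =
      centralChar (j / N) (n + Int.fract x) * cutoffFun N n x := by
  by_cases hx : x ∈ cutoffSet N n
  · obtain ⟨k, hk⟩ := mem_cutoffSet.mp hx
    have h1 : (x : ℝ) = n + N * k + Int.fract x := by
      have h2 := Int.floor_add_fract x
      rw [hk] at h2
      push_cast at h2
      exact h2.symm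
    have hN' : (N : ℂ) ≠ 0 := by exact_mod_cast hN.ne'
    have h3 : centralChar (j / N) x = centralChar (j / N) (n + Int.fract x) := by
      rw [centralChar, centralChar, Complex.exp_eq_exp_iff_exists_int]
      -- With `x = n + Nk + {x}`, the exponents differ by `2πi (Nk)(j/N) = 2πi kj`.
      refine ⟨k * j, ?_⟩
      conv_lhs => rw [h1]
      push_cast
      field_simp
      ring
    rw [h3, mul_comm]
  · simp [cutoffFun, hx]

end CutoffMultipliers

/-! ### Range functions transported through fiberization. -/

section Fibers

instance : IsFiniteMeasure unitMeasure := by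
  unfold unitMeasure
  infer_instance

theorem isRangeFunction_iff {W : Submodule ℂ (HeisenbergL2 d)}
    {J : ℝ → Submodule ℂ (FiberSpace d)} : IsRangeFunction W J ↔
    IsRangeFamily unitMeasure (W.map (fiberizationEquiv d).toLinearEquiv.toLinearMap) J := by
  have key : (∀ f : HeisenbergL2 d,
      f ∈ W ↔ ∀ᵐ ξ ∂unitMeasure, fiberization f ξ ∈ J ξ) ↔
      ∀ F, F ∈ W.map (fiberizationEquiv d).toLinearEquiv.toLinearMap ↔
        ∀ᵐ ξ ∂unitMeasure, F ξ ∈ J ξ := by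
    rw [(fiberizationEquiv d).surjective.forall]
    refine forall_congr' fun f => ?_
    have h1 : fiberizationEquiv d f ∈ W.map (fiberizationEquiv d).toLinearEquiv.toLinearMap ↔
        f ∈ W :=
      ⟨fun ⟨g, hg, hgf⟩ => (fiberizationEquiv d).injective hgf ▸ hg, fun hf => ⟨f, hf, rfl⟩⟩
    rw [h1]
    refine iff_congr Iff.rfl (eventually_congr ?_)
    filter_upwards [coeFn_fiberizationEquiv f] with ξ hξ
    rw [hξ]
  constructor
  · exact fun ⟨h1, h2, h3⟩ => ⟨h1, h2, key.mp h3⟩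
  · exact fun h => ⟨h.isClosed, h.exists_proj, key.mpr h.mem_iff⟩

/-- The range function of a closed subspace invariant under the central translations by `ℤ`. -/
theorem isRangeFamily_rangeFunction {W : Submodule ℂ (HeisenbergL2 d)}
    (hc : IsClosed (W : Set (HeisenbergL2 d)))
    (hW : ∀ k : ℤ, ∀ f ∈ W, leftTranslation (Heisenberg.central k) f ∈ W) :
    IsRangeFamily unitMeasure (W.map (fiberizationEquiv d).toLinearEquiv.toLinearMap)
      (rangeFunction W) := by
  have hex : ∃ J, IsRangeFunction W J := by
    simp only [isRangeFunction_iff]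
    refine exists_isRangeFamily ?_ ?_
    · rw [Submodule.map_coe]
      exact (fiberizationEquiv d).toHomeomorph.isClosedMap _ hc
    · rintro m hm hb _ ⟨f, hf, rfl⟩
      -- Only the values of `m` on `[0, 1)` count, and their `1`-periodic extension is a multiplier
      -- preserving `W`.
      have hm' : Measurable fun x : ℝ => m (Int.fract x) := hm.comp measurable_fract
      have hp : Function.Periodic (fun x : ℝ => m (Int.fract x)) 1 := fun x => by
        simp only [Int.fract_add_one]
      refine ⟨multiplier _ hm' (fun x => hb _) f, multiplier_mem hc one_pos (fun k => ?_) _ _ _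
        hp hf, ?_⟩
      · rw [div_one]
        exact hW k
      · refine Lp.ext ?_
        filter_upwards [coeFn_fiberizationEquiv (multiplier _ hm' (fun x => hb _) f),
          ae_fiberization_multiplier _ hm' (fun x => hb _) hp f, coeFn_fiberizationEquiv f,
          Lp.coeFn_mulBdd unitMeasure m hm hb (fiberizationEquiv d f),
          ae_restrict_mem measurableSet_Ico] with ξ h1 h2 h3 h4 h5
        refine h1.trans (h2.trans (Eq.trans ?_ h4.symm))
        rw [h3, Int.fract_eq_self.mpr h5]
  rw [rangeFunction, dif_pos hex]
  exact isRangeFunction_iff.mp hex.choose_spec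

end Fibers

/-! ### Invariance under the translation sets, and the theorem. -/

section TranslationSets

variable {A B : Matrix (Fin d) (Fin d) ℝ} {Θ : AddSubgroup ℝ}

theorem central_mem_translationSet {w : ℝ} (hw : w ∈ Θ) :
    Heisenberg.central w ∈ translationSet A B Θ := by
  refine ⟨0, 0, w, hw, Prod.ext ?_ (Prod.ext ?_ rfl)⟩ <;>
  · ext i
    simp [Heisenberg.central, Matrix.mulVec, dotProduct]

/-- The remaining factor has central coordinate `0`, so it lies in the translation set of any
subgroup `Θ'`. Refining the centre therefore only concerns central translations. -/
theorem exists_eq_central_mul {s : Heisenberg d} (hs : s ∈ translationSet A B Θ)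
    (Θ' : AddSubgroup ℝ) :
    ∃ w ∈ Θ, ∃ s' ∈ translationSet A B Θ', s = Heisenberg.central w * s' := by
  obtain ⟨k, l, w, hw, rfl⟩ := hs
  refine ⟨w, hw, _, ⟨k, l, 0, Θ'.zero_mem, rfl⟩, Prod.ext ?_ (Prod.ext ?_ ?_)⟩
  · exact (Heisenberg.central_mul_fst _ _).symm
  · exact (Heisenberg.central_mul_snd_fst _ _).symm
  · exact ((Heisenberg.central_mul_snd_snd _ _).trans (add_zero w)).symm

variable {W : Submodule ℂ (HeisenbergL2 d)}

theorem IsTranslationInvariant.central_mem (hW : IsTranslationInvariant (translationSet A B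
    (AddSubgroup.zmultiples (1 : ℝ))) W) (k : ℤ) {f : HeisenbergL2 d} (hf : f ∈ W) :
    leftTranslation (Heisenberg.central k) f ∈ W :=
  hW.2 _ (central_mem_translationSet (AddSubgroup.mem_zmultiples_iff.mpr ⟨k, by simp⟩)) f hf

theorem IsTranslationInvariant.cutoff_mem {N : ℕ} (hN : 0 < N)
    (hW : IsTranslationInvariant (translationSet A B
      (AddSubgroup.zmultiples (1 / (N : ℝ)))) W) (n : ℕ) {f : HeisenbergL2 d} (hf : f ∈ W) :
    cutoff N n f ∈ W := by
  refine multiplier_mem hW.1 (T := N) (by exact_mod_cast hN) (fun k f hf => ?_) _ _ _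
    (periodic_cutoffFun N n) hf
  refine hW.2 _ (central_mem_translationSet (AddSubgroup.mem_zmultiples_iff.mpr ⟨k, ?_⟩)) f hf
  rw [zsmul_eq_mul, mul_one_div]

/-- Cut the translate by `j/N` into its pieces over the `H_n`. On each piece the character may be
replaced by a `1`-periodic multiplier, and these preserve `W` already by invariance under the
integral centre. -/
theorem IsTranslationInvariant.refine {N : ℕ} (hN : 0 < N)
    (hW : IsTranslationInvariant (translationSet A B (AddSubgroup.zmultiples (1 : ℝ))) W)
    (h : ∀ n : Fin N, ∀ f ∈ W, cutoff N n f ∈ W) :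
    IsTranslationInvariant (translationSet A B (AddSubgroup.zmultiples (1 / (N : ℝ)))) W := by
  refine ⟨hW.1, fun s hs f hf => ?_⟩
  obtain ⟨w, hw, s', hs', rfl⟩ := exists_eq_central_mul hs (AddSubgroup.zmultiples (1 : ℝ))
  obtain ⟨j, rfl⟩ := AddSubgroup.mem_zmultiples_iff.mp hw
  rw [zsmul_eq_mul, mul_one_div, leftTranslation_mul,
    ← sum_cutoff hN (leftTranslation (Heisenberg.central _) _)]
  refine Submodule.sum_mem _ fun n _ => ?_
  have hm : Measurable fun x : ℝ => centralChar (j / N) ((n : ℕ) + Int.fract x) :=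
    (continuous_centralChar _).measurable.comp (measurable_fract.const_add _)
  have hp : Function.Periodic (fun x : ℝ => centralChar (j / N) ((n : ℕ) + Int.fract x)) 1 :=
    fun x => by simp only [Int.fract_add_one]
  rw [leftTranslation_central_eq, cutoff, multiplier_multiplier_congr (hq := hm)
    (hq' := measurable_cutoffFun N n) (bq := fun x => (norm_centralChar _ _).le)
    (bq' := norm_cutoffFun_le N n) (centralChar_mul_cutoffFun hN j)]
  refine multiplier_mem hW.1 one_pos (fun k g hg => ?_) _ _ _ hp (h n _ (hW.2 s' hs' f hf))
  rw [div_one]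
  exact hW.central_mem k hg

/-- The cut-off is idempotent and maps `W` into itself, so the image is the part of `W` fixed by it,
which is closed. Invariance holds as cut-offs commute with translations. -/
theorem IsTranslationInvariant.map_cutoff {N : ℕ} (hN : 0 < N) {S : Set (Heisenberg d)}
    (hW : IsTranslationInvariant S W) {n : ℕ} (h : ∀ f ∈ W, cutoff N n f ∈ W) :
    IsTranslationInvariant S (W.map (cutoff N n).toLinearMap) := by
  constructor
  · have heq : (W.map (cutoff N n).toLinearMap : Set (HeisenbergL2 d)) =
        (W : Set (HeisenbergL2 d)) ∩ {f | cutoff N n f = f} := by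
      ext f
      constructor
      · rintro ⟨g, hg, rfl⟩
        exact ⟨h g hg, cutoff_cutoff N n g⟩
      · exact fun hf => ⟨f, hf.1, hf.2⟩
    rw [heq]
    exact hW.1.inter (isClosed_eq (cutoff N n).continuous continuous_id)
  · rintro s hs _ ⟨f, hf, rfl⟩
    exact ⟨_, hW.2 s hs f hf, (leftTranslation_multiplier s (by exact_mod_cast hN) _ _ _
      (periodic_cutoffFun N n) f).symm⟩

end TranslationSets

theorem mainTheorem5 (d : ℕ) (A B : GL (Fin d) ℝ)
    (hAB : ∃ M : Matrix (Fin d) (Fin d) ℤ,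
      (A : Matrix (Fin d) (Fin d) ℝ) * (B : Matrix (Fin d) (Fin d) ℝ).transpose
        = M.map (fun m : ℤ => (m : ℝ)))
    (N : ℕ) (hN : 0 < N)
    (W : Submodule ℂ (HeisenbergL2 d))
    (hW : IsTranslationInvariant (translationSet A B (AddSubgroup.zmultiples (1 : ℝ))) W) :
    (IsTranslationInvariant (translationSet A B (AddSubgroup.zmultiples (1 / (N : ℝ)))) W ↔
      ∀ n : Fin N, cutoffSpace W N n ⊆ (W : Set (HeisenbergL2 d))) ∧
    (IsTranslationInvariant (translationSet A B (AddSubgroup.zmultiples (1 / (N : ℝ)))) W →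
      ∃ V : Fin N → Submodule ℂ (HeisenbergL2 d),
        (∀ n : Fin N, (V n : Set (HeisenbergL2 d)) = cutoffSpace W N n) ∧
        (∀ n : Fin N,
          IsTranslationInvariant (translationSet A B (AddSubgroup.zmultiples (1 : ℝ))) (V n)) ∧
        OrthogonalFamily ℂ (fun n => V n) (fun n => (V n).subtypeₗᵢ) ∧
        W = ⨆ n, V n ∧
        ∀ᵐ ξ ∂(volume.restrict (Ico (0 : ℝ) 1)),
          dimFunction W ξ = ∑ n : Fin N, dimFunction (V n) ξ) := by
  refine ⟨⟨fun h n => ?_, fun h => hW.refine hN fun n f hf => h n ?_⟩, fun h => ?_⟩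
  · rw [cutoffSpace_eq]
    rintro _ ⟨f, hf, rfl⟩
    exact h.cutoff_mem hN n hf
  · rw [cutoffSpace_eq]
    exact ⟨f, hf, rfl⟩
  have hinv : ∀ n : Fin N, IsTranslationInvariant
      (translationSet A B (AddSubgroup.zmultiples (1 : ℝ))) (W.map (cutoff N n).toLinearMap) :=
    fun n => hW.map_cutoff hN fun f hf => h.cutoff_mem hN n hf
  have hortho : Pairwise fun n m : Fin N =>
      W.map (cutoff N n).toLinearMap ⟂ W.map (cutoff N m).toLinearMap := by
    intro n m hnm
    rw [Submodule.isOrtho_iff_inner_eq]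
    rintro _ ⟨f, -, rfl⟩ _ ⟨g, -, rfl⟩
    exact inner_cutoff_cutoff hnm f g
  have hle : ∀ n : Fin N, W.map (cutoff N n).toLinearMap ≤ W := by
    rintro n _ ⟨f, hf, rfl⟩
    exact h.cutoff_mem hN n hf
  refine ⟨fun n => W.map (cutoff N n).toLinearMap, fun n => (cutoffSpace_eq W N n).symm, hinv,
    OrthogonalFamily.of_pairwise hortho, le_antisymm (fun f hf => ?_) (iSup_le hle), ?_⟩
  · rw [← sum_cutoff hN f]
    exact Submodule.sum_mem _ fun n _ => Submodule.mem_iSup_of_mem n ⟨f, hf, rfl⟩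
  -- Fiberization is unitary, so the orthogonal decomposition is carried over to the fibred spaces,
  -- where dimensions add almost everywhere.
  · refine (isRangeFamily_rangeFunction hW.1 fun k f hf => hW.central_mem k hf
      ).ae_toENat_rank_eq_sum (fun n : Fin N => isRangeFamily_rangeFunction (hinv n).1
        fun k f hf => (hinv n).central_mem k hf) (fun n m hnm => ?_)
      (fun n => Submodule.map_mono (hle n)) ?_
    · refine Submodule.isOrtho_iff_inner_eq.mpr ?_
      rintro _ ⟨f, hf, rfl⟩ _ ⟨g, hg, rfl⟩
      exact ((fiberizationEquiv d).inner_map_map f g).trans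
        (Submodule.isOrtho_iff_inner_eq.mp (hortho hnm) f hf g hg)
    · rintro _ ⟨f, hf, rfl⟩
      refine ⟨fun n => fiberizationEquiv d (cutoff N n f), fun n => ⟨_, ⟨f, hf, rfl⟩, rfl⟩, ?_⟩
      rw [← map_sum, sum_cutoff hN]
      rfl

end
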